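/- Let $\Sigma$ be a compact Riemannian surface with smooth boundary $\partial\Sigma$ (possibly empty), let $\Delta=\operatorname{div}\nabla\le 0$ be its Laplace--Beltrami operator, let $V\in L^\infty(\Sigma)$ be real-valued, and put $L_0=\Delta+V$. Let $H^1(\Sigma)$ be the Sobolev space of real functions $u\in L^2(\Sigma)$ with weak gradient $\nabla u\in L^2$, let $u|_{\partial\Sigma}\in L^2(\partial\Sigma)$ denote the trace of $u\in H^1(\Sigma)$, let $H^{1/2}(\partial\Sigma)$ be the space of all such traces, and let $H^1_0(\Sigma)$ be the space of all $u\in H^1(\Sigma)$ with trace $0$. For $u\in H^1(\Sigma)$ set $$Q^D[u]=\int_\Sigma|\nabla u|^2-\int_\Sigma V u^2 .$$ Let $\lambda_0^D(L_0)$ be the first Dirichlet eigenvalue of $L_0$, that is, the smallest $\lambda\in\mathbb R$ for which there is a nonzero $u\in H^1_0(\Sigma)$ with $\Delta u+Vu+\lambda u=0$ weakly, i.e. $\int_\Sigma\langle\nabla u,\nabla\varphi\rangle-\int_\Sigma Vu\varphi=\lambda\int_\Sigma u\varphi$ for all $\varphi\in H^1_0(\Sigma)$. Assume $\lambda_0^D(L_0)>0$.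 Let $h\in H^{1/2}(\partial\Sigma)$ and $\mathcal A_h=\{u\in H^1(\Sigma): u|_{\partial\Sigma}=h\}$. Then there is a unique $\widehat h\in\mathcal A_h$ such that $$Q^D[\widehat h]=\min_{u\in\mathcal A_h}Q^D[u].$$ Moreover, $\widehat h$ is the unique weak solution of $L_0u=0$ in $\Sigma$ with trace $h$, i.e. the unique $u\in\mathcal A_h$ such that $\int_\Sigma\langle\nabla u,\nabla\varphi\rangle-\int_\Sigma Vu\varphi=0$ for all $\varphi\in H^1_0(\Sigma)$. -/

import Mathlib

open Set Filter Topology MeasureTheory Bundle Manifold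
open scoped ENNReal ContDiff

noncomputable section

namespace DirichletSurface

/-- The Euclidean plane, in which the charts of a surface take their values. -/
abbrev Plane : Type := EuclideanSpace ℝ (Fin 2)

section Measures

variable (M : Type*) [EMetricSpace M] [MeasurableSpace M] [BorelSpace M]

/-- The Riemannian area: the two-dimensional Hausdorff measure of the Riemannian distance,
normalised so as to be Lebesgue measure in the Euclidean plane. -/
def area : Measure M := μHE[2]

variable [ChartedSpace (EuclideanHalfSpace 2) M]

/-- Arc length on the boundary: the (normalised) one-dimensional Hausdorff measure of the Riemannian
distance, restricted to the manifold boundary. -/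
def boundaryLength : Measure M := (μHE[1] : Measure M).restrict ((𝓡∂ 2).boundary M)

end Measures

variable {M : Type*} [EMetricSpace M] [MeasurableSpace M] [BorelSpace M]
  [ChartedSpace (EuclideanHalfSpace 2) M]
  [RiemannianBundle (fun x : M ↦ TangentSpace (𝓡∂ 2) x)]

/-- A (not necessarily continuous) tangent vector field. -/
abbrev TangentField (M : Type*) [EMetricSpace M] [ChartedSpace (EuclideanHalfSpace 2) M] : Type _ :=
  (x : M) → TangentSpace (𝓡∂ 2) x

/-- The components of a vector field, on the domain of the chart at `p`, in that chart. -/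
def chartComponents (p : M) (X : TangentField M) (x : M) : Plane :=
  mfderiv (𝓡∂ 2) 𝓘(ℝ, Plane) (extChartAt (𝓡∂ 2) p) x (X x)

/-- Square-integrable vector fields: the components in every chart are measurable, and
`∫ |X|² < ∞` for the Riemannian norm and the Riemannian area. -/
def IsL2Field (X : TangentField M) : Prop :=
  (∀ p : M, AEMeasurable (chartComponents p X)
    ((area M).restrict (chartAt (EuclideanHalfSpace 2) p).source)) ∧
  ∫⁻ x, ‖X x‖ₑ ^ 2 ∂(area M) < ⊤

/-- `X` is the weak gradient of `u` on the interior of the surface: for every chart `φ` and every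
direction `e` of the plane, `∂_e (u ∘ φ⁻¹) (y) = ⟨X (φ⁻¹ y), dφ⁻¹_y e⟩` in the sense of
distributions on the interior of the image of `φ`. -/
def IsWeakGradient (u : M → ℝ) (X : TangentField M) : Prop :=
  ∀ (p : M) (e : Plane) (ψ : Plane → ℝ), ContDiff ℝ ∞ ψ → HasCompactSupport ψ →
    tsupport ψ ⊆ interior (extChartAt (𝓡∂ 2) p).target →
    ∫ y, u ((extChartAt (𝓡∂ 2) p).symm y) * fderiv ℝ ψ y e =
      - ∫ y, inner ℝ (X ((extChartAt (𝓡∂ 2) p).symm y))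
          (mfderivWithin 𝓘(ℝ, Plane) (𝓡∂ 2) (extChartAt (𝓡∂ 2) p).symm (range (𝓡∂ 2)) y e) * ψ y

/-- The space `H¹`: square-integrable functions with a square-integrable weak gradient. -/
def H1 : Set (Lp ℝ 2 (area M)) :=
  {u | ∃ X : TangentField M, IsL2Field X ∧ IsWeakGradient u X}

open Classical in
/-- The weak gradient of a function in `H¹` (zero outside `H¹`). It is unique up to equality almost
everywhere. -/
def weakGrad (u : Lp ℝ 2 (area M)) : TangentField M :=
  if hu : ∃ X : TangentField M, IsL2Field X ∧ IsWeakGradient u X then hu.choose else fun _ ↦ 0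

/-- The classical gradient, dual to the differential for the Riemannian metric. -/
def grad (f : M → ℝ) : TangentField M := fun x ↦
  haveI : FiniteDimensional ℝ (TangentSpace (𝓡∂ 2) x) :=
    inferInstanceAs (FiniteDimensional ℝ Plane)
  haveI : CompleteSpace (TangentSpace (𝓡∂ 2) x) := FiniteDimensional.complete ℝ _
  (InnerProductSpace.toDual ℝ (TangentSpace (𝓡∂ 2) x)).symm
    (mfderiv (𝓡∂ 2) 𝓘(ℝ, ℝ) f x)

/-- `u ∈ H¹` has boundary trace `h`: `u` is the limit in the `H¹` norm of functions, smooth up to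
the boundary, whose restrictions to the boundary converge to `h` in `L²` of the boundary. -/
def HasTrace (u : Lp ℝ 2 (area M)) (h : Lp ℝ 2 (boundaryLength M)) : Prop :=
  u ∈ H1 ∧ ∃ f : ℕ → M → ℝ, (∀ n, ContMDiff (𝓡∂ 2) 𝓘(ℝ, ℝ) ∞ (f n)) ∧
    Tendsto (fun n ↦ ∫⁻ x, ‖u x - f n x‖ₑ ^ 2 ∂(area M)) atTop (𝓝 0) ∧
    Tendsto (fun n ↦ ∫⁻ x, ‖weakGrad u x - grad (f n) x‖ₑ ^ 2 ∂(area M)) atTop (𝓝 0) ∧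
    Tendsto (fun n ↦ ∫⁻ x, ‖h x - f n x‖ₑ ^ 2 ∂(boundaryLength M)) atTop (𝓝 0)

/-- The space `H^{1/2}` of the boundary, as the space of traces of functions in `H¹`. -/
def HHalf : Set (Lp ℝ 2 (boundaryLength M)) := {h | ∃ u : Lp ℝ 2 (area M), HasTrace u h}

/-- The functions in `H¹` with trace `h`. -/
def traceClass (h : Lp ℝ 2 (boundaryLength M)) : Set (Lp ℝ 2 (area M)) := {u | HasTrace u h}

/-- The space `H¹₀`: the functions in `H¹` with zero trace. -/
def H10 : Set (Lp ℝ 2 (area M)) := traceClass 0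

/-- The quadratic form `Q[u] = ∫ |∇u|² - ∫ V u²`. -/
def energy (V : M → ℝ) (u : Lp ℝ 2 (area M)) : ℝ :=
  ∫ x, ‖weakGrad u x‖ ^ 2 ∂(area M) - ∫ x, V x * u x ^ 2 ∂(area M)

/-- `u ∈ H¹` is a weak solution of `Δu + Vu + λu = 0` in the interior:
`∫ ⟨∇u, ∇φ⟩ - ∫ V u φ = λ ∫ u φ` for all `φ ∈ H¹₀`. -/
def IsWeakSolution (V : M → ℝ) (lam : ℝ) (u : Lp ℝ 2 (area M)) : Prop :=
  u ∈ H1 ∧ ∀ φ ∈ (H10 : Set (Lp ℝ 2 (area M))),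
    ∫ x, inner ℝ (weakGrad u x) (weakGrad φ x) ∂(area M) - ∫ x, V x * u x * φ x ∂(area M) =
      lam * ∫ x, u x * φ x ∂(area M)

/-- The Dirichlet eigenvalues of `Δ + V`: the `λ` for which `Δu + Vu + λu = 0` has a nonzero weak
solution with zero trace. -/
def dirichletEigenvalues (V : M → ℝ) : Set ℝ :=
  {lam | ∃ u ∈ (H10 : Set (Lp ℝ 2 (area M))), u ≠ 0 ∧ IsWeakSolution V lam u}

/-- The first Dirichlet eigenvalue of `Δ + V`: the smallest Dirichlet eigenvalue. -/
def firstDirichletEigenvalue (V : M → ℝ) : ℝ := sInf (dirichletEigenvalues V)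

end DirichletSurface

end

/-! Write `B(u, v) = ∫ ⟨∇u, ∇v⟩ - ∫ V u v`. Everything follows once `B` is coercive on `H¹₀`. Given
any `u₀` with trace `h`, Lax–Milgram yields `d₀ ∈ H¹₀` with `B(d₀, φ) = -B(u₀, φ)` for all `φ ∈
H¹₀`, so `u = u₀ + d₀` is a weak solution with trace `h`. Every competitor is `u + d` with `d ∈
H¹₀`, and `Q[u + d] = Q[u] + B(d, d)` because the cross term vanishes. Positivity of `B` then makes
`u` the only minimiser, and testing with `d` itself makes it the only weak solution.

Coercivity is where `λ₀ > 0` enters. The infimum `μ` of `B(v, v)` over `‖v‖_{L²} = 1` in `H¹₀` is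
attained, and the minimiser is an eigenfunction with eigenvalue `μ`; hence `μ ≥ λ₀ > 0`. Combined
with `B(v, v) ≥ ‖∇v‖² - ‖V‖_∞ ‖v‖²` this bounds `B` below by the full `H¹` norm. The abstract
Hilbert space argument is `exists_rayleigh_minimizer` and `form_pos_and_representation`.

Attainment needs a Rellich theorem. It is used in the quantitative form `‖u‖² ≤ ε ‖∇u‖² + ∑ l_j(u)²`
with finitely many functionals `l_j` depending on `ε` (`exists_functionals_traceTriple`). In the
plane it comes from the Poincaré inequality on the cells of a fine grid (`exists_finite_averages`).
It is carried to the surface by charts that are locally bi-Lipschitz for the Riemannian distance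
(`exists_bilipschitz_chart`), since Lipschitz maps control Hausdorff measure.

To have a Hilbert space at all, vector fields are read in a measurable orthonormal frame `J`, which
turns `L²` fields into elements of `Lp Plane 2`. The pairs (function, weak gradient) then form a
closed subspace of `L² × L²` (`isClosed_weakGraph`), the weak gradient is unique
(`eq_zero_of_mem_weakGraph`), and zero trace is a closed linear condition
(`IsTraceTriple.of_approx`). Uniqueness of the trace is never needed. -/

namespace DirichletSurface

open scoped NNReal

/-! ### Hilbert space part: Rayleigh quotients, coercivity and Lax–Milgram. -/

section Abstract

variable {H L G : Type*} [NormedAddCommGroup H] [InnerProductSpace ℝ H]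
  [NormedAddCommGroup L] [InnerProductSpace ℝ L] [NormedAddCommGroup G] [InnerProductSpace ℝ G]

/-- The bilinear form `⟨Sx, Sy⟩ - ⟨A T x, T y⟩`. -/
noncomputable def formBilin (T : H →L[ℝ] L) (S : H →L[ℝ] G) (A : L →L[ℝ] L) : H →L[ℝ] H →L[ℝ] ℝ :=
  (innerSL ℝ).bilinearComp S S - (innerSL ℝ).bilinearComp (A.comp T) T

lemma formBilin_apply (T : H →L[ℝ] L) (S : H →L[ℝ] G) (A : L →L[ℝ] L) (x y : H) :
    formBilin T S A x y = inner ℝ (S x) (S y) - inner ℝ (A (T x)) (T y) := rfl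

lemma formBilin_symm {T : H →L[ℝ] L} {S : H →L[ℝ] G} {A : L →L[ℝ] L}
    (hA : ∀ u v, inner ℝ (A u) v = inner ℝ u (A v)) (x y : H) :
    formBilin T S A x y = formBilin T S A y x := by
  rw [formBilin_apply, formBilin_apply, real_inner_comm, hA, real_inner_comm (T x)]

/-- The finitely many functionals map the ball to a bounded, hence totally bounded, subset of `ℝᵐ`.
Two points of the ball whose values there are close have close images under `T`, because the `S`
term is bounded on the ball and carries a small factor. -/
lemma totallyBounded_image_of_finite_functionals {T : H →L[ℝ] L} {S : H →L[ℝ] G}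
    (hnorm : ∀ x, ‖x‖ ^ 2 = ‖T x‖ ^ 2 + ‖S x‖ ^ 2)
    (hcomp : ∀ ε > 0, ∃ (m : ℕ) (l : Fin m → (L →L[ℝ] ℝ)), ∀ x : H,
      ‖T x‖ ^ 2 ≤ ε * ‖S x‖ ^ 2 + ∑ j, l j (T x) ^ 2) (R : ℝ) :
    TotallyBounded (T '' Metric.closedBall 0 R) := by
  refine Metric.totallyBounded_of_finite_discretization fun ε hε ↦ ?_
  set R' := |R| + 1
  have hR' : 0 < R' := by positivity
  -- Differences of points of the ball have norm at most `2 R'`, so this factor makes the `S` term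
  -- at most `ε² / 2`; the choice of `δ` below keeps the functionals under `ε² / 4`.
  obtain ⟨m, l, hl⟩ := hcomp (ε ^ 2 / (8 * R' ^ 2)) (by positivity)
  let Λ : H →L[ℝ] (Fin m → ℝ) := ContinuousLinearMap.pi fun j ↦ (l j).comp T
  have hb : TotallyBounded (Λ '' Metric.closedBall 0 R) := by
    have : Bornology.IsBounded (Λ '' Metric.closedBall 0 R) := by
      exact (Λ.lipschitz.isBounded_image Metric.isBounded_closedBall)
    exact this.isCompact_closure.totallyBounded.subset subset_closure
  obtain ⟨δ, hδ, hδm⟩ : ∃ δ > 0, (m : ℝ) * (2 * δ) ^ 2 < ε ^ 2 / 4 := by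
    refine ⟨ε / (4 * (m + 1)), by positivity, ?_⟩
    have : (0 : ℝ) ≤ m := by positivity
    rw [show (m : ℝ) * (2 * (ε / (4 * (m + 1)))) ^ 2 = ε ^ 2 / 4 * (m / (m + 1) ^ 2) by
      field_simp; ring]
    have h2 : (m : ℝ) / (m + 1) ^ 2 < 1 := by
      rw [div_lt_one (by positivity)]; nlinarith
    have : 0 < ε ^ 2 / 4 := by positivity
    nlinarith
  obtain ⟨t, ht, hcov⟩ := Metric.totallyBounded_iff.1 hb δ hδ
  have hex : ∀ x : ↥(T '' Metric.closedBall (0 : H) R), ∃ z : H, z ∈ Metric.closedBall 0 R ∧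
      T z = x := fun x ↦ x.2
  choose z hz hzx using hex
  have hex2 : ∀ x, ∃ y ∈ t, Λ (z x) ∈ Metric.ball y δ := fun x ↦ by
    simpa using hcov (mem_image_of_mem _ (hz x))
  choose y hy hyz using hex2
  have := ht.fintype
  have hcong : ∀ x x', y x = y x' → dist x x' < ε := by
    intro x x' hxx
    rw [Subtype.dist_eq, ← hzx x, ← hzx x', dist_eq_norm, ← map_sub]
    have hd : dist (Λ (z x)) (Λ (z x')) < 2 * δ := by
      have h1 := hyz x
      have h2 := hyz x'
      rw [Metric.mem_ball] at h1 h2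
      rw [← hxx] at h2
      calc _ ≤ _ := dist_triangle_right _ _ (y x)
        _ < _ := by linarith
    have hj : ∀ j, (l j (T (z x - z x'))) ^ 2 ≤ (2 * δ) ^ 2 := by
      intro j
      have : dist (Λ (z x) j) (Λ (z x') j) ≤ _ := dist_le_pi_dist (Λ (z x)) (Λ (z x')) j
      rw [Real.dist_eq] at this
      have h3 : l j (T (z x - z x')) = Λ (z x) j - Λ (z x') j := by simp [Λ]
      rw [h3, ← sq_abs]
      exact pow_le_pow_left₀ (abs_nonneg _) (by linarith) 2
    have hS : ‖S (z x - z x')‖ ^ 2 ≤ (2 * R') ^ 2 := by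
      have h1 : ‖z x - z x'‖ ≤ 2 * R' := by
        have h1 := mem_closedBall_zero_iff.1 (hz x)
        have h2 := mem_closedBall_zero_iff.1 (hz x')
        have := le_abs_self R
        calc _ ≤ _ := norm_sub_le _ _
          _ ≤ _ := by simp only [R']; linarith
      have := hnorm (z x - z x')
      have h4 := pow_le_pow_left₀ (norm_nonneg _) h1 2
      nlinarith [sq_nonneg ‖T (z x - z x')‖]
    have hfin : ‖T (z x - z x')‖ ^ 2 < ε ^ 2 := by
      have h1 := hl (z x - z x')
      have h2 : ∑ j, l j (T (z x - z x')) ^ 2 ≤ m * (2 * δ) ^ 2 := by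
        calc _ ≤ ∑ j : Fin m, (2 * δ) ^ 2 := Finset.sum_le_sum fun j _ ↦ hj j
          _ = _ := by simp
      have h3 : ε ^ 2 / (8 * R' ^ 2) * ‖S (z x - z x')‖ ^ 2 ≤ ε ^ 2 / 2 := by
        calc _ ≤ ε ^ 2 / (8 * R' ^ 2) * (2 * R') ^ 2 := by gcongr
          _ = _ := by field_simp; ring
      have : 0 < ε ^ 2 := by positivity
      linarith
    exact lt_of_pow_lt_pow_left₀ 2 hε.le hfin
  let e := Fintype.equivFin t
  exact ⟨ULift (Fin (Fintype.card t)), inferInstance, fun x ↦ ⟨e ⟨y x, hy x⟩⟩,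
    fun x x' hxx ↦ hcong x x' (by simpa using hxx)⟩

variable [CompleteSpace H] [CompleteSpace L]

/-- The Rayleigh quotient of `⟨Sx, Sx⟩ - ⟨A T x, T x⟩` over `‖T x‖ = 1` attains its infimum, at an
eigenvector, as soon as `T` is compact relative to `S`. -/
lemma exists_rayleigh_minimizer {T : H →L[ℝ] L} {S : H →L[ℝ] G} {A : L →L[ℝ] L}
    (hA : ∀ u v, inner ℝ (A u) v = inner ℝ u (A v))
    (hnorm : ∀ x, ‖x‖ ^ 2 = ‖T x‖ ^ 2 + ‖S x‖ ^ 2)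
    (hcomp : ∀ ε > 0, ∃ (m : ℕ) (l : Fin m → (L →L[ℝ] ℝ)), ∀ x : H,
      ‖T x‖ ^ 2 ≤ ε * ‖S x‖ ^ 2 + ∑ j, l j (T x) ^ 2)
    (hne : ∃ x, T x ≠ 0) :
    ∃ (μ : ℝ) (y : H), y ≠ 0 ∧ (∀ z, formBilin T S A y z = μ * inner ℝ (T y) (T z)) ∧
      ∀ z, μ * ‖T z‖ ^ 2 ≤ formBilin T S A z z := by
  set b := formBilin T S A with hb
  have hAbd : ∀ x, |inner ℝ (A (T x)) (T x)| ≤ ‖A‖ * ‖T x‖ ^ 2 := fun x ↦ by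
    calc _ ≤ ‖A (T x)‖ * ‖T x‖ := abs_real_inner_le_norm _ _
      _ ≤ ‖A‖ * ‖T x‖ * ‖T x‖ := by gcongr; exact A.le_opNorm _
      _ = _ := by ring
  have hbxx : ∀ x, b x x = ‖S x‖ ^ 2 - inner ℝ (A (T x)) (T x) := fun x ↦ by
    rw [hb, formBilin_apply, real_inner_self_eq_norm_sq]
  set Rq : Set ℝ := {r | ∃ x, ‖T x‖ = 1 ∧ b x x = r} with hRq
  have hscale : ∀ (c : ℝ) x, b (c • x) (c • x) = c ^ 2 * b x x := fun c x ↦ by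
    simp only [map_smul, smul_apply, smul_eq_mul]; ring
  have hRne : Rq.Nonempty := by
    obtain ⟨x, hx⟩ := hne
    exact ⟨_, ‖T x‖⁻¹ • x, by simp [norm_smul, hx], rfl⟩
  have hRbd : BddBelow Rq := by
    refine ⟨-‖A‖, ?_⟩
    rintro _ ⟨x, hx, rfl⟩
    have := hAbd x
    rw [hx] at this
    rw [hbxx]
    have := (abs_le.1 this).2
    nlinarith [sq_nonneg ‖S x‖]
  set μ := sInf Rq with hμ
  have hlow : ∀ z, μ * ‖T z‖ ^ 2 ≤ b z z := by
    intro z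
    by_cases hz : T z = 0
    · rw [hbxx, hz]; simp
    · have h1 : μ ≤ b (‖T z‖⁻¹ • z) (‖T z‖⁻¹ • z) :=
        csInf_le hRbd ⟨_, by simp [norm_smul, hz], rfl⟩
      rw [hscale] at h1
      have h2 : 0 < ‖T z‖ := by simpa using hz
      calc μ * ‖T z‖ ^ 2 ≤ (‖T z‖⁻¹ ^ 2 * b z z) * ‖T z‖ ^ 2 := by gcongr
        _ = b z z := by field_simp
  obtain ⟨r, -, hr, hrR⟩ := exists_seq_tendsto_sInf hRne hRbd
  choose x hx1 hxr using hrR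
  obtain ⟨C, hC⟩ : ∃ C, ∀ n, r n ≤ C := by
    obtain ⟨C, hC⟩ := hr.bddAbove_range
    exact ⟨C, fun n ↦ hC ⟨n, rfl⟩⟩
  have hxbd : ∀ n, x n ∈ Metric.closedBall (0 : H) (√(1 + C + ‖A‖)) := by
    intro n
    rw [mem_closedBall_zero_iff]
    apply Real.le_sqrt_of_sq_le
    have h1 := hbxx (x n)
    have h2 := (abs_le.1 (hAbd (x n))).2
    have h3 := hC n
    rw [hnorm, hx1]
    rw [hx1] at h2
    rw [hxr] at h1
    linarith
  have htb := totallyBounded_image_of_finite_functionals hnorm hcomp (√(1 + C + ‖A‖))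
  obtain ⟨a, -, φ, hφ, hφa⟩ := (htb.closure.isCompact_of_isClosed isClosed_closure).tendsto_subseq
    (x := fun n ↦ T (x n)) fun n ↦ subset_closure (mem_image_of_mem _ (hxbd n))
  have hcT : CauchySeq fun n ↦ T (x (φ n)) := hφa.cauchySeq
  have hrφ : Tendsto (fun n ↦ r (φ n)) atTop (𝓝 μ) := hr.comp hφ.tendsto_atTop
  -- The parallelogram law for `b` and for `‖T ·‖²`, with the lower bound `hlow` at `p + q`, shows
  -- that a minimising sequence which is Cauchy after `T` is already Cauchy in `H`. No weak
  -- convergence or semicontinuity is needed.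
  have hkey : ∀ n m, ‖x (φ n) - x (φ m)‖ ^ 2 ≤ (1 + ‖A‖ + |μ|) * ‖T (x (φ n)) - T (x (φ m))‖ ^ 2
      + 2 * (r (φ n) - μ) + 2 * (r (φ m) - μ) := by
    intro n m
    set p := x (φ n)
    set q := x (φ m)
    have h1 := hbxx (p - q)
    have h2 := (abs_le.1 (hAbd (p - q))).2
    have h3 := hlow (p + q)
    have h4 : b (p - q) (p - q) = 2 * b p p + 2 * b q q - b (p + q) (p + q) := by
      simp only [map_sub, map_add, sub_apply, add_apply]
      ring
    have h5 : ‖T (p + q)‖ ^ 2 = 4 - ‖T (p - q)‖ ^ 2 := by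
      have := parallelogram_law_with_norm ℝ (T p) (T q)
      rw [hx1, hx1] at this
      rw [map_add, map_sub]
      nlinarith
    have h6 : b p p = r (φ n) := hxr _
    have h7 : b q q = r (φ m) := hxr _
    have h8 := neg_abs_le μ
    have h9 : μ ≤ |μ| := le_abs_self μ
    have h10 := sq_nonneg ‖T (p - q)‖
    rw [hnorm, ← map_sub]
    rw [h5] at h3
    nlinarith
  have hcx : CauchySeq fun n ↦ x (φ n) := by
    rw [Metric.cauchySeq_iff']
    intro ε hε
    set K := 1 + ‖A‖ + |μ|
    have hK : 0 < K := by positivity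
    obtain ⟨N₁, hN₁⟩ := Metric.cauchySeq_iff.1 hcT (ε / (2 * √K)) (by positivity)
    obtain ⟨N₂, hN₂⟩ := (Metric.tendsto_atTop.1 hrφ) (ε ^ 2 / 8) (by positivity)
    refine ⟨max N₁ N₂, fun n hn ↦ ?_⟩
    have e1 := hN₁ n (le_of_max_le_left hn) (max N₁ N₂) (le_max_left _ _)
    have e2 := hN₂ n (le_of_max_le_right hn)
    have e3 := hN₂ (max N₁ N₂) (le_max_right _ _)
    have h := hkey n (max N₁ N₂)
    rw [dist_eq_norm] at e1 ⊢
    rw [Real.dist_eq, abs_lt] at e2 e3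
    have e4 : K * ‖T (x (φ n)) - T (x (φ (max N₁ N₂)))‖ ^ 2 ≤ ε ^ 2 / 4 := by
      calc _ ≤ K * (ε / (2 * √K)) ^ 2 := by gcongr
        _ = _ := by rw [div_pow, mul_pow, Real.sq_sqrt hK.le]; field_simp; ring
    refine lt_of_pow_lt_pow_left₀ 2 hε.le ?_
    nlinarith [e2.2, e3.2, sq_pos_of_pos hε]
  obtain ⟨y, hy⟩ := cauchySeq_tendsto_of_complete hcx
  have hTy : ‖T y‖ = 1 := by
    have h1 : Tendsto (fun n ↦ ‖T (x (φ n))‖) atTop (𝓝 ‖T y‖) :=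
      ((T.continuous.tendsto y).comp hy).norm
    simp only [hx1] at h1
    exact (tendsto_nhds_unique h1 tendsto_const_nhds)
  have hby : b y y = μ := by
    have h1 : Tendsto (fun n ↦ b (x (φ n)) (x (φ n))) atTop (𝓝 (b y y)) := by
      have hc : Continuous fun z ↦ b z z := by fun_prop
      exact (hc.tendsto y).comp hy
    simp only [hxr] at h1
    exact tendsto_nhds_unique h1 hrφ
  refine ⟨μ, y, fun h0 ↦ by simp [h0] at hTy, fun z ↦ ?_, hlow⟩
  -- First variation: `2 t p + t² q` is the excess of `b` over `μ ‖T ·‖²` at `y + t z`. It is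
  -- nonnegative for every `t`, which forces `p = 0`.
  set p := b y z - μ * inner ℝ (T y) (T z) with hp
  set q := b z z - μ * ‖T z‖ ^ 2 with hq
  have hq0 : 0 ≤ q := by have := hlow z; linarith
  have hquad : ∀ t : ℝ, 0 ≤ 2 * t * p + t ^ 2 * q := by
    intro t
    have hsymm : b z y = b y z := formBilin_symm hA z y
    have h1 := hlow (y + t • z)
    have h2 : b (y + t • z) (y + t • z) = μ + 2 * t * b y z + t ^ 2 * b z z := by
      simp only [map_add, map_smul, add_apply, smul_apply,
        smul_eq_mul, hby, hsymm]
      ring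
    have h3 : ‖T (y + t • z)‖ ^ 2 = 1 + 2 * t * inner ℝ (T y) (T z) + t ^ 2 * ‖T z‖ ^ 2 := by
      rw [map_add, map_smul, norm_add_sq_real, hTy, inner_smul_right, norm_smul, mul_pow,
        Real.norm_eq_abs, sq_abs]
      ring
    rw [h2, h3] at h1
    rw [hp, hq]
    linarith
  have hp0 : p = 0 := by
    -- The denominator is `q + 1` because `q` may vanish.
    have h1 := hquad (-p / (q + 1))
    have h2 : 2 * (-p / (q + 1)) * p + (-p / (q + 1)) ^ 2 * q = -(p ^ 2 * (q + 2)) / (q + 1) ^ 2 := by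
      field_simp; ring
    rw [h2, le_div_iff₀ (by positivity)] at h1
    have h3 : p ^ 2 ≤ 0 := by nlinarith [sq_nonneg p]
    exact pow_eq_zero_iff (two_ne_zero) |>.1 (le_antisymm h3 (sq_nonneg p))
  linarith

/-- If the smallest eigenvalue of `⟨Sx, Sx⟩ - ⟨A T x, T x⟩` is positive, then the form is positive
definite, and it represents every continuous functional. -/
lemma form_pos_and_representation {T : H →L[ℝ] L} {S : H →L[ℝ] G} {A : L →L[ℝ] L}
    (hA : ∀ u v, inner ℝ (A u) v = inner ℝ u (A v))
    (hnorm : ∀ x, ‖x‖ ^ 2 = ‖T x‖ ^ 2 + ‖S x‖ ^ 2)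
    (hcomp : ∀ ε > 0, ∃ (m : ℕ) (l : Fin m → (L →L[ℝ] ℝ)), ∀ x : H,
      ‖T x‖ ^ 2 ≤ ε * ‖S x‖ ^ 2 + ∑ j, l j (T x) ^ 2)
    (hgraph : ∀ x, T x = 0 → S x = 0)
    (heig : ∀ (μ : ℝ) (y : H), y ≠ 0 →
      (∀ z, formBilin T S A y z = μ * inner ℝ (T y) (T z)) → 0 < μ) :
    (∀ x, x ≠ 0 → 0 < formBilin T S A x x) ∧
      ∀ l : H →L[ℝ] ℝ, ∃ x, ∀ z, formBilin T S A x z = l z := by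
  obtain ⟨c, hc, hco⟩ : ∃ c > 0, ∀ x, c * ‖x‖ * ‖x‖ ≤ formBilin T S A x x := by
    by_cases hne : ∃ x, T x ≠ 0
    · obtain ⟨μ, y, hy0, hy, hlow⟩ := exists_rayleigh_minimizer hA hnorm hcomp hne
      have hμ := heig μ y hy0 hy
      -- Adding `μ` times the bound `h1` and `‖A‖ + 1` times the Rayleigh bound `h2` cancels the
      -- negative multiple of `‖T x‖²` and leaves `μ (‖T x‖² + ‖S x‖²)`.
      set K := ‖A‖ + 1 + μ
      have hK : 0 < K := by positivity
      refine ⟨μ / K, by positivity, fun x ↦ ?_⟩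
      have h1 : ‖S x‖ ^ 2 - ‖A‖ * ‖T x‖ ^ 2 ≤ formBilin T S A x x := by
        rw [formBilin_apply, real_inner_self_eq_norm_sq]
        have : inner ℝ (A (T x)) (T x) ≤ ‖A‖ * ‖T x‖ ^ 2 := by
          calc _ ≤ ‖A (T x)‖ * ‖T x‖ := real_inner_le_norm _ _
            _ ≤ ‖A‖ * ‖T x‖ * ‖T x‖ := by gcongr; exact A.le_opNorm _
            _ = _ := by ring
        linarith
      have h2 := hlow x
      have h3 : μ * ‖x‖ ^ 2 ≤ K * formBilin T S A x x := by
        rw [hnorm]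
        have e1 := mul_le_mul_of_nonneg_left h1 hμ.le
        have e2 := mul_le_mul_of_nonneg_left h2 (show 0 ≤ ‖A‖ + 1 by positivity)
        simp only [K]
        nlinarith
      calc μ / K * ‖x‖ * ‖x‖ = μ * ‖x‖ ^ 2 / K := by ring
        _ ≤ _ := by rw [div_le_iff₀ hK]; linarith
    -- If `T` vanishes identically then so does `S`, and the space is trivial.
    · push Not at hne
      refine ⟨1, one_pos, fun x ↦ ?_⟩
      have : x = 0 := by
        have := hnorm x
        rw [hgraph x (hne x), hne x] at this
        simpa using this
      simp [this]
  refine ⟨fun x hx ↦ ?_, fun l ↦ ?_⟩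
  · have : 0 < ‖x‖ := norm_pos_iff.2 hx
    exact lt_of_lt_of_le (by positivity) (hco x)
  -- Lax–Milgram, after representing `l` by a vector through Riesz.
  · have hcoer : IsCoercive (formBilin T S A) := ⟨c, hc, hco⟩
    let w := (InnerProductSpace.toDual ℝ H).symm l
    refine ⟨hcoer.continuousLinearEquivOfBilin.symm w, fun z ↦ ?_⟩
    have := hcoer.continuousLinearEquivOfBilin_apply (hcoer.continuousLinearEquivOfBilin.symm w) z
    rw [← this]
    simp [w]

end Abstract

/-! ### Poincaré inequality on convex sets. -/

section Poincare

lemma ENNReal_add_sq_le (a b : ℝ≥0∞) : (a + b) ^ 2 ≤ 4 * a ^ 2 + 4 * b ^ 2 := by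
  wlog hab : a ≤ b generalizing a b
  · rw [add_comm, add_comm (4 * _)]
    exact this b a (le_of_not_ge hab)
  calc (a + b) ^ 2 ≤ (b + b) ^ 2 := by gcongr
    _ = 4 * b ^ 2 := by rw [← two_mul, mul_pow]; norm_num
    _ ≤ _ := le_add_self

lemma sq_lintegral_le {α : Type*} [MeasurableSpace α] {μ : Measure α} {f : α → ℝ≥0∞}
    (hf : AEMeasurable f μ) : (∫⁻ x, f x ∂μ) ^ 2 ≤ μ univ * ∫⁻ x, f x ^ 2 ∂μ := by
  have h := ENNReal.lintegral_mul_le_Lp_mul_Lq μ Real.HolderConjugate.two_two hf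
    (g := fun _ ↦ 1) aemeasurable_const
  simp only [Pi.mul_apply, mul_one, lintegral_const, ENNReal.rpow_ofNat, one_pow, one_mul] at h
  have hsq : ∀ a : ℝ≥0∞, (a ^ (1 / 2 : ℝ)) ^ 2 = a := fun a ↦ by
    rw [← ENNReal.rpow_natCast, ← ENNReal.rpow_mul]
    simp
  calc _ ≤ _ := pow_le_pow_left' h 2
    _ = _ := by
      rw [mul_pow, mul_comm, hsq, hsq]

/-- Fundamental theorem of calculus along the segment from `y` to `x`, then Cauchy–Schwarz. The
derivative is taken within `Ω` because `Q` may touch the edge of a half-plane; the indicator lets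
the integrand be translated and rescaled over the whole space afterwards. -/
lemma enorm_sub_sq_le_lintegral_segment {E : Type*} [NormedAddCommGroup E] [NormedSpace ℝ E]
    {Ω Q : Set E} {g : E → ℝ} (hΩ : UniqueDiffOn ℝ Ω) (hg : ContDiffOn ℝ 1 g Ω) (hQΩ : Q ⊆ Ω)
    (hQ : Convex ℝ Q) {d : ℝ} (hd : ∀ x ∈ Q, ∀ y ∈ Q, dist x y ≤ d) {x y : E} (hx : x ∈ Q)
    (hy : y ∈ Q) :
    ‖g x - g y‖ₑ ^ 2 ≤ ENNReal.ofReal d ^ 2 *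
      ∫⁻ t in Icc (0 : ℝ) 1, Q.indicator (fun z ↦ ‖fderivWithin ℝ g Ω z‖ₑ ^ 2)
        ((1 - t) • y + t • x) := by
  set γ : ℝ → E := fun t ↦ (1 - t) • y + t • x with hγ
  have hγQ : ∀ t ∈ Icc (0 : ℝ) 1, γ t ∈ Q := fun t ht ↦
    hQ hy hx (by linarith [ht.2]) ht.1 (by ring)
  have hγd : ∀ t, HasDerivAt γ (x - y) t := by
    intro t
    have h1 : HasDerivAt (fun t : ℝ ↦ (1 - t) • y) ((-1 : ℝ) • y) t := by
      simpa using ((hasDerivAt_id t).const_sub 1).smul_const y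
    have h2 : HasDerivAt (fun t : ℝ ↦ t • x) ((1 : ℝ) • x) t := (hasDerivAt_id t).smul_const x
    have h3 := h1.add h2
    have e : (-1 : ℝ) • y + (1 : ℝ) • x = x - y := by module
    rw [e] at h3
    exact h3
  have hγc : ContDiff ℝ 1 γ := by
    simp only [hγ]; fun_prop
  have hmaps : MapsTo γ (Icc 0 1) Ω := fun t ht ↦ hQΩ (hγQ t ht)
  have hcd : ContDiffOn ℝ 1 (g ∘ γ) (Icc 0 1) := hg.comp hγc.contDiffOn hmaps
  have h1 := enorm_sub_le_lintegral_derivWithin_Icc_of_contDiffOn_Icc hcd zero_le_one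
  have hcont : ContinuousOn (fun t ↦ ‖fderivWithin ℝ g Ω (γ t)‖ₑ) (Icc 0 1) :=
    ((hg.continuousOn_fderivWithin hΩ le_rfl).comp hγc.continuous.continuousOn hmaps).enorm
  have h2 : ∀ t ∈ Icc (0 : ℝ) 1, ‖derivWithin (g ∘ γ) (Icc 0 1) t‖ₑ ≤
      ENNReal.ofReal d * ‖fderivWithin ℝ g Ω (γ t)‖ₑ := by
    intro t ht
    rw [fderivWithin_comp_derivWithin t (hg.differentiableOn one_ne_zero _ (hmaps ht))
      (hγd t).differentiableAt.differentiableWithinAt hmaps,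
      (hγd t).hasDerivWithinAt.derivWithin (uniqueDiffOn_Icc zero_lt_one t ht), mul_comm]
    refine (ContinuousLinearMap.le_opENorm _ _).trans ?_
    gcongr
    rw [← ofReal_norm, ← dist_eq_norm]
    exact ENNReal.ofReal_le_ofReal (hd x hx y hy)
  have h3 : ‖g x - g y‖ₑ ≤ ENNReal.ofReal d * ∫⁻ t in Icc (0 : ℝ) 1, ‖fderivWithin ℝ g Ω (γ t)‖ₑ := by
    rw [← lintegral_const_mul' _ _ ENNReal.ofReal_ne_top]
    calc _ = ‖(g ∘ γ) 1 - (g ∘ γ) 0‖ₑ := by simp [hγ]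
      _ ≤ _ := h1
      _ ≤ _ := setLIntegral_mono' measurableSet_Icc h2
  calc _ ≤ _ := pow_le_pow_left' h3 2
    _ = ENNReal.ofReal d ^ 2 * (∫⁻ t in Icc (0 : ℝ) 1, ‖fderivWithin ℝ g Ω (γ t)‖ₑ) ^ 2 := mul_pow _ _ _
    _ ≤ ENNReal.ofReal d ^ 2 * ∫⁻ t in Icc (0 : ℝ) 1, ‖fderivWithin ℝ g Ω (γ t)‖ₑ ^ 2 := by
      gcongr
      simpa using sq_lintegral_le (hcont.aemeasurable (μ := volume) measurableSet_Icc)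
    _ = _ := by
      congr 1
      refine setLIntegral_congr_fun measurableSet_Icc fun t ht ↦ ?_
      simp only [hγ] at hγQ
      simp only [indicator_of_mem (hγQ t ht), hγ]

variable {E : Type*} [NormedAddCommGroup E] [InnerProductSpace ℝ E] [FiniteDimensional ℝ E]
  [MeasurableSpace E] [BorelSpace E]

/-- The Jacobian of the dilation is `t⁻ⁿ ≤ 2ⁿ`. -/
lemma lintegral_add_smul_le {F : E → ℝ≥0∞} (hF : Measurable F) (c : E) {t : ℝ} (ht : 1 / 2 ≤ t) :
    ∫⁻ x, F (c + t • x) ≤ 2 ^ Module.finrank ℝ E * ∫⁻ x, F x := by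
  have ht0 : t ≠ 0 := by linarith
  have h1 : ∫⁻ x, F (c + t • x) = ∫⁻ x, F (c + x) ∂(Measure.map (fun x ↦ t • x) volume) := by
    rw [lintegral_map (by fun_prop) (by fun_prop)]
  rw [h1, Measure.map_addHaar_smul _ ht0, lintegral_smul_measure, lintegral_add_left_eq_self]
  simp only [smul_eq_mul]
  gcongr
  rw [abs_of_nonneg (by positivity), ← ENNReal.ofReal_ofNat, ← ENNReal.ofReal_pow (by norm_num)]
  apply ENNReal.ofReal_le_ofReal
  rw [← inv_pow]
  gcongr
  rw [inv_le_comm₀ (by linarith) (by norm_num)]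
  linarith

/-- The mean square oscillation of a function on a convex set is controlled by its gradient. -/
lemma lintegral_lintegral_sub_sq_le {Ω Q : Set E} {g : E → ℝ} (hΩ : UniqueDiffOn ℝ Ω)
    (hg : ContDiffOn ℝ 1 g Ω) (hQΩ : Q ⊆ Ω) (hQ : Convex ℝ Q) (hQm : MeasurableSet Q) {d : ℝ}
    (hd : ∀ x ∈ Q, ∀ y ∈ Q, dist x y ≤ d) :
    ∫⁻ x in Q, ∫⁻ y in Q, ‖g x - g y‖ₑ ^ 2 ≤ ENNReal.ofReal d ^ 2 *
      (2 ^ Module.finrank ℝ E * (volume Q * ∫⁻ z in Q, ‖fderivWithin ℝ g Ω z‖ₑ ^ 2)) := by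
  set F : E → ℝ≥0∞ := Q.indicator fun z ↦ ‖fderivWithin ℝ g Ω z‖ₑ ^ 2 with hF
  have hFm : Measurable F := by
    classical
    have hc : ContinuousOn (fun z ↦ ‖fderivWithin ℝ g Ω z‖ₑ ^ 2) Q := by
      have := ((hg.continuousOn_fderivWithin hΩ le_rfl).mono hQΩ).enorm
      exact (ENNReal.continuous_pow 2).comp_continuousOn this
    have := hc.measurable_piecewise (g := fun _ ↦ 0) continuousOn_const hQm
    have e : Q.piecewise (fun z ↦ ‖fderivWithin ℝ g Ω z‖ₑ ^ 2) (fun _ ↦ 0) = F :=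
      piecewise_eq_indicator
    exact e ▸ this
  have hFint : ∫⁻ z, F z = ∫⁻ z in Q, ‖fderivWithin ℝ g Ω z‖ₑ ^ 2 := lintegral_indicator hQm _
  have hd2 : ENNReal.ofReal d ^ 2 ≠ ⊤ := by simp
  calc ∫⁻ x in Q, ∫⁻ y in Q, ‖g x - g y‖ₑ ^ 2
      ≤ ∫⁻ x in Q, ∫⁻ y in Q, ENNReal.ofReal d ^ 2 *
          ∫⁻ t in Icc (0 : ℝ) 1, F ((1 - t) • y + t • x) := by
        refine setLIntegral_mono' hQm fun x hx ↦ setLIntegral_mono' hQm fun y hy ↦ ?_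
        exact enorm_sub_sq_le_lintegral_segment hΩ hg hQΩ hQ hd hx hy
    _ = ENNReal.ofReal d ^ 2 * ∫⁻ x in Q, ∫⁻ y in Q,
          ∫⁻ t in Icc (0 : ℝ) 1, F ((1 - t) • y + t • x) := by
        simp_rw [lintegral_const_mul' _ _ hd2]
    _ = ENNReal.ofReal d ^ 2 * ∫⁻ t in Icc (0 : ℝ) 1, ∫⁻ x in Q, ∫⁻ y in Q,
          F ((1 - t) • y + t • x) := by
        congr 1
        have hm3 : Measurable fun p : (E × ℝ) × E ↦ F ((1 - p.1.2) • p.2 + p.1.2 • p.1.1) :=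
          hFm.comp (by fun_prop)
        have hm3' : ∀ x, Measurable fun p : E × ℝ ↦ F ((1 - p.2) • p.1 + p.2 • x) := fun x ↦
          hFm.comp (by fun_prop)
        have : ∀ x, ∫⁻ y in Q, ∫⁻ t in Icc (0 : ℝ) 1, F ((1 - t) • y + t • x) =
            ∫⁻ t in Icc (0 : ℝ) 1, ∫⁻ y in Q, F ((1 - t) • y + t • x) := fun x ↦
          lintegral_lintegral_swap (hm3' x).aemeasurable
        simp_rw [this]
        exact lintegral_lintegral_swap (hm3.lintegral_prod_right).aemeasurable
    _ ≤ ENNReal.ofReal d ^ 2 * ∫⁻ t in Icc (0 : ℝ) 1,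
          2 ^ Module.finrank ℝ E * (volume Q * ∫⁻ z, F z) := by
        gcongr ENNReal.ofReal d ^ 2 * ?_
        refine setLIntegral_mono' measurableSet_Icc fun t ht ↦ ?_
        have hm2 : Measurable fun p : E × E ↦ F ((1 - t) • p.2 + t • p.1) := hFm.comp (by fun_prop)
        -- One of `t`, `1 - t` is at least `1 / 2`; integrating first in the variable carrying that
        -- coefficient keeps the Jacobian bounded.
        rcases le_total (1 / 2) t with h | h
        · rw [lintegral_lintegral_swap hm2.aemeasurable]
          calc _ ≤ ∫⁻ y in Q, 2 ^ Module.finrank ℝ E * ∫⁻ z, F z := by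
                refine lintegral_mono fun y ↦ ?_
                exact (setLIntegral_le_lintegral _ _).trans (lintegral_add_smul_le hFm _ h)
            _ = _ := by simp only [lintegral_const, Measure.restrict_apply_univ]; ring
        · calc _ ≤ ∫⁻ x in Q, 2 ^ Module.finrank ℝ E * ∫⁻ z, F z := by
                refine lintegral_mono fun x ↦ ?_
                refine (setLIntegral_le_lintegral _ _).trans ?_
                simp_rw [add_comm _ (t • x)]
                exact lintegral_add_smul_le hFm _ (by linarith)
            _ = _ := by simp only [lintegral_const, Measure.restrict_apply_univ]; ring
    _ = _ := by simp [hFint]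

/-- A Poincaré inequality on convex sets. -/
lemma lintegral_sq_le_of_convex {Ω Q : Set E} {g : E → ℝ} (hΩ : UniqueDiffOn ℝ Ω)
    (hg : ContDiffOn ℝ 1 g Ω) (hQΩ : Q ⊆ Ω) (hQ : Convex ℝ Q) (hQm : MeasurableSet Q) {d : ℝ}
    (hd : ∀ x ∈ Q, ∀ y ∈ Q, dist x y ≤ d) (hint : IntegrableOn g Q) (h0 : volume Q ≠ 0)
    (htop : volume Q ≠ ⊤) :
    ∫⁻ x in Q, ‖g x‖ₑ ^ 2 ≤ 4 * (volume Q)⁻¹ * ‖∫ x in Q, g x‖ₑ ^ 2 +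
      4 * ENNReal.ofReal d ^ 2 * 2 ^ Module.finrank ℝ E *
        ∫⁻ z in Q, ‖fderivWithin ℝ g Ω z‖ₑ ^ 2 := by
  set I := ∫ x in Q, g x
  have hgm : AEMeasurable (fun x ↦ g x) (volume.restrict Q) := hint.aemeasurable
  -- Comes from `|Q| g(x) = ∫ g + ∫ (g(x) - g(y)) dy`, squared, with Cauchy–Schwarz on the last
  -- integral.
  have hpt : ∀ x, (volume Q) ^ 2 * ‖g x‖ₑ ^ 2 ≤
      4 * ‖I‖ₑ ^ 2 + 4 * (volume Q * ∫⁻ y in Q, ‖g x - g y‖ₑ ^ 2) := by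
    intro x
    have h1 : volume Q * ‖g x‖ₑ ≤ ‖I‖ₑ + ∫⁻ y in Q, ‖g x - g y‖ₑ := by
      have hc : IntegrableOn (fun _ : E ↦ g x) Q := integrableOn_const htop
      have e : (∫ y in Q, g x) = I + ∫ y in Q, (g x - g y) := by
        rw [integral_sub hc hint]; ring
      have e2 : volume Q * ‖g x‖ₑ = ‖∫ y in Q, g x‖ₑ := by
        rw [setIntegral_const, enorm_smul, Measure.real, Real.enorm_of_nonneg ENNReal.toReal_nonneg,
          ENNReal.ofReal_toReal htop]
      rw [e2, e]
      exact (enorm_add_le _ _).trans (by gcongr; exact enorm_integral_le_lintegral_enorm _)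
    rw [← mul_pow]
    refine (pow_le_pow_left' h1 2).trans ((ENNReal_add_sq_le _ _).trans ?_)
    gcongr
    simpa using sq_lintegral_le (μ := volume.restrict Q) (hgm.const_sub (g x)).enorm
  have hint2 : (volume Q) ^ 2 * ∫⁻ x in Q, ‖g x‖ₑ ^ 2 ≤
      4 * ‖I‖ₑ ^ 2 * volume Q + 4 * (volume Q * (ENNReal.ofReal d ^ 2 *
      (2 ^ Module.finrank ℝ E * (volume Q * ∫⁻ z in Q, ‖fderivWithin ℝ g Ω z‖ₑ ^ 2)))) := by
    rw [← lintegral_const_mul' _ _ (by finiteness)]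
    refine (lintegral_mono fun x ↦ hpt x).trans ?_
    rw [lintegral_add_left measurable_const, lintegral_const_mul' 4 (fun x ↦ _ * _) (by simp),
      lintegral_const_mul' _ _ htop]
    simp only [lintegral_const, Measure.restrict_apply_univ]
    gcongr
    exact lintegral_lintegral_sub_sq_le hΩ hg hQΩ hQ hQm hd
  have hcancel : ∀ a : ℝ≥0∞, a = ((volume Q)⁻¹) ^ 2 * ((volume Q) ^ 2 * a) := fun a ↦ by
    rw [← mul_assoc, ← mul_pow, ENNReal.inv_mul_cancel h0 htop]; simp
  rw [hcancel (∫⁻ x in Q, ‖g x‖ₑ ^ 2)]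
  refine (mul_le_mul_right hint2 _).trans (le_of_eq ?_)
  have hc1 : (volume Q)⁻¹ * volume Q = 1 := ENNReal.inv_mul_cancel h0 htop
  rw [mul_add]
  congr 1
  · calc _ = 4 * ((volume Q)⁻¹ * ‖I‖ₑ ^ 2) * ((volume Q)⁻¹ * volume Q) := by ring
      _ = _ := by rw [hc1]; ring
  · calc _ = 4 * ENNReal.ofReal d ^ 2 * 2 ^ Module.finrank ℝ E *
        (∫⁻ z in Q, ‖fderivWithin ℝ g Ω z‖ₑ ^ 2) * (((volume Q)⁻¹ * volume Q) *
        ((volume Q)⁻¹ * volume Q)) := by ring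
      _ = _ := by rw [hc1]; ring

end Poincare

/-! ### Small-constant Poincaré inequality in the plane, by a fine grid. -/

section Cells

/-- The cell of a point of the plane for the square grid of mesh `s`. -/
noncomputable def gridIndex (s : ℝ) (y : Plane) : Fin 2 → ℤ := fun i ↦ ⌊y i / s⌋

lemma measurable_gridIndex (s : ℝ) : Measurable (gridIndex s) := by
  refine measurable_pi_lambda _ fun i ↦ Int.measurable_floor.comp ?_
  fun_prop

lemma gridIndex_eq_iff {s : ℝ} (hs : 0 < s) (y : Plane) (k : Fin 2 → ℤ) :
    gridIndex s y = k ↔ ∀ i, k i * s ≤ y i ∧ y i < (k i + 1) * s := by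
  rw [funext_iff]
  refine forall_congr' fun i ↦ ?_
  rw [gridIndex, Int.floor_eq_iff, le_div_iff₀ hs, div_lt_iff₀ hs]

lemma convex_gridCell {s : ℝ} (hs : 0 < s) (k : Fin 2 → ℤ) : Convex ℝ (gridIndex s ⁻¹' {k}) := by
  intro x hx y hy a b ha hb hab
  simp only [mem_preimage, mem_singleton_iff, gridIndex_eq_iff hs] at *
  intro i
  have h1 := hx i
  have h2 := hy i
  have h3 := (convex_Ico ((k i : ℝ) * s) ((k i + 1) * s)) (show x i ∈ _ from h1)
    (show y i ∈ _ from h2) ha hb hab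
  simpa using h3

lemma dist_le_of_gridIndex_eq {s : ℝ} (hs : 0 < s) {x y : Plane}
    (h : gridIndex s x = gridIndex s y) : dist x y ≤ 2 * s := by
  have hx := (gridIndex_eq_iff hs x _).1 rfl
  have hy := (gridIndex_eq_iff hs y _).1 h.symm
  rw [dist_eq_norm]
  refine le_of_sq_le_sq ?_ (by positivity)
  rw [EuclideanSpace.norm_sq_eq, Fin.sum_univ_two]
  have hi : ∀ i, ‖(x - y) i‖ ^ 2 ≤ s ^ 2 := fun i ↦ by
    rw [Real.norm_eq_abs, sq_abs, ← sq_abs]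
    refine pow_le_pow_left₀ (abs_nonneg _) ?_ 2
    have h1 := hx i
    have h2 := hy i
    simp only [PiLp.sub_apply]
    rw [abs_le]
    constructor <;> nlinarith
  nlinarith [hi 0, hi 1]

lemma finite_gridIndex_image (s : ℝ) {B : Set Plane} (hB : IsCompact B) :
    (gridIndex s '' B).Finite := by
  have : ∀ i : Fin 2, ((fun y : Plane ↦ ⌊y i / s⌋) '' B).Finite := by
    intro i
    have hc : IsCompact ((fun y : Plane ↦ y i / s) '' B) := hB.image (by fun_prop)
    obtain ⟨a, ha⟩ := hc.bddBelow
    obtain ⟨b, hb⟩ := hc.bddAbove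
    refine (finite_Icc ⌊a⌋ ⌊b⌋).subset ?_
    rintro _ ⟨y, hy, rfl⟩
    exact ⟨Int.floor_le_floor (ha ⟨y, hy, rfl⟩), Int.floor_le_floor (hb ⟨y, hy, rfl⟩)⟩
  refine (Finite.pi this).subset ?_
  rintro _ ⟨y, hy, rfl⟩ i -
  exact ⟨y, hy, rfl⟩

/-- On a compact convex set of the plane, the `L²` norm of a function is controlled by finitely many
averages and a small multiple of the norm of its gradient. -/
lemma exists_finite_averages {B : Set Plane} (hB : IsCompact B) (hBc : Convex ℝ B) {δ : ℝ}
    (hδ : 0 < δ) :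
    ∃ (t : Finset (Fin 2 → ℤ)) (Q : (Fin 2 → ℤ) → Set Plane) (c : (Fin 2 → ℤ) → ℝ),
      (∀ k, MeasurableSet (Q k) ∧ Q k ⊆ B) ∧
      ∀ (Ω : Set Plane) (g : Plane → ℝ), UniqueDiffOn ℝ Ω → ContDiffOn ℝ 1 g Ω → B ⊆ Ω →
        ∫⁻ x in B, ‖g x‖ₑ ^ 2 ≤ ∑ k ∈ t, ENNReal.ofReal (c k) * ‖∫ x in Q k, g x‖ₑ ^ 2 +
          ENNReal.ofReal δ * ∫⁻ x in B, ‖fderivWithin ℝ g Ω x‖ₑ ^ 2 := by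
  -- Cells have diameter at most `2 s`, and the Poincaré constant in dimension two is `4 (2 s)² 2² =
  -- 64 s²`, which is `δ`.
  set s := Real.sqrt (δ / 64) with hs
  have hs0 : 0 < s := by positivity
  set Q : (Fin 2 → ℤ) → Set Plane := fun k ↦ B ∩ gridIndex s ⁻¹' {k} with hQ
  have hQm : ∀ k, MeasurableSet (Q k) := fun k ↦
    hB.measurableSet.inter (measurable_gridIndex s (measurableSet_singleton k))
  have hdisj : Pairwise (Function.onFun Disjoint Q) := by
    intro k l hkl
    rw [Function.onFun, disjoint_left]
    rintro x ⟨-, h1⟩ ⟨-, h2⟩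
    exact hkl (h1.symm.trans h2)
  set t := (finite_gridIndex_image s hB).toFinset
  have hunion : B = ⋃ k ∈ t, Q k := by
    ext x
    simp only [mem_iUnion, hQ, exists_prop]
    exact ⟨fun hx ↦ ⟨gridIndex s x, by simpa [t] using ⟨x, hx, rfl⟩, hx, rfl⟩,
      fun ⟨_, _, hx, _⟩ ↦ hx⟩
  have hfin : ∀ k, volume (Q k) ≠ ⊤ := fun k ↦
    ((measure_mono inter_subset_left).trans_lt hB.measure_lt_top).ne
  -- For a null cell the coefficient is `⊤.toReal = 0`; this is harmless, since all integrals over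
  -- that cell vanish.
  refine ⟨t, Q, fun k ↦ (4 * (volume (Q k))⁻¹).toReal, fun k ↦ ⟨hQm k, inter_subset_left⟩, ?_⟩
  intro Ω g hΩ hg hBΩ
  have hsplit : ∀ f : Plane → ℝ≥0∞, ∫⁻ x in B, f x = ∑ k ∈ t, ∫⁻ x in Q k, f x := fun f ↦ by
    conv_lhs => rw [hunion]
    exact lintegral_biUnion_finset (hdisj.set_pairwise _) (fun k _ ↦ hQm k) f
  rw [hsplit, hsplit, Finset.mul_sum, ← Finset.sum_add_distrib]
  refine Finset.sum_le_sum fun k _ ↦ ?_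
  by_cases h0 : volume (Q k) = 0
  · simp [Measure.restrict_eq_zero.2 h0]
  have hd : ∀ x ∈ Q k, ∀ y ∈ Q k, dist x y ≤ 2 * s := fun x hx y hy ↦
    dist_le_of_gridIndex_eq hs0 (hx.2.trans hy.2.symm)
  have hint : IntegrableOn g (Q k) :=
    ((hg.continuousOn.mono hBΩ).integrableOn_compact hB).mono_set inter_subset_left
  refine (lintegral_sq_le_of_convex hΩ hg (inter_subset_left.trans hBΩ)
    (hBc.inter (convex_gridCell hs0 k)) (hQm k) hd hint h0 (hfin k)).trans (le_of_eq ?_)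
  congr 1
  · rw [ENNReal.ofReal_toReal]
    exact ENNReal.mul_ne_top (by simp) (ENNReal.inv_ne_top.2 h0)
  · congr 1
    have : ENNReal.ofReal (2 * s) ^ 2 = ENNReal.ofReal (δ / 16) := by
      rw [← ENNReal.ofReal_pow (by positivity), mul_pow, hs, Real.sq_sqrt (by positivity)]
      congr 1; ring
    rw [this, finrank_euclideanSpace_fin, ← ENNReal.ofReal_ofNat 4, ← ENNReal.ofReal_ofNat 2,
      ← ENNReal.ofReal_pow (by norm_num), ← ENNReal.ofReal_mul (by norm_num),
      ← ENNReal.ofReal_mul (by positivity)]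
    congr 1; ring

end Cells

/-! ### Coordinate frames and the metric in a chart. -/

section ChartFrames

variable {M : Type*} [EMetricSpace M] [ChartedSpace (EuclideanHalfSpace 2) M]
  [IsManifold (𝓡∂ 2) ∞ M]

/-- The coordinate vector field with constant components `e` in the chart at `p`. -/
noncomputable def chartVec (p : M) (e : Plane) (x : M) : TangentSpace (𝓡∂ 2) x :=
  (trivializationAt Plane (TangentSpace (𝓡∂ 2) : M → Type) p).symmL ℝ x e

lemma chartVec_add (p : M) (e e' : Plane) (x : M) :
    chartVec p (e + e') x = chartVec p e x + chartVec p e' x := map_add _ _ _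

lemma chartVec_smul (p : M) (c : ℝ) (e : Plane) (x : M) :
    chartVec p (c • e) x = c • chartVec p e x := map_smul _ _ _

lemma plane_eq_sum (v : Plane) :
    v = v 0 • EuclideanSpace.single 0 1 + v 1 • EuclideanSpace.single 1 1 := by
  ext i; fin_cases i <;> simp

lemma chartVec_eq_sum (p : M) (v : Plane) (x : M) :
    chartVec p v x = v 0 • chartVec p (EuclideanSpace.single 0 1) x +
      v 1 • chartVec p (EuclideanSpace.single 1 1) x := by
  conv_lhs => rw [plane_eq_sum v]
  rw [chartVec_add, chartVec_smul, chartVec_smul]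

/-- Identifies the vector appearing in `IsWeakGradient` with the frame coming from the tangent
bundle trivialisation, whose continuity is available. -/
lemma mfderivWithin_symm_eq_chartVec {p : M} {y : Plane} (hy : y ∈ (extChartAt (𝓡∂ 2) p).target)
    (e : Plane) :
    mfderivWithin 𝓘(ℝ, Plane) (𝓡∂ 2) (extChartAt (𝓡∂ 2) p).symm (range (𝓡∂ 2)) y e =
      chartVec p e ((extChartAt (𝓡∂ 2) p).symm y) := by
  have hx : (extChartAt (𝓡∂ 2) p).symm y ∈ (chartAt (EuclideanHalfSpace 2) p).source := by
    simpa only [extChartAt_source] using (extChartAt (𝓡∂ 2) p).map_target hy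
  have h := TangentBundle.symmL_trivializationAt (I := 𝓡∂ 2) (𝕜 := ℝ) hx
  rw [chartVec, h, (extChartAt (𝓡∂ 2) p).right_inv hy]
  rfl

lemma chartVec_chartComponents {p x : M} (hx : x ∈ (chartAt (EuclideanHalfSpace 2) p).source)
    (X : TangentField M) : chartVec p (chartComponents p X x) x = X x := by
  rw [chartComponents, ← TangentBundle.continuousLinearMapAt_trivializationAt hx]
  exact (trivializationAt Plane (TangentSpace (𝓡∂ 2) : M → Type) p).symmL_continuousLinearMapAt
    (by simpa using hx) _

lemma chartVec_injective {p x : M} (hx : x ∈ (chartAt (EuclideanHalfSpace 2) p).source) {v : Plane}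
    (h : chartVec p v x = 0) : v = 0 := by
  have h1 := (trivializationAt Plane (TangentSpace (𝓡∂ 2) : M → Type) p).continuousLinearMapAt_symmL
    (R := ℝ) (b := x) (by simpa using hx) v
  change chartVec p v x = 0 at h
  rw [← h1]
  change ((trivializationAt Plane (TangentSpace (𝓡∂ 2) : M → Type) p).continuousLinearMapAt ℝ x)
    (chartVec p v x) = 0
  rw [h, map_zero]

lemma continuousOn_chartVec (p : M) (e : Plane) :
    ContinuousOn (fun x ↦ (⟨x, chartVec p e x⟩ : TotalSpace Plane (TangentSpace (𝓡∂ 2) : M → Type)))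
      (chartAt (EuclideanHalfSpace 2) p).source := by
  have h := (trivializationAt Plane (TangentSpace (𝓡∂ 2) : M → Type) p).continuousOn_symm
  have h2 := h.comp (f := fun x : M ↦ (x, e)) (s := (chartAt (EuclideanHalfSpace 2) p).source)
    (by fun_prop) (fun x hx ↦ ⟨by simpa using hx, mem_univ _⟩)
  refine h2.congr fun x hx ↦ ?_
  simp only [chartVec, Function.comp_apply]
  rw [Trivialization.symmL_apply _ (by simpa using hx)]

variable [RiemannianBundle (fun x : M ↦ TangentSpace (𝓡∂ 2) x)]

/-- The entries of the metric in the chart at `p`. -/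
noncomputable def gram (p : M) (i j : Fin 2) (x : M) : ℝ :=
  inner ℝ (chartVec p (EuclideanSpace.single i 1) x) (chartVec p (EuclideanSpace.single j 1) x)

lemma gram_comm (p : M) (i j : Fin 2) (x : M) : gram p i j x = gram p j i x := real_inner_comm _ _

lemma norm_chartVec_sq (p : M) (v : Plane) (x : M) :
    ‖chartVec p v x‖ ^ 2 = gram p 0 0 x * v 0 ^ 2 + 2 * gram p 0 1 x * v 0 * v 1 +
      gram p 1 1 x * v 1 ^ 2 := by
  rw [chartVec_eq_sum, norm_add_sq_real, norm_smul, norm_smul, inner_smul_left, inner_smul_right,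
    mul_pow, mul_pow]
  simp only [gram, Real.norm_eq_abs, sq_abs, conj_trivial, real_inner_self_eq_norm_sq]
  ring

lemma gram_zero_pos {p x : M} (hx : x ∈ (chartAt (EuclideanHalfSpace 2) p).source) :
    0 < gram p 0 0 x := by
  refine real_inner_self_pos.2 fun h ↦ ?_
  have := congrArg (fun v : Plane ↦ v 0) (chartVec_injective hx h)
  simp at this

lemma gram_det_pos {p x : M} (hx : x ∈ (chartAt (EuclideanHalfSpace 2) p).source) :
    0 < gram p 0 0 x * gram p 1 1 x - gram p 0 1 x ^ 2 := by
  have h0 := gram_zero_pos hx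
  -- The squared length of this vector is `gram p 0 0 x` times the determinant.
  set v : Plane := !₂[-gram p 0 1 x, gram p 0 0 x] with hv
  have hne : chartVec p v x ≠ 0 := fun h ↦ by
    have := congrArg (fun v : Plane ↦ v 1) (chartVec_injective hx h)
    simp [hv] at this
    exact h0.ne' this
  have h1 : 0 < ‖chartVec p v x‖ ^ 2 := by positivity
  rw [norm_chartVec_sq] at h1
  simp only [hv, PiLp.toLp_apply, Matrix.cons_val_zero, Matrix.cons_val_one] at h1
  have h2 : 0 < gram p 0 0 x * (gram p 0 0 x * gram p 1 1 x - gram p 0 1 x ^ 2) := by nlinarith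
  exact (mul_pos_iff_of_pos_left h0).1 h2

variable [IsContinuousRiemannianBundle Plane (fun x : M ↦ TangentSpace (𝓡∂ 2) x)]

lemma continuousOn_inner_chartVec (p q : M) (e e' : Plane) :
    ContinuousOn (fun x ↦ inner ℝ (chartVec p e x) (chartVec q e' x))
      ((chartAt (EuclideanHalfSpace 2) p).source ∩ (chartAt (EuclideanHalfSpace 2) q).source) := by
  exact ((continuousOn_chartVec p e).mono inter_subset_left).inner_bundle
    ((continuousOn_chartVec q e').mono inter_subset_right)

lemma continuousOn_gram (p : M) (i j : Fin 2) :
    ContinuousOn (gram p i j) (chartAt (EuclideanHalfSpace 2) p).source := by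
  simpa using! continuousOn_inner_chartVec p p (EuclideanSpace.single i 1) (EuclideanSpace.single j 1)

/-- The eigenvalues of the Gram matrix lie between `det / tr` and `tr`, and both are continuous at
`q`. -/
lemma exists_norm_chartVec_bounds {p q : M} (hq : q ∈ (chartAt (EuclideanHalfSpace 2) p).source) :
    ∃ C > (0 : ℝ), ∀ᶠ x in 𝓝 q, x ∈ (chartAt (EuclideanHalfSpace 2) p).source ∧ ∀ v : Plane,
      ‖chartVec p v x‖ ≤ C * ‖v‖ ∧ ‖v‖ ≤ C * ‖chartVec p v x‖ := by
  set s := (chartAt (EuclideanHalfSpace 2) p).source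
  have hs : s ∈ 𝓝 q := (chartAt (EuclideanHalfSpace 2) p).open_source.mem_nhds hq
  have hc : ∀ i j, ContinuousAt (gram p i j) q := fun i j ↦ (continuousOn_gram p i j).continuousAt hs
  set tr : M → ℝ := fun x ↦ gram p 0 0 x + gram p 1 1 x
  set dt : M → ℝ := fun x ↦ gram p 0 0 x * gram p 1 1 x - gram p 0 1 x ^ 2
  have htr : ContinuousAt tr q := (hc 0 0).add (hc 1 1)
  have hdt : ContinuousAt dt q := ((hc 0 0).mul (hc 1 1)).sub ((hc 0 1).pow 2)
  have hquot : ContinuousAt (fun x ↦ tr x / dt x) q := htr.div hdt (gram_det_pos hq).ne'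
  set K := max (2 * |tr q| + 2) (|tr q / dt q| + 1)
  have hK : 0 < K := lt_of_lt_of_le (by positivity) (le_max_right _ _)
  refine ⟨√K, by positivity, ?_⟩
  have e1 : ∀ᶠ x in 𝓝 q, tr x < |tr q| + 1 :=
    htr.eventually_lt_const (by linarith [le_abs_self (tr q)])
  have e2 : ∀ᶠ x in 𝓝 q, tr x / dt x < |tr q / dt q| + 1 :=
    hquot.eventually_lt_const (by linarith [le_abs_self (tr q / dt q)])
  filter_upwards [hs, e1, e2] with x hx h1 h2
  refine ⟨hx, fun v ↦ ?_⟩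
  have hd : 0 < dt x := gram_det_pos hx
  have hN := norm_chartVec_sq p v x
  have hv : ‖v‖ ^ 2 = v 0 ^ 2 + v 1 ^ 2 := by
    rw [EuclideanSpace.norm_sq_eq, Fin.sum_univ_two]; simp
  have h00 := gram_zero_pos hx
  have h11 : 0 ≤ gram p 1 1 x := real_inner_self_nonneg
  have hpd : gram p 0 1 x ^ 2 ≤ gram p 0 0 x * gram p 1 1 x := by simp only [dt] at hd; linarith
  constructor
  · refine le_of_sq_le_sq ?_ (by positivity)
    rw [mul_pow, Real.sq_sqrt hK.le, hv, hN]
    have h3 : 2 * tr x ≤ K := le_trans (by linarith) (le_max_left _ _)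
    -- Adding the squared length of the reflected vector removes the mixed term; this explains the
    -- factor `2` in front of the trace.
    have h4 : 0 ≤ ‖chartVec p (!₂[v 0, - v 1]) x‖ ^ 2 := sq_nonneg _
    rw [norm_chartVec_sq] at h4
    simp only [Matrix.cons_val_zero, Matrix.cons_val_one] at h4
    have h5 : gram p 0 0 x * v 0 ^ 2 + 2 * gram p 0 1 x * v 0 * v 1 + gram p 1 1 x * v 1 ^ 2 ≤
        2 * tr x * (v 0 ^ 2 + v 1 ^ 2) := by
      simp only [tr]
      nlinarith [mul_nonneg h00.le (sq_nonneg (v 1)), mul_nonneg h11 (sq_nonneg (v 0))]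
    exact h5.trans (by gcongr)
  · refine le_of_sq_le_sq ?_ (by positivity)
    rw [mul_pow, Real.sq_sqrt hK.le]
    have h3 : tr x / dt x ≤ K := le_trans h2.le (le_max_right _ _)
    -- By Cayley–Hamilton the difference of the two sides is `|G v|²` for the Gram matrix `G`.
    have h4 : dt x * ‖v‖ ^ 2 ≤ tr x * ‖chartVec p v x‖ ^ 2 := by
      rw [hv, hN]
      simp only [tr, dt]
      nlinarith [sq_nonneg (gram p 0 0 x * v 0 + gram p 0 1 x * v 1),
        sq_nonneg (gram p 0 1 x * v 0 + gram p 1 1 x * v 1)]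
    calc ‖v‖ ^ 2 ≤ tr x / dt x * ‖chartVec p v x‖ ^ 2 := by
          rw [div_mul_eq_mul_div, le_div_iff₀ hd]; linarith
      _ ≤ _ := by gcongr

end ChartFrames

/-! ### Charts are locally bi-Lipschitz for the Riemannian distance. -/

section LocalLipschitz

variable {M : Type*} [EMetricSpace M] [ChartedSpace (EuclideanHalfSpace 2) M]
  [IsManifold (𝓡∂ 2) ∞ M] [RiemannianBundle (fun x : M ↦ TangentSpace (𝓡∂ 2) x)]
  [IsRiemannianManifold (𝓡∂ 2) M]

lemma enorm_chartVec_le {p x : M} {C : ℝ≥0} {v : Plane} (h : ‖chartVec p v x‖ ≤ C * ‖v‖) :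
    ‖chartVec p v x‖ₑ ≤ C * ‖v‖ₑ := by
  simp only [enorm]
  exact_mod_cast h

/-- The image of the straight segment, which stays in `B` by convexity, has Riemannian length at
most `C` times its Euclidean length. -/
lemma edist_extChartAt_symm_le {p : M} {B : Set Plane} (hB : B ⊆ (extChartAt (𝓡∂ 2) p).target)
    (hBc : Convex ℝ B) {C : ℝ≥0}
    (hC : ∀ y ∈ B, ∀ v : Plane, ‖chartVec p v ((extChartAt (𝓡∂ 2) p).symm y)‖ ≤ C * ‖v‖) :
    LipschitzOnWith C (extChartAt (𝓡∂ 2) p).symm B := by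
  intro y hy y' hy'
  let η := ContinuousAffineMap.lineMap (R := ℝ) y y'
  set γ := (extChartAt (𝓡∂ 2) p).symm ∘ η
  have hηB : Icc 0 1 ⊆ ⇑η ⁻¹' B := by
    simp only [← image_subset_iff, ContinuousAffineMap.coe_lineMap_eq,
      ← segment_eq_image_lineMap, η]
    exact hBc.segment_subset hy hy'
  have hη : Icc 0 1 ⊆ ⇑η ⁻¹' (extChartAt (𝓡∂ 2) p).target := hηB.trans (preimage_mono hB)
  have η_smooth : CMDiff[Icc 0 1] 1 η := by
    apply ContMDiff.contMDiffOn
    rw [contMDiff_iff_contDiff]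
    exact ContinuousAffineMap.contDiff _
  have h1 : edist ((extChartAt (𝓡∂ 2) p).symm y) ((extChartAt (𝓡∂ 2) p).symm y') ≤
      pathELength (𝓡∂ 2) γ 0 1 := by
    rw [IsRiemannianManifold.out (I := 𝓡∂ 2)]
    apply riemannianEDist_le_pathELength _ _ _ zero_le_one
    · exact (contMDiffOn_extChartAt_symm p).comp η_smooth hη
    · simp [γ, η, ContinuousAffineMap.coe_lineMap_eq]
    · simp [γ, η, ContinuousAffineMap.coe_lineMap_eq]
  refine h1.trans ?_
  rw [pathELength_eq_lintegral_mfderivWithin_Icc]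
  have h2 : ∀ t ∈ Icc (0 : ℝ) 1, ‖(mfderivWithin 𝓘(ℝ, ℝ) (𝓡∂ 2) γ (Icc 0 1) t) 1‖ₑ ≤ C * edist y y' := by
    intro t ht
    have e1 : (mfderivWithin 𝓘(ℝ, ℝ) (𝓡∂ 2) γ (Icc 0 1) t) =
        (mfderivWithin 𝓘(ℝ, Plane) (𝓡∂ 2) (extChartAt (𝓡∂ 2) p).symm (range (𝓡∂ 2)) (η t)) ∘L (mfderivWithin 𝓘(ℝ, ℝ) 𝓘(ℝ, Plane) η (Icc 0 1) t) := by
      apply mfderivWithin_comp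
      · exact mdifferentiableWithinAt_extChartAt_symm (hη ht)
      · exact η_smooth.mdifferentiableOn one_ne_zero t ht
      · exact hη.trans (preimage_mono (extChartAt_target_subset_range p))
      · rw [uniqueMDiffWithinAt_iff_uniqueDiffWithinAt]
        exact uniqueDiffOn_Icc zero_lt_one t ht
    have e2 : (mfderivWithin 𝓘(ℝ, ℝ) (𝓡∂ 2) γ (Icc 0 1) t) 1 =
        (mfderivWithin 𝓘(ℝ, Plane) (𝓡∂ 2) (extChartAt (𝓡∂ 2) p).symm (range (𝓡∂ 2)) (η t)) (y' - y) := by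
      have e3 : (mfderivWithin 𝓘(ℝ, ℝ) 𝓘(ℝ, Plane) η (Icc 0 1) t) 1 = y' - y := by
        rw [mfderivWithin_eq_fderivWithin]
        have hd : HasDerivAt η (y' - y) t := by
          have := AffineMap.hasDerivAt_lineMap (a := y) (b := y') (x := t)
          exact this
        have := hd.hasFDerivAt.hasFDerivWithinAt.fderivWithin (uniqueDiffOn_Icc zero_lt_one t ht)
        rw [this]
        exact ContinuousLinearMap.toSpanSingleton_apply_one ℝ (y' - y)
      have := congr($e1 1)
      rw [this]
      exact congrArg _ e3
    rw [e2, mfderivWithin_symm_eq_chartVec (hη ht)]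
    refine (enorm_chartVec_le (hC _ (hηB ht) _)).trans ?_
    rw [edist_comm, edist_eq_enorm_sub]
  calc _ ≤ ∫⁻ t in Icc (0 : ℝ) 1, C * edist y y' := setLIntegral_mono' measurableSet_Icc h2
    _ = _ := by simp

/-- Two points of the ball of radius `ρ` are joined by almost minimising paths of length less than
`2 ρ`. Such a path stays in the ball of radius `3 ρ`, where the chart is defined and the bound on
the frame applies, so its image has length at most `C` times that of the path. -/
lemma edist_extChartAt_le {p q : M} {ρ : ℝ≥0∞} {C : ℝ≥0} (hC0 : 0 < C)
    (hsub : Metric.eball q (3 * ρ) ⊆ (chartAt (EuclideanHalfSpace 2) p).source)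
    (hC : ∀ x ∈ Metric.eball q (3 * ρ), ∀ v : Plane, ‖v‖ ≤ C * ‖chartVec p v x‖) :
    LipschitzOnWith C (extChartAt (𝓡∂ 2) p) (Metric.eball q ρ) := by
  intro x hx y hy
  have hxy : edist x y < 2 * ρ := by
    rw [Metric.mem_eball] at hx hy
    calc _ ≤ _ := edist_triangle_right x y q
      _ < ρ + ρ := ENNReal.add_lt_add hx hy
      _ = _ := (two_mul _).symm
  have hC0' : (C : ℝ≥0∞) ≠ 0 := by simpa using hC0.ne'
  suffices H : edist (extChartAt (𝓡∂ 2) p x) (extChartAt (𝓡∂ 2) p y) / C ≤ edist x y by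
    rw [ENNReal.div_le_iff hC0' ENNReal.coe_ne_top] at H
    rwa [mul_comm]
  refine le_of_forall_gt fun s hs ↦ ?_
  have hs' : riemannianEDist (𝓡∂ 2) x y < min s (2 * ρ) := by
    rw [← IsRiemannianManifold.out]
    exact lt_min hs hxy
  obtain ⟨γ, hγx, hγy, γ_smooth, hγ, -⟩ :=
    exists_lt_locally_constant_of_riemannianEDist_lt hs' zero_lt_one
  have hmem : ∀ t ∈ Icc (0 : ℝ) 1, γ t ∈ Metric.eball q (3 * ρ) := by
    intro t ht
    have h1 : edist x (γ t) < 2 * ρ := by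
      rw [IsRiemannianManifold.out (I := 𝓡∂ 2)]
      calc _ ≤ pathELength (𝓡∂ 2) γ 0 t :=
            riemannianEDist_le_pathELength γ_smooth.contMDiffOn hγx rfl ht.1
        _ ≤ pathELength (𝓡∂ 2) γ 0 1 := pathELength_mono le_rfl ht.2
        _ < _ := hγ.trans_le (min_le_right _ _)
    rw [Metric.mem_eball] at hx ⊢
    rw [edist_comm] at h1
    calc _ ≤ _ := edist_triangle _ x _
      _ < 2 * ρ + ρ := ENNReal.add_lt_add h1 hx
      _ = _ := by ring
  let γ' := extChartAt (𝓡∂ 2) p ∘ γ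
  have hcd : CMDiff[Icc 0 1] 1 γ' :=
    contMDiffOn_extChartAt.comp (I' := 𝓡∂ 2) (t := (chartAt (EuclideanHalfSpace 2) p).source)
      γ_smooth.contMDiffOn (fun t ht ↦ hsub (hmem t ht))
  have hlen : edist (extChartAt (𝓡∂ 2) p x) (extChartAt (𝓡∂ 2) p y) ≤
      C * pathELength (𝓡∂ 2) γ 0 1 := by
    rw [edist_comm, edist_eq_enorm_sub]
    calc _ = ‖γ' 1 - γ' 0‖ₑ := by simp [γ', hγx, hγy]
      _ ≤ ∫⁻ t in Icc (0 : ℝ) 1, ‖derivWithin γ' (Icc 0 1) t‖ₑ := by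
        apply enorm_sub_le_lintegral_derivWithin_Icc_of_contDiffOn_Icc _ zero_le_one
        rwa [← contMDiffOn_iff_contDiffOn]
      _ ≤ ∫⁻ t in Icc (0 : ℝ) 1, C * ‖(mfderivWithin 𝓘(ℝ, ℝ) (𝓡∂ 2) γ (Icc 0 1) t) 1‖ₑ := by
        apply setLIntegral_mono' measurableSet_Icc fun t ht ↦ ?_
        have hsrc := hsub (hmem t ht)
        have e1 : mfderivWithin 𝓘(ℝ, ℝ) 𝓘(ℝ, Plane) γ' (Icc 0 1) t =
            (mfderiv (𝓡∂ 2) 𝓘(ℝ, Plane) (extChartAt (𝓡∂ 2) p) (γ t)) ∘L (mfderivWithin 𝓘(ℝ, ℝ) (𝓡∂ 2) γ (Icc 0 1) t) := by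
          apply mfderiv_comp_mfderivWithin
          · exact mdifferentiableAt_extChartAt hsrc
          · exact (γ_smooth.mdifferentiable one_ne_zero).mdifferentiableOn _ ht
          · rw [uniqueMDiffWithinAt_iff_uniqueDiffWithinAt]
            exact uniqueDiffOn_Icc zero_lt_one _ ht
        let w : Plane := derivWithin γ' (Icc 0 1) t
        have e2 : w = (mfderiv (𝓡∂ 2) 𝓘(ℝ, Plane) (extChartAt (𝓡∂ 2) p) (γ t)) ((mfderivWithin 𝓘(ℝ, ℝ) (𝓡∂ 2) γ (Icc 0 1) t) 1) := by
          have := congr($e1 1)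
          rw [mfderivWithin_eq_fderivWithin] at this
          simp only [w, ← fderivWithin_derivWithin]
          exact this
        have e3 : chartVec p w (γ t) = (mfderivWithin 𝓘(ℝ, ℝ) (𝓡∂ 2) γ (Icc 0 1) t) 1 := by
          rw [e2, ← TangentBundle.continuousLinearMapAt_trivializationAt hsrc]
          exact (trivializationAt Plane (TangentSpace (𝓡∂ 2) : M → Type)
            p).symmL_continuousLinearMapAt (by simpa using hsrc) _
        have e4 := hC _ (hmem t ht) w
        rw [← e3]
        change ‖w‖ₑ ≤ _
        simp only [enorm]
        exact_mod_cast e4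
      _ = _ := by
        rw [lintegral_const_mul' _ _ ENNReal.coe_ne_top, pathELength_eq_lintegral_mfderivWithin_Icc]
  refine lt_of_le_of_lt ?_ (hγ.trans_le (min_le_left _ _))
  exact ENNReal.div_le_of_le_mul' hlen

variable [IsContinuousRiemannianBundle Plane (fun x : M ↦ TangentSpace (𝓡∂ 2) x)]

/-- Near each point of its domain, a chart is bi-Lipschitz for the Riemannian distance, and its
coordinate vector fields are comparable with those of the plane. -/
lemma exists_bilipschitz_chart {p q : M} (hq : q ∈ (chartAt (EuclideanHalfSpace 2) p).source) :
    ∃ (r : ℝ) (C : ℝ≥0), 0 < r ∧ 0 < C ∧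
      (Metric.closedBall (extChartAt (𝓡∂ 2) p q) r ∩ range (𝓡∂ 2) ⊆ (extChartAt (𝓡∂ 2) p).target) ∧
      LipschitzOnWith C (extChartAt (𝓡∂ 2) p).symm
        (Metric.closedBall (extChartAt (𝓡∂ 2) p q) r ∩ range (𝓡∂ 2)) ∧
      LipschitzOnWith C (extChartAt (𝓡∂ 2) p) ((extChartAt (𝓡∂ 2) p).symm ''
        (Metric.closedBall (extChartAt (𝓡∂ 2) p q) r ∩ range (𝓡∂ 2))) ∧
      (extChartAt (𝓡∂ 2) p).symm ''
        (Metric.closedBall (extChartAt (𝓡∂ 2) p q) r ∩ range (𝓡∂ 2)) ∈ 𝓝 q ∧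
      ∀ x ∈ (extChartAt (𝓡∂ 2) p).symm ''
        (Metric.closedBall (extChartAt (𝓡∂ 2) p q) r ∩ range (𝓡∂ 2)), ∀ v : Plane,
          ‖chartVec p v x‖ ≤ C * ‖v‖ := by
  obtain ⟨C, hC0, hC⟩ := exists_norm_chartVec_bounds hq
  lift C to ℝ≥0 using hC0.le
  obtain ⟨ε, hε, hball⟩ := EMetric.mem_nhds_iff.1 hC
  have h3 : 3 * (ε / 3) = ε := ENNReal.mul_div_cancel (by norm_num) (by norm_num)
  have hε3 : 0 < ε / 3 := ENNReal.div_pos hε.ne' (by norm_num)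
  have hlip : LipschitzOnWith C (extChartAt (𝓡∂ 2) p) (Metric.eball q (ε / 3)) := by
    refine edist_extChartAt_le (by exact_mod_cast hC0) ?_ ?_
    · rw [h3]; exact fun x hx ↦ (hball hx).1
    · rw [h3]; exact fun x hx v ↦ ((hball hx).2 v).2
  have hq' : q ∈ (extChartAt (𝓡∂ 2) p).source := by rwa [extChartAt_source]
  have hN : (extChartAt (𝓡∂ 2) p).symm ⁻¹' (Metric.eball q (ε / 3)) ∩
      (extChartAt (𝓡∂ 2) p).target ∈ 𝓝[range (𝓡∂ 2)] (extChartAt (𝓡∂ 2) p q) := by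
    refine inter_mem ?_ (extChartAt_target_mem_nhdsWithin' hq')
    refine mem_nhdsWithin_of_mem_nhds ((continuousAt_extChartAt_symm' hq').preimage_mem_nhds ?_)
    rw [(extChartAt (𝓡∂ 2) p).left_inv hq']
    exact Metric.eball_mem_nhds q hε3
  obtain ⟨r₀, hr₀, hr₀s⟩ := Metric.mem_nhdsWithin_iff.1 hN
  set B := Metric.closedBall (extChartAt (𝓡∂ 2) p q) (r₀ / 2) ∩ range (𝓡∂ 2) with hB
  have hBs : B ⊆ (extChartAt (𝓡∂ 2) p).symm ⁻¹' (Metric.eball q (ε / 3)) ∩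
      (extChartAt (𝓡∂ 2) p).target :=
    (inter_subset_inter_left _ (Metric.closedBall_subset_ball (by linarith))).trans hr₀s
  have hBt : B ⊆ (extChartAt (𝓡∂ 2) p).target := hBs.trans inter_subset_right
  have himg : (extChartAt (𝓡∂ 2) p).symm '' B ⊆ Metric.eball q (ε / 3) :=
    image_subset_iff.2 (hBs.trans inter_subset_left)
  have hle : Metric.eball q (ε / 3) ⊆ Metric.eball q ε :=
    Metric.eball_subset_eball (ENNReal.div_le_of_le_mul (le_mul_of_one_le_right' (by norm_num)))
  have hbd : ∀ x ∈ (extChartAt (𝓡∂ 2) p).symm '' B, ∀ v : Plane, ‖chartVec p v x‖ ≤ C * ‖v‖ :=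
    fun x hx v ↦ ((hball (hle (himg hx))).2 v).1
  refine ⟨r₀ / 2, C, by positivity, by exact_mod_cast hC0, hBt, ?_, hlip.mono himg, ?_, hbd⟩
  · exact edist_extChartAt_symm_le hBt ((convex_closedBall _ _).inter (𝓡∂ 2).convex_range)
      fun y hy v ↦ hbd _ (mem_image_of_mem _ hy) v
  · have h1 : extChartAt (𝓡∂ 2) p ⁻¹' Metric.closedBall (extChartAt (𝓡∂ 2) p q) (r₀ / 2) ∩
        (extChartAt (𝓡∂ 2) p).source ∈ 𝓝 q :=
      inter_mem ((continuousAt_extChartAt' hq').preimage_mem_nhds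
        (Metric.closedBall_mem_nhds _ (by positivity))) (extChartAt_source_mem_nhds' hq')
    filter_upwards [h1] with x hx
    exact ⟨extChartAt (𝓡∂ 2) p x, ⟨hx.1, extChartAt_target_subset_range p
      ((extChartAt (𝓡∂ 2) p).map_source hx.2)⟩, (extChartAt (𝓡∂ 2) p).left_inv hx.2⟩

end LocalLipschitz

/-! ### Comparison of the Riemannian area with Lebesgue measure in charts. -/

section AreaComparison

lemma euclideanHausdorffMeasure_image_le_of_lipschitzOnWith {X Y : Type*} [EMetricSpace X]
    [MeasurableSpace X] [BorelSpace X] [EMetricSpace Y] [MeasurableSpace Y] [BorelSpace Y]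
    {C : ℝ≥0} {f : X → Y} {s : Set X} (hf : LipschitzOnWith C f s) (d : ℕ) :
    (μHE[d] : Measure Y) (f '' s) ≤ (C : ℝ≥0∞) ^ d * (μHE[d] : Measure X) s := by
  simp only [Measure.euclideanHausdorffMeasure_def, Measure.smul_apply, ENNReal.smul_def,
    smul_eq_mul]
  have := hf.hausdorffMeasure_image_le (d := d) (by positivity)
  rw [ENNReal.rpow_natCast] at this
  calc _ ≤ _ := mul_le_mul_right this _
    _ = _ := by ring

variable {M : Type*} [EMetricSpace M] [ChartedSpace (EuclideanHalfSpace 2) M]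
  [IsManifold (𝓡∂ 2) ∞ M] [RiemannianBundle (fun x : M ↦ TangentSpace (𝓡∂ 2) x)]

/-- A compact convex piece of the image of the chart at `p`, on which the chart is bi-Lipschitz. -/
structure IsPatch (p : M) (B : Set Plane) (C : ℝ≥0) : Prop where
  isCompact : IsCompact B
  convex : Convex ℝ B
  subset : B ⊆ (extChartAt (𝓡∂ 2) p).target
  lip_symm : LipschitzOnWith C (extChartAt (𝓡∂ 2) p).symm B
  lip : LipschitzOnWith C (extChartAt (𝓡∂ 2) p) ((extChartAt (𝓡∂ 2) p).symm '' B)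
  norm_le : ∀ x ∈ (extChartAt (𝓡∂ 2) p).symm '' B, ∀ v : Plane, ‖chartVec p v x‖ ≤ C * ‖v‖

lemma exists_isPatch [IsRiemannianManifold (𝓡∂ 2) M]
    [IsContinuousRiemannianBundle Plane (fun x : M ↦ TangentSpace (𝓡∂ 2) x)]
    {p q : M} (hq : q ∈ (chartAt (EuclideanHalfSpace 2) p).source) :
    ∃ B C, IsPatch p B C ∧ (extChartAt (𝓡∂ 2) p).symm '' B ∈ 𝓝 q ∧
      B ∈ 𝓝[range (𝓡∂ 2)] (extChartAt (𝓡∂ 2) p q) := by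
  obtain ⟨r, C, hr, hC, h1, h2, h3, h4, h5⟩ := exists_bilipschitz_chart hq
  exact ⟨_, C, ⟨(isCompact_closedBall _ _).inter_right (𝓡∂ 2).isClosed_range,
    (convex_closedBall _ _).inter (𝓡∂ 2).convex_range, h1, h2, h3, h5⟩, h4,
    inter_mem (mem_nhdsWithin_of_mem_nhds (Metric.closedBall_mem_nhds _ hr)) self_mem_nhdsWithin⟩

namespace IsPatch

variable {p : M} {B : Set Plane} {C : ℝ≥0}

lemma isCompact_image (h : IsPatch p B C) : IsCompact ((extChartAt (𝓡∂ 2) p).symm '' B) :=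
  h.isCompact.image_of_continuousOn h.lip_symm.continuousOn

lemma image_subset_source (h : IsPatch p B C) :
    (extChartAt (𝓡∂ 2) p).symm '' B ⊆ (chartAt (EuclideanHalfSpace 2) p).source := by
  rw [← extChartAt_source (𝓡∂ 2)]
  exact image_subset_iff.2 fun y hy ↦ (extChartAt (𝓡∂ 2) p).map_target (h.subset hy)

variable [MeasurableSpace M] [BorelSpace M]

/-- The chart is Lipschitz on the image of the patch, and two-dimensional Hausdorff measure in the
plane is Lebesgue measure; `area_preimage_le` is the same argument for the inverse chart. -/
lemma volume_preimage_le (h : IsPatch p B C) (A : Set M) :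
    volume (B ∩ (extChartAt (𝓡∂ 2) p).symm ⁻¹' A) ≤
      (C : ℝ≥0∞) ^ 2 * area M (A ∩ (extChartAt (𝓡∂ 2) p).symm '' B) := by
  set S := B ∩ (extChartAt (𝓡∂ 2) p).symm ⁻¹' A
  have h1 : extChartAt (𝓡∂ 2) p '' ((extChartAt (𝓡∂ 2) p).symm '' S) = S := by
    rw [image_image]
    refine (image_congr fun y hy ↦ ?_).trans (image_id S)
    exact (extChartAt (𝓡∂ 2) p).right_inv (h.subset hy.1)
  have h2 := euclideanHausdorffMeasure_image_le_of_lipschitzOnWith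
    (h.lip.mono (image_mono (inter_subset_left : S ⊆ B))) 2
  rw [h1, EuclideanSpace.euclideanHausdorffMeasure_eq_volume] at h2
  refine h2.trans (mul_le_mul_right (measure_mono ?_) _)
  rintro _ ⟨y, hy, rfl⟩
  exact ⟨hy.2, mem_image_of_mem _ hy.1⟩

lemma area_preimage_le (h : IsPatch p B C) (N : Set Plane) :
    area M ((extChartAt (𝓡∂ 2) p).symm '' B ∩ extChartAt (𝓡∂ 2) p ⁻¹' N) ≤
      (C : ℝ≥0∞) ^ 2 * volume (N ∩ B) := by
  have h2 := euclideanHausdorffMeasure_image_le_of_lipschitzOnWith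
    (h.lip_symm.mono (inter_subset_right : N ∩ B ⊆ B)) 2
  rw [EuclideanSpace.euclideanHausdorffMeasure_eq_volume] at h2
  refine le_trans (measure_mono ?_) h2
  rintro _ ⟨⟨y, hy, rfl⟩, hx⟩
  refine ⟨y, ⟨?_, hy⟩, rfl⟩
  rwa [mem_preimage, (extChartAt (𝓡∂ 2) p).right_inv (h.subset hy)] at hx

lemma aemeasurable_symm (h : IsPatch p B C) :
    AEMeasurable (extChartAt (𝓡∂ 2) p).symm (volume.restrict B) :=
  h.lip_symm.continuousOn.aemeasurable h.isCompact.measurableSet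

lemma map_symm_le (h : IsPatch p B C) :
    (volume.restrict B).map (extChartAt (𝓡∂ 2) p).symm ≤
      (C : ℝ≥0∞) ^ 2 • (area M).restrict ((extChartAt (𝓡∂ 2) p).symm '' B) := by
  refine Measure.le_iff.2 fun A hA ↦ ?_
  rw [Measure.map_apply_of_aemeasurable h.aemeasurable_symm hA,
    Measure.restrict_apply' h.isCompact.measurableSet, inter_comm, Measure.smul_apply,
    Measure.restrict_apply hA]
  exact h.volume_preimage_le A

lemma lintegral_symm_le (h : IsPatch p B C) {F : M → ℝ≥0∞} (hF : AEMeasurable F (area M)) :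
    ∫⁻ y in B, F ((extChartAt (𝓡∂ 2) p).symm y) ≤
      (C : ℝ≥0∞) ^ 2 * ∫⁻ x in (extChartAt (𝓡∂ 2) p).symm '' B, F x ∂(area M) := by
  have hF' : AEMeasurable F ((volume.restrict B).map (extChartAt (𝓡∂ 2) p).symm) :=
    (hF.restrict.smul_measure _).mono_measure h.map_symm_le
  rw [← lintegral_map' hF' h.aemeasurable_symm, ← smul_eq_mul, ← lintegral_smul_measure]
  exact lintegral_mono' h.map_symm_le le_rfl

lemma lintegral_le (h : IsPatch p B C) {F : M → ℝ≥0∞} (hF : Continuous F) :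
    ∫⁻ x in (extChartAt (𝓡∂ 2) p).symm '' B, F x ∂(area M) ≤
      (C : ℝ≥0∞) ^ 2 * ∫⁻ y in B, F ((extChartAt (𝓡∂ 2) p).symm y) := by
  set U := (extChartAt (𝓡∂ 2) p).symm '' B
  have hU : MeasurableSet U := h.isCompact_image.measurableSet
  have hm : AEMeasurable (extChartAt (𝓡∂ 2) p) ((area M).restrict U) :=
    h.lip.continuousOn.aemeasurable hU
  have hle : ((area M).restrict U).map (extChartAt (𝓡∂ 2) p) ≤
      (C : ℝ≥0∞) ^ 2 • volume.restrict B := by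
    refine Measure.le_iff.2 fun N hN ↦ ?_
    rw [Measure.map_apply_of_aemeasurable hm hN, Measure.restrict_apply' hU, inter_comm,
      Measure.smul_apply, Measure.restrict_apply hN]
    exact h.area_preimage_le N
  have hG : AEMeasurable (fun y ↦ F ((extChartAt (𝓡∂ 2) p).symm y)) (volume.restrict B) :=
    hF.measurable.comp_aemeasurable h.aemeasurable_symm
  have hG' : AEMeasurable (fun y ↦ F ((extChartAt (𝓡∂ 2) p).symm y))
      (((area M).restrict U).map (extChartAt (𝓡∂ 2) p)) :=
    (hG.smul_measure _).mono_measure hle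
  calc _ = ∫⁻ x in U, F ((extChartAt (𝓡∂ 2) p).symm (extChartAt (𝓡∂ 2) p x)) ∂(area M) := by
        refine setLIntegral_congr_fun hU fun x hx ↦ ?_
        have : x ∈ (extChartAt (𝓡∂ 2) p).source := by
          rw [extChartAt_source]; exact h.image_subset_source hx
        simp only [(extChartAt (𝓡∂ 2) p).left_inv this]
    _ = ∫⁻ y, F ((extChartAt (𝓡∂ 2) p).symm y)
          ∂(((area M).restrict U).map (extChartAt (𝓡∂ 2) p)) := (lintegral_map' hG' hm).symm
    _ ≤ _ := by
      rw [← smul_eq_mul, ← lintegral_smul_measure]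
      exact lintegral_mono' hle le_rfl

end IsPatch

lemma aemeasurable_extChartAt_symm [MeasurableSpace M] [BorelSpace M] {p : M} {K : Set Plane}
    (hK : IsCompact K) (hKt : K ⊆ (extChartAt (𝓡∂ 2) p).target) :
    AEMeasurable (extChartAt (𝓡∂ 2) p).symm (volume.restrict K) :=
  ((continuousOn_extChartAt_symm p).mono hKt).aemeasurable hK.measurableSet

variable [MeasurableSpace M] [BorelSpace M] [IsRiemannianManifold (𝓡∂ 2) M]
    [IsContinuousRiemannianBundle Plane (fun x : M ↦ TangentSpace (𝓡∂ 2) x)]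

/-- The bound holds near each point by `exists_isPatch` and constants add under unions, so
compactness suffices. -/
lemma exists_volume_preimage_le {p : M} {K : Set Plane} (hK : IsCompact K)
    (hKt : K ⊆ (extChartAt (𝓡∂ 2) p).target) :
    ∃ C : ℝ≥0, ∀ A, volume (K ∩ (extChartAt (𝓡∂ 2) p).symm ⁻¹' A) ≤ C * area M A := by
  refine hK.induction_on (p := fun K ↦ ∃ C : ℝ≥0, ∀ A,
    volume (K ∩ (extChartAt (𝓡∂ 2) p).symm ⁻¹' A) ≤ C * area M A) ⟨0, by simp⟩ ?_ ?_ ?_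
  · rintro s t hst ⟨C, hC⟩
    exact ⟨C, fun A ↦ (measure_mono (inter_subset_inter_left _ hst)).trans (hC A)⟩
  · rintro s t ⟨C, hC⟩ ⟨C', hC'⟩
    refine ⟨C + C', fun A ↦ ?_⟩
    rw [union_inter_distrib_right]
    refine (measure_union_le _ _).trans ?_
    push_cast
    rw [add_mul]
    exact add_le_add (hC A) (hC' A)
  · intro y hy
    have hq : (extChartAt (𝓡∂ 2) p).symm y ∈ (chartAt (EuclideanHalfSpace 2) p).source := by
      rw [← extChartAt_source (𝓡∂ 2)]
      exact (extChartAt (𝓡∂ 2) p).map_target (hKt hy)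
    obtain ⟨B, C, hB, -, hBn⟩ := exists_isPatch hq
    rw [(extChartAt (𝓡∂ 2) p).right_inv (hKt hy)] at hBn
    refine ⟨B, nhdsWithin_mono _ (hKt.trans (extChartAt_target_subset_range p)) hBn, C ^ 2,
      fun A ↦ (hB.volume_preimage_le A).trans ?_⟩
    push_cast
    gcongr
    exact inter_subset_left

/-- The pullback to the surface of Lebesgue measure on a compact part of the image of a chart is
controlled by the area. -/
lemma exists_map_symm_le {p : M} {K : Set Plane} (hK : IsCompact K)
    (hKt : K ⊆ (extChartAt (𝓡∂ 2) p).target) :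
    ∃ C : ℝ≥0, (volume.restrict K).map (extChartAt (𝓡∂ 2) p).symm ≤ C • area M := by
  obtain ⟨C, hC⟩ := exists_volume_preimage_le hK hKt
  refine ⟨C, Measure.le_iff.2 fun A hA ↦ ?_⟩
  rw [Measure.map_apply_of_aemeasurable (aemeasurable_extChartAt_symm hK hKt) hA,
    Measure.restrict_apply' hK.measurableSet, inter_comm]
  exact hC A

variable [CompactSpace M]

lemma area_preimage_eq_zero (p : M) {N : Set Plane} (hN : volume N = 0) :
    area M ((chartAt (EuclideanHalfSpace 2) p).source ∩ extChartAt (𝓡∂ 2) p ⁻¹' N) = 0 := by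
  have : SecondCountableTopology M := EMetric.secondCountable_of_sigmaCompact M
  refine measure_null_of_locally_null _ fun x hx ↦ ?_
  obtain ⟨B, C, hB, hBn, -⟩ := exists_isPatch hx.1
  refine ⟨_, inter_mem self_mem_nhdsWithin (mem_nhdsWithin_of_mem_nhds hBn), ?_⟩
  refine measure_mono_null ?_ (le_antisymm ((hB.area_preimage_le N).trans ?_) (zero_le))
  · exact fun z hz ↦ ⟨hz.2, hz.1.2⟩
  · rw [measure_mono_null inter_subset_left hN, mul_zero]

lemma isFiniteMeasure_area : IsFiniteMeasure (area M) := by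
  refine ⟨?_⟩
  refine isCompact_univ.measure_lt_top_of_nhdsWithin fun x _ ↦ ?_
  obtain ⟨B, C, hB, hBn, -⟩ := exists_isPatch (mem_chart_source (EuclideanHalfSpace 2) x)
  refine ⟨_, mem_nhdsWithin_of_mem_nhds hBn, ?_⟩
  have h := hB.area_preimage_le univ
  rw [preimage_univ, inter_univ, univ_inter] at h
  exact h.trans_lt (ENNReal.mul_lt_top (by simp) hB.isCompact.measure_lt_top)

/-- The target is relatively open in the half-plane, so its non-interior points lie on the frontier
of a convex set, which is null. -/
lemma volume_target_diff_interior (p : M) :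
    volume ((extChartAt (𝓡∂ 2) p).target \ interior (extChartAt (𝓡∂ 2) p).target) = 0 := by
  refine measure_mono_null ?_ ((𝓡∂ 2).convex_range.addHaar_frontier volume)
  rw [(𝓡∂ 2).isClosed_range.frontier_eq]
  refine fun y hy ↦ ⟨extChartAt_target_subset_range p hy.1, fun hy' ↦ hy.2 ?_⟩
  have ho : IsOpen ((𝓡∂ 2).symm ⁻¹' (chartAt (EuclideanHalfSpace 2) p).target) :=
    (chartAt (EuclideanHalfSpace 2) p).open_target.preimage (𝓡∂ 2).continuous_symm
  have ht := extChartAt_target (I := 𝓡∂ 2) p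
  have h1 := hy.1
  rw [ht] at h1 ⊢
  rw [interior_inter, ho.interior_eq]
  exact ⟨h1.1, hy'⟩

/-- Up to a set of zero area, the domain of a chart consists of points mapped to the interior of the
image. -/
lemma area_source_diff_interior (p : M) :
    area M ((chartAt (EuclideanHalfSpace 2) p).source \
      extChartAt (𝓡∂ 2) p ⁻¹' interior (extChartAt (𝓡∂ 2) p).target) = 0 := by
  refine measure_mono_null ?_ (area_preimage_eq_zero p (volume_target_diff_interior p))
  refine fun x hx ↦ ⟨hx.1, (extChartAt (𝓡∂ 2) p).map_source ?_, hx.2⟩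
  rw [extChartAt_source]; exact hx.1

end AreaComparison

/-! ### Measurable orthonormal frames, turning `L²` vector fields into `L²` maps to the plane. -/

section Frames

/-- Gram–Schmidt orthonormalisation in dimension two, as a linear isometry with the plane. -/
lemma exists_gramSchmidt_isometry {E : Type*} [NormedAddCommGroup E] [InnerProductSpace ℝ E]
    [FiniteDimensional ℝ E] (hE : Module.finrank ℝ E = 2) {a b : E}
    (h0 : 0 < inner ℝ a a) (hdet : 0 < inner ℝ a a * inner ℝ b b - inner ℝ a b ^ 2) :
    ∃ J : E ≃ₗᵢ[ℝ] Plane, ∀ v, J v = !₂[inner ℝ a v / √(inner ℝ a a),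
      (inner ℝ b v - inner ℝ a b / inner ℝ a a * inner ℝ a v) /
        √((inner ℝ a a * inner ℝ b b - inner ℝ a b ^ 2) / inner ℝ a a)] := by
  set g := inner ℝ a a
  set k := inner ℝ a b
  set D := (g * inner ℝ b b - k ^ 2) / g with hD
  have hD0 : 0 < D := by positivity
  set f : Fin 2 → E := ![(√g)⁻¹ • a, (√D)⁻¹ • (b - (k / g) • a)] with hf
  have hk : inner ℝ b a = k := real_inner_comm _ _
  have hon : Orthonormal ℝ f := by
    rw [orthonormal_iff_ite]
    have hga : inner ℝ a a = g := rfl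
    have hka : inner ℝ a b = k := rfl
    have e11 : inner ℝ (f 0) (f 0) = 1 := by
      change inner ℝ ((√g)⁻¹ • a) ((√g)⁻¹ • a) = 1
      rw [real_inner_smul_left, real_inner_smul_right, hga, ← mul_assoc, ← mul_inv,
        Real.mul_self_sqrt h0.le, inv_mul_cancel₀ h0.ne']
    have e12 : inner ℝ (f 0) (f 1) = 0 := by
      change inner ℝ ((√g)⁻¹ • a) ((√D)⁻¹ • (b - (k / g) • a)) = 0
      rw [real_inner_smul_left, real_inner_smul_right, inner_sub_right, real_inner_smul_right, hga,
        hka, div_mul_cancel₀ _ h0.ne']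
      simp
    have e22 : inner ℝ (f 1) (f 1) = 1 := by
      change inner ℝ ((√D)⁻¹ • (b - (k / g) • a)) ((√D)⁻¹ • (b - (k / g) • a)) = 1
      have : inner ℝ (b - (k / g) • a) (b - (k / g) • a) = D := by
        simp only [inner_sub_right, inner_sub_left, real_inner_smul_left, real_inner_smul_right,
          hga, hka, hk, hD]
        field_simp
        ring
      rw [real_inner_smul_left, real_inner_smul_right, this, ← mul_assoc, ← mul_inv,
        Real.mul_self_sqrt hD0.le, inv_mul_cancel₀ hD0.ne']
    intro i j
    fin_cases i <;> fin_cases j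
    · simpa using e11
    · simpa using e12
    · simpa [real_inner_comm] using e12
    · simpa using e22
  obtain ⟨B, hB⟩ := Orthonormal.exists_orthonormalBasis_extension_of_card_eq (𝕜 := ℝ)
    (ι := Fin 2) (by simpa using hE) (v := f) (s := univ)
    (hon.comp _ Subtype.val_injective)
  refine ⟨B.repr, fun v ↦ ?_⟩
  ext i
  rw [B.repr_apply_apply, hB i (mem_univ i)]
  fin_cases i
  · simp [hf, inner_smul_left, div_eq_inv_mul]
  · simp [hf, inner_smul_left, inner_sub_left, div_eq_inv_mul]

variable {M : Type*} [EMetricSpace M] [ChartedSpace (EuclideanHalfSpace 2) M]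

lemma exists_chart_cover [CompactSpace M] [Nonempty M] :
    ∃ s : ℕ → M, ∀ x, ∃ n, x ∈ (chartAt (EuclideanHalfSpace 2) (s n)).source := by
  obtain ⟨t, ht⟩ := CompactSpace.elim_nhds_subcover
    (fun x : M ↦ (chartAt (EuclideanHalfSpace 2) x).source) fun x ↦ chart_source_mem_nhds _ x
  have hne : (t : Set M).Nonempty := by
    by_contra h
    rw [not_nonempty_iff_eq_empty, Finset.coe_eq_empty] at h
    subst h
    obtain ⟨x⟩ := ‹Nonempty M›
    have : x ∈ (⊤ : Set M) := trivial
    rw [← ht] at this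
    simp at this
  obtain ⟨s, hs⟩ := t.countable_toSet.exists_eq_range hne
  refine ⟨s, fun x ↦ ?_⟩
  have : x ∈ (⊤ : Set M) := trivial
  rw [← ht] at this
  simp only [mem_iUnion, exists_prop] at this
  obtain ⟨y, hy, hxy⟩ := this
  have hy' : y ∈ range s := by rw [← hs]; exact hy
  obtain ⟨n, rfl⟩ := hy'
  exact ⟨n, hxy⟩

variable [IsManifold (𝓡∂ 2) ∞ M] [RiemannianBundle (fun x : M ↦ TangentSpace (𝓡∂ 2) x)]
  [MeasurableSpace M] [BorelSpace M]

/-- A family of isometries of the tangent spaces with the plane, depending measurably on the point. -/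
def IsMeasurableFrame (J : (x : M) → TangentSpace (𝓡∂ 2) x ≃ₗᵢ[ℝ] Plane) : Prop :=
  ∀ (p : M) (e : Plane), AEMeasurable (fun x ↦ J x (chartVec p e x))
    ((area M).restrict (chartAt (EuclideanHalfSpace 2) p).source)

lemma exists_chart_isometry {c x : M} (hx : x ∈ (chartAt (EuclideanHalfSpace 2) c).source) :
    ∃ J : TangentSpace (𝓡∂ 2) x ≃ₗᵢ[ℝ] Plane, ∀ v, J v =
      !₂[inner ℝ (chartVec c (EuclideanSpace.single 0 1) x) v / √(gram c 0 0 x),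
        (inner ℝ (chartVec c (EuclideanSpace.single 1 1) x) v - gram c 0 1 x / gram c 0 0 x *
          inner ℝ (chartVec c (EuclideanSpace.single 0 1) x) v) /
        √((gram c 0 0 x * gram c 1 1 x - gram c 0 1 x ^ 2) / gram c 0 0 x)] := by
  have : FiniteDimensional ℝ (TangentSpace (𝓡∂ 2) x) :=
    inferInstanceAs (FiniteDimensional ℝ Plane)
  have hfr : Module.finrank ℝ (TangentSpace (𝓡∂ 2) x) = 2 :=
    (finrank_euclideanSpace_fin : Module.finrank ℝ Plane = 2)
  exact exists_gramSchmidt_isometry hfr (gram_zero_pos hx) (gram_det_pos hx)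

variable [IsContinuousRiemannianBundle Plane (fun x : M ↦ TangentSpace (𝓡∂ 2) x)]
  [CompactSpace M] [Nonempty M]

variable (M) in
lemma exists_isMeasurableFrame :
    ∃ J : (x : M) → TangentSpace (𝓡∂ 2) x ≃ₗᵢ[ℝ] Plane, IsMeasurableFrame J := by
  classical
  obtain ⟨s, hs⟩ := exists_chart_cover (M := M)
  -- At each point the frame is obtained by Gram–Schmidt in the first chart of a countable cover
  -- containing it. The sets where `idx` is constant are measurable, and on each of them the frame
  -- is given by continuous formulas.
  set idx : M → ℕ := fun x ↦ Nat.find (hs x) with hidx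
  have hmem : ∀ x, x ∈ (chartAt (EuclideanHalfSpace 2) (s (idx x))).source :=
    fun x ↦ Nat.find_spec (hs x)
  have hidxm : Measurable idx :=
    measurable_find hs fun n ↦ (chartAt (EuclideanHalfSpace 2) (s n)).open_source.measurableSet
  choose J hJ using fun x ↦ exists_chart_isometry (hmem x)
  refine ⟨J, fun p e ↦ ?_⟩
  set S := (chartAt (EuclideanHalfSpace 2) p).source
  have hSo : IsOpen S := (chartAt (EuclideanHalfSpace 2) p).open_source
  have hcov : S = ⋃ n, S ∩ idx ⁻¹' {n} := by
    ext x; simp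
  rw [hcov, aemeasurable_iUnion_iff]
  intro n
  set T := (chartAt (EuclideanHalfSpace 2) (s n)).source
  have hTo : IsOpen T := (chartAt (EuclideanHalfSpace 2) (s n)).open_source
  set F : M → Plane := fun x ↦
    !₂[inner ℝ (chartVec (s n) (EuclideanSpace.single 0 1) x) (chartVec p e x) / √(gram (s n) 0 0 x),
        (inner ℝ (chartVec (s n) (EuclideanSpace.single 1 1) x) (chartVec p e x) -
          gram (s n) 0 1 x / gram (s n) 0 0 x *
          inner ℝ (chartVec (s n) (EuclideanSpace.single 0 1) x) (chartVec p e x)) /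
        √((gram (s n) 0 0 x * gram (s n) 1 1 x - gram (s n) 0 1 x ^ 2) / gram (s n) 0 0 x)] with hF
  have hFc : ContinuousOn F (T ∩ S) := by
    have hi : ∀ i : Fin 2, ContinuousOn (fun x ↦
        inner ℝ (chartVec (s n) (EuclideanSpace.single i 1) x) (chartVec p e x)) (T ∩ S) :=
      fun i ↦ continuousOn_inner_chartVec (s n) p _ _
    have hg : ∀ i j, ContinuousOn (gram (s n) i j) (T ∩ S) := fun i j ↦
      (continuousOn_gram (s n) i j).mono inter_subset_left
    have hg0 : ∀ x ∈ T ∩ S, gram (s n) 0 0 x ≠ 0 := fun x hx ↦ (gram_zero_pos hx.1).ne'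
    have h1 : ContinuousOn (fun x ↦ inner ℝ (chartVec (s n) (EuclideanSpace.single 0 1) x)
        (chartVec p e x) / √(gram (s n) 0 0 x)) (T ∩ S) :=
      (hi 0).div (hg 0 0).sqrt fun x hx ↦ (Real.sqrt_pos.2 (gram_zero_pos hx.1)).ne'
    have h2 := ((hi 1).sub (((hg 0 1).div (hg 0 0) hg0).mul (hi 0))).div
      (((((hg 0 0).mul (hg 1 1)).sub ((hg 0 1).pow 2)).div (hg 0 0) hg0).sqrt)
      fun x hx ↦ (Real.sqrt_pos.2 (div_pos (gram_det_pos hx.1) (gram_zero_pos hx.1))).ne'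
    refine (PiLp.continuous_toLp 2 _).comp_continuousOn (continuousOn_pi.2 fun i ↦ ?_)
    fin_cases i
    · exact h1
    · exact h2
  have hFm : AEMeasurable F ((area M).restrict (T ∩ S)) :=
    hFc.aemeasurable (hTo.inter hSo).measurableSet
  have hsub : S ∩ idx ⁻¹' {n} ⊆ T ∩ S := by
    rintro x ⟨hx, hn⟩
    have hn : idx x = n := hn
    refine ⟨?_, hx⟩
    have := hmem x
    rwa [hn] at this
  have hms : MeasurableSet (S ∩ idx ⁻¹' {n}) :=
    hSo.measurableSet.inter (hidxm (measurableSet_singleton n))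
  refine (hFm.mono_measure (Measure.restrict_mono hsub le_rfl)).congr ?_
  filter_upwards [ae_restrict_mem hms] with x hx
  have hn : idx x = n := hx.2
  rw [hJ x, hF]
  simp only [hn]

variable {J : (x : M) → TangentSpace (𝓡∂ 2) x ≃ₗᵢ[ℝ] Plane}

lemma aemeasurable_of_chart_cover {F : Type*} [MeasurableSpace F] {f : M → F}
    (h : ∀ p, AEMeasurable f ((area M).restrict (chartAt (EuclideanHalfSpace 2) p).source)) :
    AEMeasurable f (area M) := by
  obtain ⟨s, hs⟩ := exists_chart_cover (M := M)
  have hcov : (⋃ n, (chartAt (EuclideanHalfSpace 2) (s n)).source) = univ := by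
    ext x; simpa using hs x
  rw [← Measure.restrict_univ (μ := area M), ← hcov, aemeasurable_iUnion_iff]
  exact fun n ↦ h (s n)

omit [CompactSpace M] [Nonempty M] in
-- Cramer's rule with the Gram matrix recovers the components from the inner products with the
-- coordinate frame.
lemma aemeasurable_chartComponents_of_inner {p : M} {X : TangentField M}
    (hw : ∀ i : Fin 2, AEMeasurable
      (fun x ↦ inner ℝ (chartVec p (EuclideanSpace.single i 1) x) (X x))
      ((area M).restrict (chartAt (EuclideanHalfSpace 2) p).source)) :
    AEMeasurable (chartComponents p X)
      ((area M).restrict (chartAt (EuclideanHalfSpace 2) p).source) := by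
  set S := (chartAt (EuclideanHalfSpace 2) p).source
  have hS : MeasurableSet S := (chartAt (EuclideanHalfSpace 2) p).open_source.measurableSet
  have hg : ∀ i j, AEMeasurable (gram p i j) ((area M).restrict S) := fun i j ↦
    (continuousOn_gram p i j).aemeasurable hS
  set D : M → ℝ := fun x ↦ gram p 0 0 x * gram p 1 1 x - gram p 0 1 x ^ 2
  have hD : AEMeasurable D ((area M).restrict S) :=
    ((hg 0 0).mul (hg 1 1)).sub ((hg 0 1).pow_const 2)
  set w : Fin 2 → M → ℝ := fun i x ↦
    inner ℝ (chartVec p (EuclideanSpace.single i 1) x) (X x) with hwdef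
  have hV : AEMeasurable (fun x ↦ (!₂[(gram p 1 1 x * w 0 x - gram p 0 1 x * w 1 x) / D x,
      (gram p 0 0 x * w 1 x - gram p 0 1 x * w 0 x) / D x] : Plane)) ((area M).restrict S) := by
    refine (PiLp.continuous_toLp 2 _).measurable.comp_aemeasurable
      (aemeasurable_pi_lambda _ fun i ↦ ?_)
    fin_cases i
    · exact (((hg 1 1).mul (hw 0)).sub ((hg 0 1).mul (hw 1))).div hD
    · exact (((hg 0 0).mul (hw 1)).sub ((hg 0 1).mul (hw 0))).div hD
  refine hV.congr ?_
  filter_upwards [ae_restrict_mem hS] with x hx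
  have hDx : 0 < D x := gram_det_pos hx
  set v := chartComponents p X x with hv
  have hXv : X x = chartVec p v x := (chartVec_chartComponents hx X).symm
  have hwi : ∀ i, w i x = gram p i 0 x * v 0 + gram p i 1 x * v 1 := by
    intro i
    simp only [hwdef, hXv]
    rw [chartVec_eq_sum p v x, inner_add_right, inner_smul_right, inner_smul_right]
    simp only [gram]; ring
  ext i
  fin_cases i
  · change (gram p 1 1 x * w 0 x - gram p 0 1 x * w 1 x) / D x = v 0
    rw [div_eq_iff hDx.ne', hwi, hwi, gram_comm p 1 0]
    simp only [D]; ring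
  · change (gram p 0 0 x * w 1 x - gram p 0 1 x * w 0 x) / D x = v 1
    rw [div_eq_iff hDx.ne', hwi, hwi, gram_comm p 1 0]
    simp only [D]; ring

lemma aemeasurable_frame_iff (hJ : IsMeasurableFrame J) (X : TangentField M) :
    AEMeasurable (fun x ↦ J x (X x)) (area M) ↔
      ∀ p : M, AEMeasurable (chartComponents p X)
        ((area M).restrict (chartAt (EuclideanHalfSpace 2) p).source) := by
  constructor
  · intro h p
    refine aemeasurable_chartComponents_of_inner fun i ↦ ?_
    simp_rw [← fun x v w ↦ LinearIsometryEquiv.inner_map_map (J x) v w]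
    exact (hJ p _).inner h.restrict
  · refine fun h ↦ aemeasurable_of_chart_cover fun p ↦ ?_
    have hS : MeasurableSet (chartAt (EuclideanHalfSpace 2) p).source :=
      (chartAt (EuclideanHalfSpace 2) p).open_source.measurableSet
    have hc : ∀ i : Fin 2, AEMeasurable (fun x ↦ chartComponents p X x i)
        ((area M).restrict (chartAt (EuclideanHalfSpace 2) p).source) := fun i ↦
      (EuclideanSpace.proj (𝕜 := ℝ) i).continuous.measurable.comp_aemeasurable (h p)
    refine (((hc 0).smul (hJ p (EuclideanSpace.single 0 1))).add
      ((hc 1).smul (hJ p (EuclideanSpace.single 1 1)))).congr ?_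
    filter_upwards [ae_restrict_mem hS] with x hx
    conv_rhs => rw [← chartVec_chartComponents hx X, chartVec_eq_sum, map_add, map_smul, map_smul]
    rfl

lemma isL2Field_iff (hJ : IsMeasurableFrame J) (X : TangentField M) :
    IsL2Field X ↔ MemLp (fun x ↦ J x (X x)) 2 (area M) := by
  rw [IsL2Field, ← aemeasurable_frame_iff hJ, MemLp, aestronglyMeasurable_iff_aemeasurable,
    eLpNorm_lt_top_iff_lintegral_rpow_enorm_lt_top two_ne_zero ENNReal.ofNat_ne_top]
  have : ∀ x, ‖J x (X x)‖ₑ = ‖X x‖ₑ := fun x ↦ (J x).toLinearIsometry.enorm_map (X x)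
  simp [this]

end Frames

/-! ### Continuous functionals given by integration. -/

section Functionals

/-- Integration against a bounded function, for a measure `ν` dominated by the finite measure `μ`,
is a continuous functional on `L²(μ)`. -/
lemma exists_integral_inner_functional {α F : Type*} [MeasurableSpace α] [NormedAddCommGroup F]
    [InnerProductSpace ℝ F] {μ ν : Measure α} [IsFiniteMeasure μ] {C : ℝ≥0} (hν : ν ≤ C • μ)
    {w : α → F} (hw : AEStronglyMeasurable w ν) {R : ℝ} (hR : ∀ᵐ x ∂ν, ‖w x‖ ≤ R) :
    ∃ l : Lp F 2 μ →L[ℝ] ℝ, ∀ u, l u = ∫ x, inner ℝ (w x) (u x) ∂ν := by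
  have hac : ν ≪ μ := (Measure.absolutelyContinuous_of_le hν).trans
    (Measure.smul_absolutelyContinuous (c := (C : ℝ≥0∞)))
  have hmem1 : ∀ u : Lp F 2 μ, MemLp u 1 ν := fun u ↦
    ((Lp.memLp u).mono_exponent (p := 1) one_le_two).of_measure_le_smul
      (c := (C : ℝ≥0∞)) ENNReal.coe_ne_top hν
  have hint : ∀ u : Lp F 2 μ, Integrable (fun x ↦ inner ℝ (w x) (u x)) ν := fun u ↦ by
    refine Integrable.mono' (g := fun x ↦ R * ‖u x‖)
      ((memLp_one_iff_integrable.1 (hmem1 u)).norm.const_mul R)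
      (hw.inner (hmem1 u).1) ?_
    filter_upwards [hR] with x hx
    exact (norm_inner_le_norm _ _).trans (by gcongr)
  let l₀ : Lp F 2 μ →ₗ[ℝ] ℝ :=
    { toFun := fun u ↦ ∫ x, inner ℝ (w x) (u x) ∂ν
      map_add' := fun u v ↦ by
        rw [← integral_add (hint u) (hint v)]
        refine integral_congr_ae ?_
        filter_upwards [hac.ae_le (Lp.coeFn_add u v)] with x hx
        rw [hx, Pi.add_apply, inner_add_right]
      map_smul' := fun c u ↦ by
        rw [RingHom.id_apply, smul_eq_mul, ← integral_const_mul]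
        refine integral_congr_ae ?_
        filter_upwards [hac.ae_le (Lp.coeFn_smul c u)] with x hx
        rw [hx, Pi.smul_apply, inner_smul_right] }
  set K : ℝ≥0∞ := C * μ univ ^ (1 / (1 : ℝ≥0∞).toReal - 1 / (2 : ℝ≥0∞).toReal) with hK
  have hKt : K ≠ ⊤ := by
    refine ENNReal.mul_ne_top ENNReal.coe_ne_top (ENNReal.rpow_ne_top_of_nonneg ?_
      (measure_ne_top _ _))
    norm_num
  refine ⟨l₀.mkContinuous (|R| * K.toReal) fun u ↦ ?_, fun u ↦ rfl⟩
  have h1 : eLpNorm u 1 ν ≤ K * eLpNorm u 2 μ := by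
    calc eLpNorm u 1 ν ≤ eLpNorm u 1 ((C : ℝ≥0∞) • μ) := eLpNorm_mono_measure _ hν
      _ = C * eLpNorm u 1 μ := by rw [eLpNorm_one_smul_measure]
      _ ≤ C * (eLpNorm u 2 μ * μ univ ^ (1 / (1 : ℝ≥0∞).toReal - 1 / (2 : ℝ≥0∞).toReal)) := by
        gcongr
        exact eLpNorm_le_eLpNorm_mul_rpow_measure_univ one_le_two (Lp.memLp u).1
      _ = _ := by rw [hK]; ring
  have h2 : ∫ x, ‖u x‖ ∂ν ≤ K.toReal * ‖u‖ := by
    rw [Lp.norm_def, ← ENNReal.toReal_mul, integral_norm_eq_lintegral_enorm (hmem1 u).1,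
      ← eLpNorm_one_eq_lintegral_enorm]
    exact ENNReal.toReal_mono (ENNReal.mul_ne_top hKt (Lp.eLpNorm_ne_top u)) h1
  calc ‖l₀ u‖ ≤ ∫ x, |R| * ‖u x‖ ∂ν := by
        refine norm_integral_le_of_norm_le
          ((memLp_one_iff_integrable.1 (hmem1 u)).norm.const_mul |R|) ?_
        filter_upwards [hR] with x hx
        exact (norm_inner_le_norm _ _).trans (by gcongr; exact hx.trans (le_abs_self R))
    _ = |R| * ∫ x, ‖u x‖ ∂ν := integral_const_mul _ _
    _ ≤ |R| * (K.toReal * ‖u‖) := by gcongr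
    _ = _ := by ring

end Functionals

/-! ### The weak gradient as a closed graph in `L² × L²`. -/

section WeakGradient

variable {M : Type*} [EMetricSpace M] [ChartedSpace (EuclideanHalfSpace 2) M]
  [IsManifold (𝓡∂ 2) ∞ M] [RiemannianBundle (fun x : M ↦ TangentSpace (𝓡∂ 2) x)]
  [MeasurableSpace M] [BorelSpace M]
  [IsContinuousRiemannianBundle Plane (fun x : M ↦ TangentSpace (𝓡∂ 2) x)]
  [CompactSpace M] [Nonempty M] [IsRiemannianManifold (𝓡∂ 2) M]
  {J : (x : M) → TangentSpace (𝓡∂ 2) x ≃ₗᵢ[ℝ] Plane}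

/-- Lebesgue measure on a compact part `K` of the image of the chart at `p`, seen on the surface. -/
noncomputable def chartMeasure (p : M) (K : Set Plane) : Measure M :=
  (volume.restrict K).map (extChartAt (𝓡∂ 2) p).symm

lemma ae_chartMeasure {p : M} {K : Set Plane} (hK : IsCompact K)
    (hKt : K ⊆ (extChartAt (𝓡∂ 2) p).target) :
    ∀ᵐ x ∂(chartMeasure p K), x ∈ (extChartAt (𝓡∂ 2) p).symm '' K := by
  have hm : MeasurableSet ((extChartAt (𝓡∂ 2) p).symm '' K) :=
    (hK.image_of_continuousOn ((continuousOn_extChartAt_symm p).mono hKt)).measurableSet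
  refine (mem_ae_map_iff (aemeasurable_extChartAt_symm hK hKt) hm).2 ?_
  filter_upwards [ae_restrict_mem hK.measurableSet] with y hy
  exact mem_image_of_mem _ hy

lemma image_symm_subset_source {p : M} {K : Set Plane} (hKt : K ⊆ (extChartAt (𝓡∂ 2) p).target) :
    (extChartAt (𝓡∂ 2) p).symm '' K ⊆ (chartAt (EuclideanHalfSpace 2) p).source := by
  rw [← extChartAt_source (𝓡∂ 2)]
  exact image_subset_iff.2 fun y hy ↦ (extChartAt (𝓡∂ 2) p).map_target (hKt hy)

/-- `chartMeasure p K` is carried by the chart domain and dominated by a multiple of the area. -/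
lemma aemeasurable_chartMeasure {p : M} {K : Set Plane} (hK : IsCompact K)
    (hKt : K ⊆ (extChartAt (𝓡∂ 2) p).target) {F : Type*} [MeasurableSpace F] {f : M → F}
    (hf : AEMeasurable f ((area M).restrict (chartAt (EuclideanHalfSpace 2) p).source)) :
    AEMeasurable f (chartMeasure p K) := by
  obtain ⟨C, hC⟩ := exists_map_symm_le hK hKt
  have hr : (chartMeasure p K).restrict (chartAt (EuclideanHalfSpace 2) p).source =
      chartMeasure p K := by
    refine Measure.restrict_eq_self_of_ae_mem ?_
    filter_upwards [ae_chartMeasure hK hKt] with x hx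
    exact image_symm_subset_source hKt hx
  rw [← hr]
  refine (hf.smul_measure C).mono_measure ?_
  rw [← Measure.restrict_smul]
  exact Measure.restrict_mono_measure hC _

lemma exists_norm_chartVec_le {p : M} {K : Set Plane} (hK : IsCompact K)
    (hKt : K ⊆ (extChartAt (𝓡∂ 2) p).target) (e : Plane) :
    ∃ R, ∀ x ∈ (extChartAt (𝓡∂ 2) p).symm '' K, ‖chartVec p e x‖ ≤ R := by
  have hKc : IsCompact ((extChartAt (𝓡∂ 2) p).symm '' K) :=
    hK.image_of_continuousOn ((continuousOn_extChartAt_symm p).mono hKt)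
  have hc : ContinuousOn (fun x ↦ ‖chartVec p e x‖) ((extChartAt (𝓡∂ 2) p).symm '' K) := by
    have h := (continuousOn_inner_chartVec p p e e).mono
      (t := (extChartAt (𝓡∂ 2) p).symm '' K)
      (fun x hx ↦ ⟨image_symm_subset_source hKt hx, image_symm_subset_source hKt hx⟩)
    refine h.sqrt.congr fun x _ ↦ ?_
    simp only [real_inner_self_eq_norm_sq, Real.sqrt_sq (norm_nonneg _)]
  obtain ⟨R, hR⟩ := hKc.exists_bound_of_continuousOn hc
  exact ⟨R, fun x hx ↦ by simpa using hR x hx⟩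

lemma integral_chartMeasure {p : M} {K : Set Plane} (hK : IsCompact K)
    (hKt : K ⊆ (extChartAt (𝓡∂ 2) p).target) {f : M → ℝ} {g : Plane → ℝ}
    (hf : AEMeasurable f (chartMeasure p K))
    (hfg : ∀ y ∈ K, g y = f ((extChartAt (𝓡∂ 2) p).symm y)) :
    ∫ x, f x ∂(chartMeasure p K) = ∫ y in K, g y := by
  rw [chartMeasure, integral_map (aemeasurable_extChartAt_symm hK hKt) hf.aestronglyMeasurable]
  exact setIntegral_congr_fun hK.measurableSet fun y hy ↦ (hfg y hy).symm

/-- Both sides of the definition of the weak gradient are continuous functionals. -/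
lemma exists_weakGradient_functionals (hJ : IsMeasurableFrame J) (p : M) (e : Plane)
    {ψ : Plane → ℝ} (hψ : ContDiff ℝ ∞ ψ) (hψc : HasCompactSupport ψ)
    (hψt : tsupport ψ ⊆ interior (extChartAt (𝓡∂ 2) p).target) :
    ∃ (l₁ : Lp ℝ 2 (area M) →L[ℝ] ℝ) (l₂ : Lp Plane 2 (area M) →L[ℝ] ℝ),
      (∀ u, ∫ y, u ((extChartAt (𝓡∂ 2) p).symm y) * fderiv ℝ ψ y e = l₁ u) ∧
      ∀ (X : TangentField M) (Z : Lp Plane 2 (area M)), (Z =ᵐ[area M] fun x ↦ J x (X x)) →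
        ∫ y, inner ℝ (X ((extChartAt (𝓡∂ 2) p).symm y))
          (mfderivWithin 𝓘(ℝ, Plane) (𝓡∂ 2) (extChartAt (𝓡∂ 2) p).symm (range (𝓡∂ 2)) y e) * ψ y =
          l₂ Z := by
  have : IsFiniteMeasure (area M) := isFiniteMeasure_area
  -- Only the compact support of `ψ` matters. There Lebesgue measure, pushed to the surface, is
  -- dominated by the area, so both integrals depend only on classes modulo null sets.
  set K := tsupport ψ
  have hK : IsCompact K := hψc
  have hKt : K ⊆ (extChartAt (𝓡∂ 2) p).target := hψt.trans interior_subset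
  obtain ⟨C, hC⟩ := exists_map_symm_le hK hKt
  have hC' : chartMeasure p K ≤ C • area M := hC
  have hac : chartMeasure p K ≪ area M := (Measure.absolutelyContinuous_of_le hC').trans
    (Measure.smul_absolutelyContinuous (c := (C : ℝ≥0∞)))
  have hright : ∀ y ∈ K, extChartAt (𝓡∂ 2) p ((extChartAt (𝓡∂ 2) p).symm y) = y := fun y hy ↦
    (extChartAt (𝓡∂ 2) p).right_inv (hKt hy)
  have hS : MeasurableSet (chartAt (EuclideanHalfSpace 2) p).source :=
    (chartAt (EuclideanHalfSpace 2) p).open_source.measurableSet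
  have hφ : ∀ {g : Plane → ℝ}, Continuous g → AEMeasurable (fun x ↦ g (extChartAt (𝓡∂ 2) p x))
      (chartMeasure p K) := fun hg ↦ by
    refine aemeasurable_chartMeasure hK hKt (ContinuousOn.aemeasurable ?_ hS)
    refine hg.comp_continuousOn ?_
    rw [← extChartAt_source (𝓡∂ 2)]
    exact continuousOn_extChartAt p
  -- The test function and its derivative are moved to the surface as bounded weights: `w₁` pairs
  -- with `u`, and `w₂` with the frame representation of `X`.
  set w₁ : M → ℝ := fun x ↦ fderiv ℝ ψ (extChartAt (𝓡∂ 2) p x) e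
  set w₂ : M → Plane := fun x ↦ ψ (extChartAt (𝓡∂ 2) p x) • J x (chartVec p e x)
  have hdc : Continuous fun y ↦ fderiv ℝ ψ y e :=
    (hψ.continuous_fderiv (by simp)).clm_apply continuous_const
  have hw₁ : AEMeasurable w₁ (chartMeasure p K) := hφ hdc
  have hw₂ : AEMeasurable w₂ (chartMeasure p K) :=
    (hφ hψ.continuous).smul (aemeasurable_chartMeasure hK hKt (hJ p e))
  obtain ⟨R₁, hR₁⟩ := hK.exists_bound_of_continuousOn hdc.continuousOn
  obtain ⟨R₂, hR₂⟩ := hK.exists_bound_of_continuousOn hψ.continuous.continuousOn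
  obtain ⟨R₃, hR₃⟩ := exists_norm_chartVec_le hK hKt e
  have hb₁ : ∀ᵐ x ∂(chartMeasure p K), ‖w₁ x‖ ≤ R₁ := by
    filter_upwards [ae_chartMeasure hK hKt] with x hx
    obtain ⟨y, hy, rfl⟩ := hx
    simp only [w₁, hright y hy]
    exact hR₁ y hy
  have hb₂ : ∀ᵐ x ∂(chartMeasure p K), ‖w₂ x‖ ≤ R₂ * R₃ := by
    filter_upwards [ae_chartMeasure hK hKt] with x hx
    obtain ⟨y, hy, rfl⟩ := hx
    simp only [w₂, hright y hy, norm_smul, LinearIsometryEquiv.norm_map]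
    have := hR₂ y hy
    exact mul_le_mul this (hR₃ _ (mem_image_of_mem _ hy)) (norm_nonneg _)
      ((norm_nonneg _).trans this)
  obtain ⟨l₁, hl₁⟩ := exists_integral_inner_functional hC' hw₁.aestronglyMeasurable hb₁
  obtain ⟨l₂, hl₂⟩ := exists_integral_inner_functional hC' hw₂.aestronglyMeasurable hb₂
  refine ⟨l₁, l₂, fun u ↦ ?_, fun X Z hZ ↦ ?_⟩
  · have hu : AEMeasurable u (chartMeasure p K) :=
      (Lp.aestronglyMeasurable u).aemeasurable.mono_ac hac
    rw [hl₁, integral_chartMeasure hK hKt (hw₁.inner hu)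
      (g := fun y ↦ u ((extChartAt (𝓡∂ 2) p).symm y) * fderiv ℝ ψ y e)]
    · refine (setIntegral_eq_integral_of_forall_compl_eq_zero fun y hy ↦ ?_).symm
      have : fderiv ℝ ψ y = 0 := by
        by_contra h
        exact hy (support_fderiv_subset ℝ h)
      simp [this]
    · intro y hy
      simp only [w₁, hright y hy]
      simp
  · have hZ' : AEMeasurable Z (chartMeasure p K) :=
      (Lp.aestronglyMeasurable Z).aemeasurable.mono_ac hac
    have hcongr : (fun x ↦ inner ℝ (w₂ x) (Z x)) =ᵐ[chartMeasure p K]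
        fun x ↦ inner ℝ (w₂ x) (J x (X x)) := by
      filter_upwards [hac.ae_le hZ] with x hx
      rw [hx]
    rw [hl₂, integral_congr_ae hcongr, integral_chartMeasure hK hKt ((hw₂.inner hZ').congr hcongr)
      (g := fun y ↦ inner ℝ (X ((extChartAt (𝓡∂ 2) p).symm y))
          (mfderivWithin 𝓘(ℝ, Plane) (𝓡∂ 2) (extChartAt (𝓡∂ 2) p).symm (range (𝓡∂ 2)) y e) * ψ y)]
    · refine (setIntegral_eq_integral_of_forall_compl_eq_zero fun y hy ↦ ?_).symm
      simp [image_eq_zero_of_notMem_tsupport hy]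
    · intro y hy
      rw [mfderivWithin_symm_eq_chartVec (hKt hy)]
      simp only [w₂, hright y hy, real_inner_smul_left, LinearIsometryEquiv.inner_map_map]
      rw [real_inner_comm, mul_comm]

/-- The pairs of a function and the frame representation of its weak gradient. -/
noncomputable def weakGraph (J : (x : M) → TangentSpace (𝓡∂ 2) x ≃ₗᵢ[ℝ] Plane) :
    Set (Lp ℝ 2 (area M) × Lp Plane 2 (area M)) :=
  {q | IsWeakGradient q.1 fun x ↦ (J x).symm (q.2 x)}

lemma isWeakGradient_iff_mem_weakGraph (hJ : IsMeasurableFrame J) {u : Lp ℝ 2 (area M)}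
    {X : TangentField M} {Z : Lp Plane 2 (area M)} (hZ : Z =ᵐ[area M] fun x ↦ J x (X x)) :
    IsWeakGradient u X ↔ (u, Z) ∈ weakGraph J := by
  have hZ' : Z =ᵐ[area M] fun x ↦ J x ((J x).symm (Z x)) := by simp
  simp only [weakGraph, IsWeakGradient, mem_ofPred_eq]
  refine forall_congr' fun p ↦ forall_congr' fun e ↦ forall_congr' fun ψ ↦
    forall_congr' fun h1 ↦ forall_congr' fun h2 ↦ forall_congr' fun h3 ↦ ?_
  obtain ⟨l₁, l₂, hl₁, hl₂⟩ := exists_weakGradient_functionals hJ p e h1 h2 h3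
  rw [hl₂ X Z hZ, hl₂ _ Z hZ']

/-- Each choice of chart, direction and test function gives one continuous linear equation;
closedness and linearity of the graph follow. -/
lemma exists_functionals_weakGraph (hJ : IsMeasurableFrame J) :
    ∃ S : Set (Lp ℝ 2 (area M) × Lp Plane 2 (area M) →L[ℝ] ℝ),
      weakGraph J = {q | ∀ l ∈ S, l q = 0} := by
  have hZ' : ∀ Z : Lp Plane 2 (area M), Z =ᵐ[area M] fun x ↦ J x ((J x).symm (Z x)) := by simp
  refine ⟨{l | ∃ (p : M) (e : Plane) (ψ : Plane → ℝ), ContDiff ℝ ∞ ψ ∧ HasCompactSupport ψ ∧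
    tsupport ψ ⊆ interior (extChartAt (𝓡∂ 2) p).target ∧ ∀ q, l q =
      (∫ y, q.1 ((extChartAt (𝓡∂ 2) p).symm y) * fderiv ℝ ψ y e) +
      ∫ y, inner ℝ ((J ((extChartAt (𝓡∂ 2) p).symm y)).symm (q.2 ((extChartAt (𝓡∂ 2) p).symm y)))
        (mfderivWithin 𝓘(ℝ, Plane) (𝓡∂ 2) (extChartAt (𝓡∂ 2) p).symm (range (𝓡∂ 2)) y e) * ψ y},
    ?_⟩
  ext ⟨u, Z⟩
  simp only [weakGraph, IsWeakGradient, mem_ofPred_eq]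
  constructor
  · rintro h l ⟨p, e, ψ, h1, h2, h3, hl⟩
    rw [hl]
    exact add_eq_zero_iff_eq_neg.2 (h p e ψ h1 h2 h3)
  · intro h p e ψ h1 h2 h3
    obtain ⟨l₁, l₂, hl₁, hl₂⟩ := exists_weakGradient_functionals hJ p e h1 h2 h3
    have := h (l₁.comp (ContinuousLinearMap.fst ℝ _ _) + l₂.comp (ContinuousLinearMap.snd ℝ _ _))
      ⟨p, e, ψ, h1, h2, h3, fun q ↦ by rw [hl₁, hl₂ _ _ (hZ' q.2)]; rfl⟩
    rw [hl₁, hl₂ _ _ (hZ' Z)]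
    exact eq_neg_of_add_eq_zero_left this

lemma isClosed_weakGraph (hJ : IsMeasurableFrame J) : IsClosed (weakGraph J) := by
  obtain ⟨S, hS⟩ := exists_functionals_weakGraph hJ
  have : weakGraph J = ⋂ l ∈ S, {q | l q = 0} := by rw [hS]; ext; simp
  rw [this]
  exact isClosed_biInter fun l _ ↦ isClosed_eq l.continuous continuous_const

lemma add_mem_weakGraph (hJ : IsMeasurableFrame J) {q q' : Lp ℝ 2 (area M) × Lp Plane 2 (area M)}
    (h : q ∈ weakGraph J) (h' : q' ∈ weakGraph J) : q + q' ∈ weakGraph J := by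
  obtain ⟨S, hS⟩ := exists_functionals_weakGraph hJ
  rw [hS] at h h' ⊢
  intro l hl
  rw [map_add, h l hl, h' l hl, add_zero]

lemma smul_mem_weakGraph (hJ : IsMeasurableFrame J) (c : ℝ)
    {q : Lp ℝ 2 (area M) × Lp Plane 2 (area M)} (h : q ∈ weakGraph J) : c • q ∈ weakGraph J := by
  obtain ⟨S, hS⟩ := exists_functionals_weakGraph hJ
  rw [hS] at h ⊢
  intro l hl
  rw [map_smul, h l hl, smul_zero]

/-- The weak gradient of the zero function is zero. -/
lemma eq_zero_of_mem_weakGraph (hJ : IsMeasurableFrame J) {Z : Lp Plane 2 (area M)}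
    (h : ((0 : Lp ℝ 2 (area M)), Z) ∈ weakGraph J) : Z = 0 := by
  have : IsFiniteMeasure (area M) := isFiniteMeasure_area
  have : SecondCountableTopology M := EMetric.secondCountable_of_sigmaCompact M
  have hZ' : Z =ᵐ[area M] fun x ↦ J x ((J x).symm (Z x)) := by simp
  have hmain : ∀ (p : M) (e : Plane), ∀ᵐ x ∂(area M),
      x ∈ (chartAt (EuclideanHalfSpace 2) p).source → inner ℝ (J x (chartVec p e x)) (Z x) = 0 := by
    intro p e
    set O := interior (extChartAt (𝓡∂ 2) p).target
    set G : Plane → ℝ := fun y ↦ inner ℝ ((J ((extChartAt (𝓡∂ 2) p).symm y)).symm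
      (Z ((extChartAt (𝓡∂ 2) p).symm y)))
      (mfderivWithin 𝓘(ℝ, Plane) (𝓡∂ 2) (extChartAt (𝓡∂ 2) p).symm (range (𝓡∂ 2)) y e) with hG
    have hGeq : ∀ y ∈ (extChartAt (𝓡∂ 2) p).target, G y = inner ℝ
        (J ((extChartAt (𝓡∂ 2) p).symm y) (chartVec p e ((extChartAt (𝓡∂ 2) p).symm y)))
        (Z ((extChartAt (𝓡∂ 2) p).symm y)) := by
      intro y hy
      rw [hG]
      simp only
      rw [mfderivWithin_symm_eq_chartVec hy, ← LinearIsometryEquiv.inner_map_map (J _),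
        LinearIsometryEquiv.apply_symm_apply, real_inner_comm]
    have hloc : LocallyIntegrableOn G O := by
      rw [locallyIntegrableOn_iff isOpen_interior.isLocallyClosed]
      intro K hKO hK
      have hKt : K ⊆ (extChartAt (𝓡∂ 2) p).target := hKO.trans interior_subset
      obtain ⟨C, hC⟩ := exists_map_symm_le hK hKt
      have hC' : chartMeasure p K ≤ C • area M := hC
      obtain ⟨R, hR⟩ := exists_norm_chartVec_le hK hKt e
      have hw := aemeasurable_chartMeasure hK hKt (hJ p e)
      have hZ1 : MemLp Z 1 (chartMeasure p K) :=
        ((Lp.memLp Z).mono_exponent (p := 1) one_le_two).of_measure_le_smul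
          (c := (C : ℝ≥0∞)) ENNReal.coe_ne_top hC'
      have hi : Integrable (fun x ↦ inner ℝ (J x (chartVec p e x)) (Z x)) (chartMeasure p K) := by
        refine Integrable.mono' (g := fun x ↦ R * ‖Z x‖)
          ((memLp_one_iff_integrable.1 hZ1).norm.const_mul R)
          (hw.aestronglyMeasurable.inner hZ1.1) ?_
        filter_upwards [ae_chartMeasure hK hKt] with x hx
        refine (norm_inner_le_norm _ _).trans ?_
        rw [LinearIsometryEquiv.norm_map]
        gcongr
        exact hR x hx
      have hi2 := hi.comp_aemeasurable (aemeasurable_extChartAt_symm hK hKt)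
      refine hi2.congr ?_
      filter_upwards [ae_restrict_mem hK.measurableSet] with y hy
      exact (hGeq y (hKt hy)).symm
    -- With `u = 0` the pairing of `G` with every test function vanishes, so the fundamental lemma
    -- of the calculus of variations applies on the open set `O`.
    have hzero : ∀ᵐ y ∂(volume : Measure Plane), y ∈ O → G y = 0 := by
      refine isOpen_interior.ae_eq_zero_of_integral_contDiff_smul_eq_zero hloc ?_
      intro ψ h1 h2 h3
      obtain ⟨l₁, l₂, hl₁, hl₂⟩ := exists_weakGradient_functionals hJ p e h1 h2 h3
      have h4 := h p e ψ h1 h2 h3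
      simp only at h4
      rw [hl₁, map_zero] at h4
      have h5 : ∫ y, G y * ψ y = 0 := by
        rw [hG]; linarith
      simpa [mul_comm] using h5
    -- Exceptional sets of the chart pull back to sets of zero area, as do the points sent outside
    -- `O`.
    have hnull := area_preimage_eq_zero p (ae_iff.1 hzero)
    have hbd := area_source_diff_interior p
    rw [measure_eq_zero_iff_ae_notMem] at hnull hbd
    filter_upwards [hnull, hbd] with x h1 h2 hx
    have hx' : x ∈ (extChartAt (𝓡∂ 2) p).source := by rwa [extChartAt_source]
    have hO : extChartAt (𝓡∂ 2) p x ∈ O := by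
      by_contra hcon
      exact h2 ⟨hx, hcon⟩
    have hG0 : G (extChartAt (𝓡∂ 2) p x) = 0 := by
      by_contra hcon
      exact h1 ⟨hx, fun hcon' ↦ hcon (hcon' hO)⟩
    rw [hGeq _ ((extChartAt (𝓡∂ 2) p).map_source hx'), (extChartAt (𝓡∂ 2) p).left_inv hx'] at hG0
    exact hG0
  obtain ⟨s, hs⟩ := exists_chart_cover (M := M)
  have hall : ∀ᵐ x ∂(area M), ∀ (n : ℕ) (i : Fin 2),
      x ∈ (chartAt (EuclideanHalfSpace 2) (s n)).source →
        inner ℝ (J x (chartVec (s n) (EuclideanSpace.single i 1) x)) (Z x) = 0 := by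
    rw [ae_all_iff]
    intro n
    rw [ae_all_iff]
    exact fun i ↦ hmain (s n) _
  rw [Lp.eq_zero_iff_ae_eq_zero]
  filter_upwards [hall] with x hx
  obtain ⟨n, hn⟩ := hs x
  set v := chartComponents (s n) (fun z ↦ (J z).symm (Z z)) x
  have hv : chartVec (s n) v x = (J x).symm (Z x) := chartVec_chartComponents hn _
  have hZv : Z x = J x (chartVec (s n) v x) := by rw [hv]; simp
  have h0 := hx n 0 hn
  have h1 := hx n 1 hn
  -- `Z x` is orthogonal to a frame that spans, hence to itself.
  have : inner ℝ (Z x) (Z x) = 0 := by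
    have hZ2 : Z x = v 0 • J x (chartVec (s n) (EuclideanSpace.single 0 1) x) +
        v 1 • J x (chartVec (s n) (EuclideanSpace.single 1 1) x) := by
      rw [hZv, chartVec_eq_sum, map_add, map_smul, map_smul]
    calc inner ℝ (Z x) (Z x) = inner ℝ (v 0 • J x (chartVec (s n) (EuclideanSpace.single 0 1) x) +
          v 1 • J x (chartVec (s n) (EuclideanSpace.single 1 1) x)) (Z x) := by rw [← hZ2]
      _ = 0 := by rw [inner_add_left, real_inner_smul_left, real_inner_smul_left, h0, h1]; simp
  exact inner_self_eq_zero.1 this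

end WeakGradient

/-! ### Classical gradients of smooth functions. -/

section Gradient

variable {M : Type*} [EMetricSpace M] [ChartedSpace (EuclideanHalfSpace 2) M]
  [RiemannianBundle (fun x : M ↦ TangentSpace (𝓡∂ 2) x)]

lemma inner_grad (f : M → ℝ) (x : M) (v : TangentSpace (𝓡∂ 2) x) :
    inner ℝ (grad f x) v = mfderiv (𝓡∂ 2) 𝓘(ℝ, ℝ) f x v := by
  have : FiniteDimensional ℝ (TangentSpace (𝓡∂ 2) x) :=
    inferInstanceAs (FiniteDimensional ℝ Plane)
  have : CompleteSpace (TangentSpace (𝓡∂ 2) x) := FiniteDimensional.complete ℝ _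
  exact InnerProductSpace.toDual_symm_apply

variable {f g : M → ℝ}

lemma grad_add (hf : ContMDiff (𝓡∂ 2) 𝓘(ℝ, ℝ) ∞ f) (hg : ContMDiff (𝓡∂ 2) 𝓘(ℝ, ℝ) ∞ g) (x : M) :
    grad (f + g) x = grad f x + grad g x := by
  refine ext_inner_right ℝ fun v ↦ ?_
  rw [inner_add_left, inner_grad, inner_grad, inner_grad,
    mfderiv_add (hf.mdifferentiable (by simp) x) (hg.mdifferentiable (by simp) x)]
  rfl

lemma grad_smul (c : ℝ) (hf : ContMDiff (𝓡∂ 2) 𝓘(ℝ, ℝ) ∞ f) (x : M) :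
    grad (c • f) x = c • grad f x := by
  refine ext_inner_right ℝ fun v ↦ ?_
  rw [real_inner_smul_left, inner_grad, inner_grad,
    const_smul_mfderiv (hf.mdifferentiable (by simp) x)]
  rfl

variable [IsManifold (𝓡∂ 2) ∞ M]

lemma contDiffOn_comp_symm (hf : ContMDiff (𝓡∂ 2) 𝓘(ℝ, ℝ) ∞ f) (p : M) :
    ContDiffOn ℝ ∞ (f ∘ (extChartAt (𝓡∂ 2) p).symm) (extChartAt (𝓡∂ 2) p).target := by
  rw [← contMDiffOn_iff_contDiffOn]
  exact hf.comp_contMDiffOn (contMDiffOn_extChartAt_symm p)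

/-- Chain rule within the chart target. The target has unique derivatives, so the formula also holds
on the edge of the half-plane. -/
lemma fderivWithin_comp_symm (hf : ContMDiff (𝓡∂ 2) 𝓘(ℝ, ℝ) ∞ f) {p : M} {y : Plane}
    (hy : y ∈ (extChartAt (𝓡∂ 2) p).target) (e : Plane) :
    fderivWithin ℝ (f ∘ (extChartAt (𝓡∂ 2) p).symm) (extChartAt (𝓡∂ 2) p).target y e =
      inner ℝ (grad f ((extChartAt (𝓡∂ 2) p).symm y))
        (chartVec p e ((extChartAt (𝓡∂ 2) p).symm y)) := by
  have h1 : HasMFDerivWithinAt 𝓘(ℝ, Plane) (𝓡∂ 2) (extChartAt (𝓡∂ 2) p).symm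
      (extChartAt (𝓡∂ 2) p).target y _ :=
    ((mdifferentiableWithinAt_extChartAt_symm hy).hasMFDerivWithinAt).mono
      (extChartAt_target_subset_range p)
  have h2 := (hf.mdifferentiable (by simp) ((extChartAt (𝓡∂ 2) p).symm y)).hasMFDerivAt
  have h3 := hasMFDerivWithinAt_iff_hasFDerivWithinAt.1 (h2.comp_hasMFDerivWithinAt y h1)
  have key : ∀ D : Plane →L[ℝ] ℝ, HasFDerivWithinAt (f ∘ (extChartAt (𝓡∂ 2) p).symm) D
      (extChartAt (𝓡∂ 2) p).target y → fderivWithin ℝ (f ∘ (extChartAt (𝓡∂ 2) p).symm)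
        (extChartAt (𝓡∂ 2) p).target y e = D e := fun D hD ↦ by
    rw [hD.fderivWithin (uniqueDiffOn_extChartAt_target p y hy)]
  refine (key _ h3).trans ?_
  rw [inner_grad, ← mfderivWithin_symm_eq_chartVec hy]
  rfl

variable [MeasurableSpace M] [BorelSpace M]
  [IsContinuousRiemannianBundle Plane (fun x : M ↦ TangentSpace (𝓡∂ 2) x)]
  [CompactSpace M] [Nonempty M]
  {J : (x : M) → TangentSpace (𝓡∂ 2) x ≃ₗᵢ[ℝ] Plane}

lemma aemeasurable_grad (hJ : IsMeasurableFrame J) (hf : ContMDiff (𝓡∂ 2) 𝓘(ℝ, ℝ) ∞ f) :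
    AEMeasurable (fun x ↦ J x (grad f x)) (area M) := by
  rw [aemeasurable_frame_iff hJ]
  refine fun p ↦ aemeasurable_chartComponents_of_inner fun i ↦ ?_
  refine ContinuousOn.aemeasurable ?_ (chartAt (EuclideanHalfSpace 2) p).open_source.measurableSet
  rw [← extChartAt_source (𝓡∂ 2)]
  have hc := ((contDiffOn_comp_symm hf p).continuousOn_fderivWithin
    (uniqueDiffOn_extChartAt_target p) (by simp)).clm_apply
    (continuousOn_const (c := (EuclideanSpace.single i 1 : Plane)))
  refine (hc.comp (continuousOn_extChartAt p) (extChartAt (𝓡∂ 2) p).mapsTo).congr fun x hx ↦ ?_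
  rw [Function.comp_apply, fderivWithin_comp_symm hf ((extChartAt (𝓡∂ 2) p).map_source hx),
    (extChartAt (𝓡∂ 2) p).left_inv hx, real_inner_comm]

end Gradient

/-! ### Traces: linearity and closedness. -/

section Trace

lemma eLpNorm_two_sq {α F : Type*} [MeasurableSpace α] [NormedAddCommGroup F] {μ : Measure α}
    (f : α → F) : eLpNorm f 2 μ ^ 2 = ∫⁻ x, ‖f x‖ₑ ^ 2 ∂μ := by
  rw [eLpNorm_eq_lintegral_rpow_enorm_toReal two_ne_zero ENNReal.ofNat_ne_top,
    ← ENNReal.rpow_natCast, ← ENNReal.rpow_mul]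
  simp

variable {M : Type*} [EMetricSpace M] [ChartedSpace (EuclideanHalfSpace 2) M]
  [IsManifold (𝓡∂ 2) ∞ M] [RiemannianBundle (fun x : M ↦ TangentSpace (𝓡∂ 2) x)]
  [MeasurableSpace M] [BorelSpace M]
  [IsContinuousRiemannianBundle Plane (fun x : M ↦ TangentSpace (𝓡∂ 2) x)]
  [CompactSpace M] [Nonempty M] [IsRiemannianManifold (𝓡∂ 2) M]
  {J : (x : M) → TangentSpace (𝓡∂ 2) x ≃ₗᵢ[ℝ] Plane}

lemma exists_mem_weakGraph (hJ : IsMeasurableFrame J) {u : Lp ℝ 2 (area M)} (hu : u ∈ H1) :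
    ∃ Z, (u, Z) ∈ weakGraph J ∧ Z =ᵐ[area M] fun x ↦ J x (weakGrad u x) := by
  have hu' : ∃ X : TangentField M, IsL2Field X ∧ IsWeakGradient u X := hu
  have h : IsL2Field (weakGrad u) ∧ IsWeakGradient u (weakGrad u) := by
    rw [weakGrad, dif_pos hu']
    exact hu'.choose_spec
  have hm := (isL2Field_iff hJ _).1 h.1
  exact ⟨hm.toLp _, (isWeakGradient_iff_mem_weakGraph hJ hm.coeFn_toLp).1 h.2, hm.coeFn_toLp⟩

lemma mem_H1_of_mem_weakGraph (hJ : IsMeasurableFrame J) {u : Lp ℝ 2 (area M)}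
    {Z : Lp Plane 2 (area M)} (h : (u, Z) ∈ weakGraph J) : u ∈ H1 := by
  refine ⟨fun x ↦ (J x).symm (Z x), (isL2Field_iff hJ _).2 ?_, h⟩
  simpa using Lp.memLp Z

lemma eq_of_mem_weakGraph (hJ : IsMeasurableFrame J) {u : Lp ℝ 2 (area M)}
    {Z Z' : Lp Plane 2 (area M)} (h : (u, Z) ∈ weakGraph J) (h' : (u, Z') ∈ weakGraph J) :
    Z = Z' := by
  have h1 := add_mem_weakGraph hJ h (smul_mem_weakGraph hJ (-1) h')
  rw [← sub_eq_zero]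
  refine eq_zero_of_mem_weakGraph hJ ?_
  convert! h1 using 1
  ext1 <;> simp [sub_eq_add_neg]

lemma ae_eq_weakGrad (hJ : IsMeasurableFrame J) {u : Lp ℝ 2 (area M)}
    {Z : Lp Plane 2 (area M)} (h : (u, Z) ∈ weakGraph J) :
    Z =ᵐ[area M] fun x ↦ J x (weakGrad u x) := by
  obtain ⟨Z', h1, h2⟩ := exists_mem_weakGraph hJ (mem_H1_of_mem_weakGraph hJ h)
  rwa [eq_of_mem_weakGraph hJ h h1]

/-- The trace of a function with weak gradient `Z` (in the frame `J`), phrased with `L²` norms. -/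
def IsTraceTriple (J : (x : M) → TangentSpace (𝓡∂ 2) x ≃ₗᵢ[ℝ] Plane) (u : Lp ℝ 2 (area M))
    (Z : Lp Plane 2 (area M)) (h : Lp ℝ 2 (boundaryLength M)) : Prop :=
  (u, Z) ∈ weakGraph J ∧ ∀ ε : ℝ≥0∞, 0 < ε → ∃ f : M → ℝ, ContMDiff (𝓡∂ 2) 𝓘(ℝ, ℝ) ∞ f ∧
    eLpNorm (fun x ↦ u x - f x) 2 (area M) ≤ ε ∧
    eLpNorm (fun x ↦ Z x - J x (grad f x)) 2 (area M) ≤ ε ∧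
    eLpNorm (fun x ↦ h x - f x) 2 (boundaryLength M) ≤ ε

lemma eLpNorm_sub_grad {u : Lp ℝ 2 (area M)} {Z : Lp Plane 2 (area M)}
    (hZ : Z =ᵐ[area M] fun x ↦ J x (weakGrad u x)) (f : M → ℝ) :
    eLpNorm (fun x ↦ Z x - J x (grad f x)) 2 (area M) ^ 2 =
      ∫⁻ x, ‖weakGrad u x - grad f x‖ₑ ^ 2 ∂(area M) := by
  rw [eLpNorm_two_sq]
  refine lintegral_congr_ae ?_
  filter_upwards [hZ] with x hx
  rw [hx, ← map_sub]
  exact congrArg (· ^ 2) ((J x).toLinearIsometry.enorm_map _)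

lemma hasTrace_iff (hJ : IsMeasurableFrame J) (u : Lp ℝ 2 (area M))
    (h : Lp ℝ 2 (boundaryLength M)) : HasTrace u h ↔ ∃ Z, IsTraceTriple J u Z h := by
  have hsq : ∀ {a b : ℝ≥0∞}, a ^ 2 ≤ b ^ 2 → a ≤ b := fun hab ↦
    (ENNReal.pow_le_pow_left_iff two_ne_zero).1 hab
  constructor
  · rintro ⟨hu, f, hf, h1, h2, h3⟩
    obtain ⟨Z, hZ, hZu⟩ := exists_mem_weakGraph hJ hu
    refine ⟨Z, hZ, fun ε hε ↦ ?_⟩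
    have hε2 : (0 : ℝ≥0∞) < ε ^ 2 := by positivity
    obtain ⟨n, e1, e2, e3⟩ := ((h1.eventually_le_const hε2).and
      ((h2.eventually_le_const hε2).and (h3.eventually_le_const hε2))).exists
    refine ⟨f n, hf n, hsq ?_, hsq ?_, hsq ?_⟩
    · rwa [eLpNorm_two_sq]
    · rwa [eLpNorm_sub_grad hZu]
    · rwa [eLpNorm_two_sq]
  · rintro ⟨Z, hZ, h⟩
    have hZu := ae_eq_weakGrad hJ hZ
    -- At `n = 0` the tolerance is `⊤`, which does no harm in a limit.
    choose f hf h1 h2 h3 using fun n : ℕ ↦ h (n : ℝ≥0∞)⁻¹ (by simp)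
    have hlim : Tendsto (fun n : ℕ ↦ ((n : ℝ≥0∞)⁻¹) ^ 2) atTop (𝓝 0) := by
      have := ((ENNReal.continuous_pow 2).tendsto 0).comp ENNReal.tendsto_inv_nat_nhds_zero
      simpa using! this
    refine ⟨mem_H1_of_mem_weakGraph hJ hZ, f, hf, ?_, ?_, ?_⟩
    · refine tendsto_of_tendsto_of_tendsto_of_le_of_le tendsto_const_nhds hlim
        (fun _ ↦ zero_le) fun n ↦ ?_
      rw [← eLpNorm_two_sq]
      exact pow_le_pow_left' (h1 n) 2
    · refine tendsto_of_tendsto_of_tendsto_of_le_of_le tendsto_const_nhds hlim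
        (fun _ ↦ zero_le) fun n ↦ ?_
      rw [← eLpNorm_sub_grad hZu]
      exact pow_le_pow_left' (h2 n) 2
    · refine tendsto_of_tendsto_of_tendsto_of_le_of_le tendsto_const_nhds hlim
        (fun _ ↦ zero_le) fun n ↦ ?_
      rw [← eLpNorm_two_sq]
      exact pow_le_pow_left' (h3 n) 2

namespace IsTraceTriple

variable {u u' : Lp ℝ 2 (area M)} {Z Z' : Lp Plane 2 (area M)} {h h' : Lp ℝ 2 (boundaryLength M)}

lemma add (hJ : IsMeasurableFrame J) (H : IsTraceTriple J u Z h) (H' : IsTraceTriple J u' Z' h') :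
    IsTraceTriple J (u + u') (Z + Z') (h + h') := by
  refine ⟨add_mem_weakGraph hJ H.1 H'.1, fun ε hε ↦ ?_⟩
  have hε2 : 0 < ε / 2 := ENNReal.half_pos hε.ne'
  obtain ⟨f, hf, a1, a2, a3⟩ := H.2 _ hε2
  obtain ⟨g, hg, b1, b2, b3⟩ := H'.2 _ hε2
  have hfm := hf.continuous.measurable
  have hgm := hg.continuous.measurable
  refine ⟨f + g, hf.add hg, ?_, ?_, ?_⟩
  · calc _ = eLpNorm ((fun x ↦ u x - f x) + (fun x ↦ u' x - g x)) 2 (area M) := by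
          refine eLpNorm_congr_ae ?_
          filter_upwards [Lp.coeFn_add u u'] with x hx
          simp only [hx, Pi.add_apply]; ring
      _ ≤ _ := eLpNorm_add_le ((Lp.aestronglyMeasurable u).sub hfm.aestronglyMeasurable)
        ((Lp.aestronglyMeasurable u').sub hgm.aestronglyMeasurable) one_le_two
      _ ≤ ε / 2 + ε / 2 := add_le_add a1 b1
      _ = ε := ENNReal.add_halves ε
  · calc _ = eLpNorm ((fun x ↦ Z x - J x (grad f x)) + (fun x ↦ Z' x - J x (grad g x))) 2
          (area M) := by
          refine eLpNorm_congr_ae ?_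
          filter_upwards [Lp.coeFn_add Z Z'] with x hx
          simp only [hx, Pi.add_apply, grad_add hf hg, map_add]; abel
      _ ≤ _ := eLpNorm_add_le
        ((Lp.aestronglyMeasurable Z).sub (aemeasurable_grad hJ hf).aestronglyMeasurable)
        ((Lp.aestronglyMeasurable Z').sub (aemeasurable_grad hJ hg).aestronglyMeasurable) one_le_two
      _ ≤ ε / 2 + ε / 2 := add_le_add a2 b2
      _ = ε := ENNReal.add_halves ε
  · calc _ = eLpNorm ((fun x ↦ h x - f x) + (fun x ↦ h' x - g x)) 2 (boundaryLength M) := by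
          refine eLpNorm_congr_ae ?_
          filter_upwards [Lp.coeFn_add h h'] with x hx
          simp only [hx, Pi.add_apply]; ring
      _ ≤ _ := eLpNorm_add_le ((Lp.aestronglyMeasurable h).sub hfm.aestronglyMeasurable)
        ((Lp.aestronglyMeasurable h').sub hgm.aestronglyMeasurable) one_le_two
      _ ≤ ε / 2 + ε / 2 := add_le_add a3 b3
      _ = ε := ENNReal.add_halves ε

lemma smul (hJ : IsMeasurableFrame J) (c : ℝ) (H : IsTraceTriple J u Z h) :
    IsTraceTriple J (c • u) (c • Z) (c • h) := by
  refine ⟨smul_mem_weakGraph hJ c H.1, fun ε hε ↦ ?_⟩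
  -- The `+ 1` covers `c = 0`.
  have hc : ‖c‖ₑ * (ε / (‖c‖ₑ + 1)) ≤ ε := by
    rw [← mul_div_assoc]
    refine ENNReal.div_le_of_le_mul ?_
    rw [mul_comm]
    gcongr
    exact le_self_add
  obtain ⟨f, hf, a1, a2, a3⟩ := H.2 (ε / (‖c‖ₑ + 1)) (ENNReal.div_pos hε.ne' (by finiteness))
  refine ⟨c • f, (contDiff_const_smul c).contMDiff.comp hf, ?_, ?_, ?_⟩
  · calc _ = eLpNorm (c • (fun x ↦ u x - f x)) 2 (area M) := by
          refine eLpNorm_congr_ae ?_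
          filter_upwards [Lp.coeFn_smul c u] with x hx
          simp only [hx, Pi.smul_apply, smul_sub]
      _ ≤ ‖c‖ₑ * (ε / (‖c‖ₑ + 1)) := by rw [eLpNorm_const_smul]; gcongr
      _ ≤ ε := hc
  · calc _ = eLpNorm (c • (fun x ↦ Z x - J x (grad f x))) 2 (area M) := by
          refine eLpNorm_congr_ae ?_
          filter_upwards [Lp.coeFn_smul c Z] with x hx
          simp only [hx, Pi.smul_apply, smul_sub, grad_smul c hf, map_smul]
      _ ≤ ‖c‖ₑ * (ε / (‖c‖ₑ + 1)) := by rw [eLpNorm_const_smul]; gcongr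
      _ ≤ ε := hc
  · calc _ = eLpNorm (c • (fun x ↦ h x - f x)) 2 (boundaryLength M) := by
          refine eLpNorm_congr_ae ?_
          filter_upwards [Lp.coeFn_smul c h] with x hx
          simp only [hx, Pi.smul_apply, smul_sub]
      _ ≤ ‖c‖ₑ * (ε / (‖c‖ₑ + 1)) := by rw [eLpNorm_const_smul]; gcongr
      _ ≤ ε := hc

lemma zero (hJ : IsMeasurableFrame J) : IsTraceTriple J 0 0 (0 : Lp ℝ 2 (boundaryLength M)) := by
  have hgrad : ∀ x, grad (0 : M → ℝ) x = 0 := fun x ↦ by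
    have := grad_smul (0 : ℝ) (contMDiff_const (c := (0 : ℝ)) (I := 𝓡∂ 2) (M := M)) x
    simpa using! this
  have e : ∀ {F : Type _} [NormedAddCommGroup F] {μ : Measure M} {g : M → F}, g =ᵐ[μ] 0 →
      eLpNorm g 2 μ = 0 := fun hg ↦ by rw [eLpNorm_congr_ae hg, eLpNorm_zero]
  refine ⟨?_, fun ε _ ↦ ⟨0, contMDiff_const, ?_, ?_, ?_⟩⟩
  · obtain ⟨S, hS⟩ := exists_functionals_weakGraph hJ
    rw [hS]
    exact fun l _ ↦ map_zero l
  · rw [e]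
    · exact zero_le
    · filter_upwards [Lp.coeFn_zero ℝ 2 (area M)] with x hx
      change _ - (0 : ℝ) = 0
      rw [hx]; simp
  · rw [e]
    · exact zero_le
    · filter_upwards [Lp.coeFn_zero Plane 2 (area M)] with x hx
      rw [hx, hgrad, map_zero]; simp
  · rw [e]
    · exact zero_le
    · filter_upwards [Lp.coeFn_zero ℝ 2 (boundaryLength M)] with x hx
      change _ - (0 : ℝ) = 0
      rw [hx]; simp

/-- Having a given trace is a closed condition. -/
lemma of_approx (hJ : IsMeasurableFrame J)
    (H : ∀ ε : ℝ≥0∞, 0 < ε → ∃ u' Z', IsTraceTriple J u' Z' h ∧ ‖u - u'‖ₑ ≤ ε ∧ ‖Z - Z'‖ₑ ≤ ε) :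
    IsTraceTriple J u Z h := by
  constructor
  · rw [← (isClosed_weakGraph hJ).closure_eq, EMetric.mem_closure_iff]
    intro ε hε
    obtain ⟨δ, hδ, hδε⟩ := exists_between hε
    obtain ⟨u', Z', H', h1, h2⟩ := H δ hδ
    refine ⟨(u', Z'), H'.1, lt_of_le_of_lt ?_ hδε⟩
    rw [Prod.edist_eq]
    simp only [edist_eq_enorm_sub]
    exact max_le h1 h2
  · intro ε hε
    have hε2 : 0 < ε / 2 := ENNReal.half_pos hε.ne'
    obtain ⟨u', Z', H', h1, h2⟩ := H (ε / 2) hε2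
    obtain ⟨f, hf, a1, a2, a3⟩ := H'.2 (ε / 2) hε2
    have hfm := hf.continuous.measurable
    rw [Lp.enorm_def] at h1 h2
    refine ⟨f, hf, ?_, ?_, a3.trans ENNReal.half_le_self⟩
    · calc _ = eLpNorm (⇑(u - u') + (fun x ↦ u' x - f x)) 2 (area M) := by
            refine eLpNorm_congr_ae ?_
            filter_upwards [Lp.coeFn_sub u u'] with x hx
            simp only [hx, Pi.add_apply, Pi.sub_apply]; ring
        _ ≤ _ := eLpNorm_add_le (Lp.aestronglyMeasurable _)
          ((Lp.aestronglyMeasurable u').sub hfm.aestronglyMeasurable) one_le_two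
        _ ≤ ε / 2 + ε / 2 := add_le_add h1 a1
        _ = ε := ENNReal.add_halves ε
    · calc _ = eLpNorm (⇑(Z - Z') + (fun x ↦ Z' x - J x (grad f x))) 2 (area M) := by
            refine eLpNorm_congr_ae ?_
            filter_upwards [Lp.coeFn_sub Z Z'] with x hx
            simp only [hx, Pi.add_apply, Pi.sub_apply]; abel
        _ ≤ _ := eLpNorm_add_le (Lp.aestronglyMeasurable _)
          ((Lp.aestronglyMeasurable Z').sub (aemeasurable_grad hJ hf).aestronglyMeasurable)
          one_le_two
        _ ≤ ε / 2 + ε / 2 := add_le_add h2 a2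
        _ = ε := ENNReal.add_halves ε

end IsTraceTriple

end Trace

/-! ### Quantitative Rellich theorem on the surface. -/

section Compactness

lemma ofReal_mul_enorm_sq (c a : ℝ) :
    ENNReal.ofReal c * ‖a‖ₑ ^ 2 = ENNReal.ofReal ((√c * a) ^ 2) := by
  have hc : ENNReal.ofReal c = ENNReal.ofReal (√c ^ 2) := by
    rcases le_total 0 c with h | h
    · rw [Real.sq_sqrt h]
    · rw [Real.sqrt_eq_zero_of_nonpos h, ENNReal.ofReal_of_nonpos h]; simp
  rw [hc, mul_pow, ENNReal.ofReal_mul (sq_nonneg _), ← ofReal_norm,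
    ← ENNReal.ofReal_pow (norm_nonneg _), Real.norm_eq_abs, sq_abs]

variable {M : Type*} [EMetricSpace M] [ChartedSpace (EuclideanHalfSpace 2) M]
  [IsManifold (𝓡∂ 2) ∞ M] [RiemannianBundle (fun x : M ↦ TangentSpace (𝓡∂ 2) x)]
  [MeasurableSpace M] [BorelSpace M]
  [IsContinuousRiemannianBundle Plane (fun x : M ↦ TangentSpace (𝓡∂ 2) x)]
  [CompactSpace M] [Nonempty M] [IsRiemannianManifold (𝓡∂ 2) M]
  {J : (x : M) → TangentSpace (𝓡∂ 2) x ≃ₗᵢ[ℝ] Plane}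

lemma enorm_grad_eq (f : M → ℝ) (x : M) : ‖J x (grad f x)‖ₑ = ‖grad f x‖ₑ :=
  (J x).toLinearIsometry.enorm_map _

lemma aemeasurable_enorm_grad {f : M → ℝ} (hf : ContMDiff (𝓡∂ 2) 𝓘(ℝ, ℝ) ∞ f) :
    AEMeasurable (fun x ↦ ‖grad f x‖ₑ) (area M) := by
  obtain ⟨J, hJ⟩ := exists_isMeasurableFrame M
  simpa only [enorm_grad_eq] using (aemeasurable_grad hJ hf).enorm

/-- Makes the planar cell averages of `exists_finite_averages` continuous on `L²` of the surface. -/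
lemma exists_average_functional {p : M} {B Q : Set Plane} (hB : IsCompact B)
    (hBt : B ⊆ (extChartAt (𝓡∂ 2) p).target) (hQB : Q ⊆ B) :
    ∃ l : Lp ℝ 2 (area M) →L[ℝ] ℝ, ∀ (f : M → ℝ) (F : Lp ℝ 2 (area M)), F =ᵐ[area M] f →
      l F = ∫ y in Q, f ((extChartAt (𝓡∂ 2) p).symm y) := by
  have : IsFiniteMeasure (area M) := isFiniteMeasure_area
  obtain ⟨C, hC⟩ := exists_map_symm_le hB hBt
  have hBm := aemeasurable_extChartAt_symm hB hBt
  have hQm : AEMeasurable (extChartAt (𝓡∂ 2) p).symm (volume.restrict Q) :=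
    hBm.mono_measure (Measure.restrict_mono hQB le_rfl)
  have hν : (volume.restrict Q).map (extChartAt (𝓡∂ 2) p).symm ≤ C • area M :=
    (Measure.map_mono_of_aemeasurable (Measure.restrict_mono hQB le_rfl) hBm).trans hC
  obtain ⟨l, hl⟩ := exists_integral_inner_functional (F := ℝ) (w := fun _ ↦ (1 : ℝ)) (R := 1) hν
    aestronglyMeasurable_const (by simp)
  have hac : (volume.restrict Q).map (extChartAt (𝓡∂ 2) p).symm ≪ area M :=
    (Measure.absolutelyContinuous_of_le hν).trans
      (Measure.smul_absolutelyContinuous (c := (C : ℝ≥0∞)))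
  refine ⟨l, fun f F hF ↦ ?_⟩
  have hf : AEStronglyMeasurable f ((volume.restrict Q).map (extChartAt (𝓡∂ 2) p).symm) :=
    ((Lp.aestronglyMeasurable F).mono_ac hac).congr (hac.ae_eq hF)
  rw [← integral_map hQm hf, hl]
  refine integral_congr_ae ?_
  filter_upwards [hac.ae_eq hF] with x hx
  simp [hx]

/-- On `U`, smooth functions satisfy a Poincaré inequality with arbitrarily small constant, up to
finitely many continuous functionals. -/
def HasSmallPoincare (U : Set M) : Prop :=
  ∀ δ : ℝ, 0 < δ → ∃ L : List (Lp ℝ 2 (area M) →L[ℝ] ℝ), ∀ (f : M → ℝ) (F : Lp ℝ 2 (area M)),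
    ContMDiff (𝓡∂ 2) 𝓘(ℝ, ℝ) ∞ f → F =ᵐ[area M] f →
      ∫⁻ x in U, ‖f x‖ₑ ^ 2 ∂(area M) ≤ ENNReal.ofReal (L.map fun l ↦ l F ^ 2).sum +
        ENNReal.ofReal δ * ∫⁻ x, ‖grad f x‖ₑ ^ 2 ∂(area M)

lemma list_sum_sq_nonneg (L : List (Lp ℝ 2 (area M) →L[ℝ] ℝ)) (F : Lp ℝ 2 (area M)) :
    0 ≤ (L.map fun l ↦ l F ^ 2).sum := by
  refine List.sum_nonneg fun a ha ↦ ?_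
  obtain ⟨l, -, rfl⟩ := List.mem_map.1 ha
  positivity

/-- One factor `C²` compares the Euclidean and Riemannian norms of the differential, the other
compares the measures. -/
lemma IsPatch.lintegral_enorm_fderivWithin_le {p : M} {B : Set Plane} {C : ℝ≥0}
    (hP : IsPatch p B C) {f : M → ℝ} (hf : ContMDiff (𝓡∂ 2) 𝓘(ℝ, ℝ) ∞ f) :
    ∫⁻ y in B, ‖fderivWithin ℝ (f ∘ (extChartAt (𝓡∂ 2) p).symm)
      (extChartAt (𝓡∂ 2) p).target y‖ₑ ^ 2 ≤
      (C : ℝ≥0∞) ^ 4 * ∫⁻ x, ‖grad f x‖ₑ ^ 2 ∂(area M) := by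
  have hpt : ∀ y ∈ B, ‖fderivWithin ℝ (f ∘ (extChartAt (𝓡∂ 2) p).symm)
      (extChartAt (𝓡∂ 2) p).target y‖ₑ ^ 2 ≤
        (C : ℝ≥0∞) ^ 2 * ‖grad f ((extChartAt (𝓡∂ 2) p).symm y)‖ₑ ^ 2 := by
    intro y hy
    have h1 : ‖fderivWithin ℝ (f ∘ (extChartAt (𝓡∂ 2) p).symm)
        (extChartAt (𝓡∂ 2) p).target y‖ ≤ C * ‖grad f ((extChartAt (𝓡∂ 2) p).symm y)‖ := by
      refine ContinuousLinearMap.opNorm_le_bound _ (by positivity) fun e ↦ ?_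
      rw [fderivWithin_comp_symm hf (hP.subset hy)]
      refine (norm_inner_le_norm _ _).trans ?_
      have := hP.norm_le _ (mem_image_of_mem _ hy) e
      calc _ ≤ ‖grad f ((extChartAt (𝓡∂ 2) p).symm y)‖ * (C * ‖e‖) := by gcongr
        _ = _ := by ring
    have h2 := ENNReal.ofReal_le_ofReal h1
    rw [ENNReal.ofReal_mul C.coe_nonneg, ENNReal.ofReal_coe_nnreal, ofReal_norm,
      ofReal_norm] at h2
    rw [← mul_pow]
    gcongr
  have hm : AEMeasurable (fun x : M ↦ ‖grad f x‖ₑ ^ 2) (area M) :=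
    (aemeasurable_enorm_grad hf).pow_const 2
  calc _ ≤ ∫⁻ y in B, (C : ℝ≥0∞) ^ 2 * ‖grad f ((extChartAt (𝓡∂ 2) p).symm y)‖ₑ ^ 2 :=
        setLIntegral_mono_ae' hP.isCompact.measurableSet (ae_of_all _ hpt)
    _ = (C : ℝ≥0∞) ^ 2 * ∫⁻ y in B, ‖grad f ((extChartAt (𝓡∂ 2) p).symm y)‖ₑ ^ 2 :=
        lintegral_const_mul' _ _ (by finiteness)
    _ ≤ (C : ℝ≥0∞) ^ 2 * ((C : ℝ≥0∞) ^ 2 * ∫⁻ x in (extChartAt (𝓡∂ 2) p).symm '' B,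
          ‖grad f x‖ₑ ^ 2 ∂(area M)) := by
        gcongr
        exact hP.lintegral_symm_le hm
    _ ≤ (C : ℝ≥0∞) ^ 2 * ((C : ℝ≥0∞) ^ 2 * ∫⁻ x, ‖grad f x‖ₑ ^ 2 ∂(area M)) := by
        gcongr
        exact Measure.restrict_le_self
    _ = _ := by ring

lemma IsPatch.hasSmallPoincare {p : M} {B : Set Plane} {C : ℝ≥0} (hP : IsPatch p B C) :
    HasSmallPoincare ((extChartAt (𝓡∂ 2) p).symm '' B) := by
  intro δ hδ
  have hC6 : (0 : ℝ) < C ^ 6 + 1 := by positivity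
  obtain ⟨t, Q, c, hQ, hest⟩ :=
    -- Transfer to the surface costs `C²` for the function and `C⁴` for the gradient, hence `C⁶`;
    -- the `+ 1` keeps the denominator positive.
    exists_finite_averages hP.isCompact hP.convex (div_pos hδ hC6)
  choose l hl using fun k ↦ exists_average_functional hP.isCompact hP.subset (hQ k).2
  refine ⟨t.toList.map fun k ↦ (C * √(c k)) • l k, fun f F hf hF ↦ ?_⟩
  have hg := contDiffOn_comp_symm hf p
  have h1 := hest _ _ (uniqueDiffOn_extChartAt_target p) (hg.of_le (by simp)) hP.subset
  have hsum : ENNReal.ofReal ((t.toList.map fun k ↦ (C * √(c k)) • l k).map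
      fun l ↦ l F ^ 2).sum = (C : ℝ≥0∞) ^ 2 * ∑ k ∈ t, ENNReal.ofReal (c k) *
        ‖∫ y in Q k, (f ∘ (extChartAt (𝓡∂ 2) p).symm) y‖ₑ ^ 2 := by
    rw [List.map_map, Finset.sum_map_toList, ENNReal.ofReal_sum_of_nonneg
      (fun k _ ↦ by simp only [Function.comp_apply]; positivity), Finset.mul_sum]
    refine Finset.sum_congr rfl fun k _ ↦ ?_
    simp only [Function.comp_apply, smul_apply, smul_eq_mul]
    rw [ofReal_mul_enorm_sq, hl k f F hF, mul_assoc, mul_pow, ENNReal.ofReal_mul (sq_nonneg _),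
      ENNReal.ofReal_pow C.coe_nonneg, ENNReal.ofReal_coe_nnreal]
  have hδ' : (C : ℝ≥0∞) ^ 2 * (ENNReal.ofReal (δ / (C ^ 6 + 1)) * (C : ℝ≥0∞) ^ 4) ≤
      ENNReal.ofReal δ := by
    rw [← ENNReal.ofReal_coe_nnreal, ← ENNReal.ofReal_pow C.coe_nonneg,
      ← ENNReal.ofReal_pow C.coe_nonneg, ← ENNReal.ofReal_mul (by positivity),
      ← ENNReal.ofReal_mul (by positivity)]
    refine ENNReal.ofReal_le_ofReal ?_
    rw [div_mul_eq_mul_div, mul_div_assoc', div_le_iff₀ hC6]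
    nlinarith
  calc _ ≤ (C : ℝ≥0∞) ^ 2 * ∫⁻ y in B, ‖f ((extChartAt (𝓡∂ 2) p).symm y)‖ₑ ^ 2 :=
        hP.lintegral_le (F := fun x ↦ ‖f x‖ₑ ^ 2)
          ((ENNReal.continuous_pow 2).comp hf.continuous.enorm)
    _ ≤ (C : ℝ≥0∞) ^ 2 * (∑ k ∈ t, ENNReal.ofReal (c k) *
          ‖∫ y in Q k, (f ∘ (extChartAt (𝓡∂ 2) p).symm) y‖ₑ ^ 2 +
          ENNReal.ofReal (δ / (C ^ 6 + 1)) *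
          ((C : ℝ≥0∞) ^ 4 * ∫⁻ x, ‖grad f x‖ₑ ^ 2 ∂(area M))) := by
        gcongr
        refine h1.trans ?_
        gcongr
        exact hP.lintegral_enorm_fderivWithin_le hf
    _ = ENNReal.ofReal ((t.toList.map fun k ↦ (C * √(c k)) • l k).map fun l ↦ l F ^ 2).sum +
          (C : ℝ≥0∞) ^ 2 * (ENNReal.ofReal (δ / (C ^ 6 + 1)) * (C : ℝ≥0∞) ^ 4) *
            ∫⁻ x, ‖grad f x‖ₑ ^ 2 ∂(area M) := by
        rw [hsum]; ring
    _ ≤ _ := by gcongr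

-- The property is inherited by subsets and by unions: the lists of functionals are concatenated,
-- and `δ` is split in two since both gradient terms are over the whole surface. Compactness and the
-- patches do the rest.
variable (M) in
lemma hasSmallPoincare_univ : HasSmallPoincare (univ : Set M) := by
  refine isCompact_univ.induction_on (p := HasSmallPoincare) ?_ ?_ ?_ ?_
  · exact fun δ _ ↦ ⟨[], fun f F _ _ ↦ by simp⟩
  · intro U U' hU h δ hδ
    obtain ⟨L, hL⟩ := h δ hδ
    exact ⟨L, fun f F hf hF ↦ (lintegral_mono_set hU).trans (hL f F hf hF)⟩
  · intro U U' h h' δ hδ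
    obtain ⟨L, hL⟩ := h (δ / 2) (half_pos hδ)
    obtain ⟨L', hL'⟩ := h' (δ / 2) (half_pos hδ)
    refine ⟨L ++ L', fun f F hf hF ↦ ?_⟩
    refine (lintegral_union_le _ U U').trans ((add_le_add (hL f F hf hF) (hL' f F hf hF)).trans ?_)
    rw [List.map_append, List.sum_append,
      ENNReal.ofReal_add (list_sum_sq_nonneg L F) (list_sum_sq_nonneg L' F)]
    have : ENNReal.ofReal δ = ENNReal.ofReal (δ / 2) + ENNReal.ofReal (δ / 2) := by
      rw [← ENNReal.ofReal_add (half_pos hδ).le (half_pos hδ).le, add_halves]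
    rw [this]
    exact le_of_eq (by ring)
  · intro x _
    obtain ⟨B, C, hP, hn, -⟩ := exists_isPatch (mem_chart_source (EuclideanHalfSpace 2) x)
    exact ⟨_, mem_nhdsWithin_of_mem_nhds hn, hP.hasSmallPoincare⟩

lemma ofReal_norm_sq {E : Type*} [NormedAddCommGroup E] (x : E) :
    ENNReal.ofReal (‖x‖ ^ 2) = ‖x‖ₑ ^ 2 := by
  rw [ENNReal.ofReal_pow (norm_nonneg _), ofReal_norm]

variable (J) in
lemma exists_functionals_smooth {δ : ℝ} (hδ : 0 < δ) :
    ∃ (m : ℕ) (l : Fin m → (Lp ℝ 2 (area M) →L[ℝ] ℝ)), ∀ (f : M → ℝ) (F : Lp ℝ 2 (area M))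
      (G : Lp Plane 2 (area M)), ContMDiff (𝓡∂ 2) 𝓘(ℝ, ℝ) ∞ f → F =ᵐ[area M] f →
      G =ᵐ[area M] (fun x ↦ J x (grad f x)) → ‖F‖ ^ 2 ≤ δ * ‖G‖ ^ 2 + ∑ j, l j F ^ 2 := by
  obtain ⟨L, hL⟩ := hasSmallPoincare_univ M δ hδ
  refine ⟨L.length, L.get, fun f F G hf hF hG ↦ ?_⟩
  have h := hL f F hf hF
  have hF2 : ∫⁻ x, ‖f x‖ₑ ^ 2 ∂(area M) = ‖F‖ₑ ^ 2 := by
    rw [Lp.enorm_def, eLpNorm_two_sq]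
    exact lintegral_congr_ae (hF.mono fun x hx ↦ by simp only [hx])
  have hG2 : ∫⁻ x, ‖grad f x‖ₑ ^ 2 ∂(area M) = ‖G‖ₑ ^ 2 := by
    rw [Lp.enorm_def, eLpNorm_two_sq]
    exact lintegral_congr_ae (hG.mono fun x hx ↦ by simp only [hx, enorm_grad_eq])
  rw [Measure.restrict_univ, hF2, hG2, ← ofReal_norm_sq, ← ofReal_norm_sq,
    ← ENNReal.ofReal_mul hδ.le, ← ENNReal.ofReal_add (list_sum_sq_nonneg L F) (by positivity),
    ENNReal.ofReal_le_ofReal_iff (add_nonneg (list_sum_sq_nonneg L F) (by positivity))] at h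
  have hsum : ∑ j, (L.get j) F ^ 2 = (L.map fun l ↦ l F ^ 2).sum :=
    Fin.sum_univ_fun_getElem L fun l ↦ l F ^ 2
  rw [hsum]
  linarith

/-- A quantitative Rellich theorem: up to finitely many functionals, the `L²` norm of a function is
controlled by a small multiple of the norm of its gradient. -/
lemma exists_functionals_traceTriple (hJ : IsMeasurableFrame J) {δ : ℝ} (hδ : 0 < δ) :
    ∃ (m : ℕ) (l : Fin m → (Lp ℝ 2 (area M) →L[ℝ] ℝ)), ∀ u Z h, IsTraceTriple J u Z h →
      ‖u‖ ^ 2 ≤ δ * ‖Z‖ ^ 2 + ∑ j, l j u ^ 2 := by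
  obtain ⟨m, l, hl⟩ := exists_functionals_smooth J hδ
  refine ⟨m, l, fun u Z h H ↦ ?_⟩
  -- The shift by one keeps every tolerance finite, so that the differences are in `L²`.
  choose f hf h1 h2 _ using fun n : ℕ ↦ H.2 ((n : ℝ≥0∞) + 1)⁻¹ (by simp)
  have hlim : Tendsto (fun n : ℕ ↦ ((n : ℝ≥0∞) + 1)⁻¹) atTop (𝓝 0) := by
    have := (tendsto_add_atTop_iff_nat 1).2 ENNReal.tendsto_inv_nat_nhds_zero
    simpa using! this
  have hfin : ∀ n : ℕ, ((n : ℝ≥0∞) + 1)⁻¹ < ⊤ := fun n ↦ by simp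
  have m1 : ∀ n, MemLp (fun x ↦ u x - f n x) 2 (area M) := fun n ↦
    ⟨(Lp.aestronglyMeasurable u).sub (hf n).continuous.measurable.aestronglyMeasurable,
      (h1 n).trans_lt (hfin n)⟩
  have m2 : ∀ n, MemLp (fun x ↦ Z x - J x (grad (f n) x)) 2 (area M) := fun n ↦
    ⟨(Lp.aestronglyMeasurable Z).sub (aemeasurable_grad hJ (hf n)).aestronglyMeasurable,
      (h2 n).trans_lt (hfin n)⟩
  -- The `L²` class of the approximant is obtained as `w` minus the class of the error; both sides
  -- of the inequality are continuous along this sequence.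
  have key : ∀ {F : Type} [NormedAddCommGroup F] (w : Lp F 2 (area M)) (g : ℕ → M → F)
      (hm : ∀ n, MemLp (fun x ↦ w x - g n x) 2 (area M)),
      (∀ n, eLpNorm (fun x ↦ w x - g n x) 2 (area M) ≤ ((n : ℝ≥0∞) + 1)⁻¹) →
      Tendsto (fun n ↦ w - (hm n).toLp _) atTop (𝓝 w) := by
    intro F _ w g hm hle
    rw [tendsto_iff_edist_tendsto_0]
    refine tendsto_of_tendsto_of_tendsto_of_le_of_le tendsto_const_nhds hlim
      (fun _ ↦ zero_le) fun n ↦ ?_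
    rw [edist_comm, edist_eq_enorm_sub, sub_sub_cancel, Lp.enorm_toLp]
    exact hle n
  have t1 := key u f m1 h1
  have t2 := key Z (fun n x ↦ J x (grad (f n) x)) m2 h2
  refine le_of_tendsto_of_tendsto (t1.norm.pow 2) (((t2.norm.pow 2).const_mul δ).add
    (tendsto_finsetSum _ fun j _ ↦ (((l j).continuous.tendsto u).comp t1).pow 2))
    (Eventually.of_forall fun n ↦ hl (f n) _ _ (hf n) ?_ ?_)
  · filter_upwards [Lp.coeFn_sub u ((m1 n).toLp _), (m1 n).coeFn_toLp] with x e1 e2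
    rw [e1, Pi.sub_apply, e2, sub_sub_cancel]
  · filter_upwards [Lp.coeFn_sub Z ((m2 n).toLp _), (m2 n).coeFn_toLp] with x e1 e2
    rw [e1, Pi.sub_apply, e2, sub_sub_cancel]

end Compactness

/-! ### Multiplication by `V` as a symmetric operator on `L²`. -/

section Multiplication

lemma exists_multiplication_operator {α : Type*} [MeasurableSpace α] {μ : Measure α} {V : α → ℝ}
    (hV : MemLp V ⊤ μ) :
    ∃ A : Lp ℝ 2 μ →L[ℝ] Lp ℝ 2 μ, ∀ u, A u =ᵐ[μ] fun x ↦ V x * u x := by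
  refine ⟨(ContinuousLinearMap.mul ℝ ℝ).holderL μ ⊤ 2 2 (hV.toLp V), fun u ↦ ?_⟩
  filter_upwards [(ContinuousLinearMap.mul ℝ ℝ).coeFn_holder (r := 2) (hV.toLp V) u,
    hV.coeFn_toLp] with x h1 h2
  rw [← h2]
  exact h1

variable {α : Type*} [MeasurableSpace α] {μ : Measure α} {V : α → ℝ}
  {A : Lp ℝ 2 μ →L[ℝ] Lp ℝ 2 μ}

lemma inner_eq_integral_mul (u v : Lp ℝ 2 μ) : inner ℝ u v = ∫ x, u x * v x ∂μ := by
  rw [L2.inner_def]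
  exact integral_congr_ae (ae_of_all _ fun x ↦ by simp [mul_comm])

lemma inner_multiplication (hA : ∀ u, A u =ᵐ[μ] fun x ↦ V x * u x) (u v : Lp ℝ 2 μ) :
    inner ℝ (A u) v = ∫ x, V x * u x * v x ∂μ := by
  rw [inner_eq_integral_mul]
  refine integral_congr_ae ?_
  filter_upwards [hA u] with x hx
  rw [hx]

lemma inner_multiplication_comm (hA : ∀ u, A u =ᵐ[μ] fun x ↦ V x * u x) (u v : Lp ℝ 2 μ) :
    inner ℝ (A u) v = inner ℝ u (A v) := by
  rw [real_inner_comm (A v), inner_multiplication hA, inner_multiplication hA]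
  exact integral_congr_ae (ae_of_all _ fun x ↦ by simp only; ring)

end Multiplication

/-! ### The Dirichlet principle. -/

section Main

variable {M : Type*} [EMetricSpace M] [ChartedSpace (EuclideanHalfSpace 2) M]
  [IsManifold (𝓡∂ 2) ∞ M] [RiemannianBundle (fun x : M ↦ TangentSpace (𝓡∂ 2) x)]
  [MeasurableSpace M] [BorelSpace M]
  [IsContinuousRiemannianBundle Plane (fun x : M ↦ TangentSpace (𝓡∂ 2) x)]
  [CompactSpace M] [Nonempty M] [IsRiemannianManifold (𝓡∂ 2) M]
  {J : (x : M) → TangentSpace (𝓡∂ 2) x ≃ₗᵢ[ℝ] Plane}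
  {V : M → ℝ} {A : Lp ℝ 2 (area M) →L[ℝ] Lp ℝ 2 (area M)}
  {u v : Lp ℝ 2 (area M)} {Z W : Lp Plane 2 (area M)} {h : Lp ℝ 2 (boundaryLength M)}

lemma integral_inner_weakGrad (hJ : IsMeasurableFrame J) (hu : (u, Z) ∈ weakGraph J)
    (hv : (v, W) ∈ weakGraph J) :
    ∫ x, inner ℝ (weakGrad u x) (weakGrad v x) ∂(area M) = inner ℝ Z W := by
  rw [L2.inner_def]
  refine integral_congr_ae ?_
  filter_upwards [ae_eq_weakGrad hJ hu, ae_eq_weakGrad hJ hv] with x hx hx'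
  rw [hx, hx']
  exact ((J x).inner_map_map _ _).symm

lemma energy_eq (hJ : IsMeasurableFrame J) (hA : ∀ u, A u =ᵐ[area M] fun x ↦ V x * u x)
    (hu : (u, Z) ∈ weakGraph J) : energy V u = inner ℝ Z Z - inner ℝ (A u) u := by
  rw [inner_multiplication hA, ← integral_inner_weakGrad hJ hu hu, energy]
  congr 1
  · exact integral_congr_ae (ae_of_all _ fun x ↦ (real_inner_self_eq_norm_sq _).symm)
  · exact integral_congr_ae (ae_of_all _ fun x ↦ by simp only; ring)

lemma isWeakSolution_iff (hJ : IsMeasurableFrame J) (hA : ∀ u, A u =ᵐ[area M] fun x ↦ V x * u x)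
    (hu : (u, Z) ∈ weakGraph J) (lam : ℝ) :
    IsWeakSolution V lam u ↔ ∀ φ W, IsTraceTriple J φ W 0 →
      inner ℝ Z W - inner ℝ (A u) φ = lam * inner ℝ u φ := by
  constructor
  · intro H φ W hφ
    have := H.2 φ ((hasTrace_iff hJ _ _).2 ⟨W, hφ⟩)
    rwa [integral_inner_weakGrad hJ hu hφ.1, ← inner_multiplication hA,
      ← inner_eq_integral_mul] at this
  · refine fun H ↦ ⟨mem_H1_of_mem_weakGraph hJ hu, fun φ hφ ↦ ?_⟩
    obtain ⟨W, hW⟩ := (hasTrace_iff hJ _ _).1 hφ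
    rw [integral_inner_weakGrad hJ hu hW.1, ← inner_multiplication hA,
      ← inner_eq_integral_mul]
    exact H φ W hW

/-- The functions in `H¹₀` together with their gradients, as a subspace of `L² × L²`. -/
def dirichletSpace (hJ : IsMeasurableFrame J) :
    Submodule ℝ (WithLp 2 (Lp ℝ 2 (area M) × Lp Plane 2 (area M))) where
  carrier := {q | IsTraceTriple J q.fst q.snd 0}
  add_mem' {q q'} hq hq' := by
    have := IsTraceTriple.add hJ hq hq'
    rwa [add_zero] at this
  zero_mem' := IsTraceTriple.zero hJ
  smul_mem' c q hq := by
    have := IsTraceTriple.smul hJ c hq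
    rwa [smul_zero] at this

lemma isClosed_dirichletSpace (hJ : IsMeasurableFrame J) :
    IsClosed (dirichletSpace hJ : Set (WithLp 2 (Lp ℝ 2 (area M) × Lp Plane 2 (area M)))) := by
  refine isClosed_of_closure_subset fun q hq ↦ ?_
  refine IsTraceTriple.of_approx hJ fun ε hε ↦ ?_
  obtain ⟨δ, hδ, hδε⟩ := exists_between hε
  obtain ⟨q', hq', hd⟩ := EMetric.mem_closure_iff.1 hq ε hε
  rw [edist_eq_enorm_sub] at hd
  refine ⟨q'.fst, q'.snd, hq', ?_, ?_⟩
  · exact (enorm_le_iff_norm_le.2 (WithLp.norm_fst_le _ (q - q'))).trans hd.le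
  · exact (enorm_le_iff_norm_le.2 (WithLp.norm_snd_le _ (q - q'))).trans hd.le

/-- The form `∫ ⟨∇u, ∇v⟩ - ∫ V u v` is positive on `H¹₀`, and represents every functional there. -/
lemma exists_representation (hJ : IsMeasurableFrame J)
    (hA : ∀ u, A u =ᵐ[area M] fun x ↦ V x * u x) (hpos : 0 < firstDirichletEigenvalue V) :
    (∀ d E, IsTraceTriple J d E 0 → inner ℝ E E - inner ℝ (A d) d ≤ 0 → d = 0) ∧
    ∀ (v : Lp ℝ 2 (area M)) (W : Lp Plane 2 (area M)), ∃ d E, IsTraceTriple J d E 0 ∧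
      ∀ φ F, IsTraceTriple J φ F 0 →
        inner ℝ E F - inner ℝ (A d) φ = inner ℝ W F - inner ℝ v φ := by
  have : CompleteSpace (dirichletSpace hJ) :=
    (isClosed_dirichletSpace hJ).completeSpace_coe
  set T : dirichletSpace hJ →L[ℝ] Lp ℝ 2 (area M) :=
    (WithLp.fstL 2 ℝ _ _).comp (dirichletSpace hJ).subtypeL
  set S : dirichletSpace hJ →L[ℝ] Lp Plane 2 (area M) :=
    (WithLp.sndL 2 ℝ _ _).comp (dirichletSpace hJ).subtypeL
  have hTS : ∀ q, IsTraceTriple J (T q) (S q) 0 := fun q ↦ q.2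
  have hgraph : ∀ q, T q = 0 → S q = 0 := fun q hq ↦ by
    have := (hTS q).1
    rw [hq] at this
    exact eq_zero_of_mem_weakGraph hJ this
  have hnorm : ∀ q, ‖q‖ ^ 2 = ‖T q‖ ^ 2 + ‖S q‖ ^ 2 := fun q ↦
    WithLp.prod_norm_sq_eq_of_L2 _
  have hT : ∀ q, T q = 0 → q = 0 := fun q hq ↦ by
    have := hnorm q
    rw [hq, hgraph q hq] at this
    simpa using this
  -- The real `sInf` of a set unbounded below is `0` by convention, so positivity already excludes
  -- that case.
  have hbdd : BddBelow (dirichletEigenvalues V) := by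
    by_contra hb
    rw [firstDirichletEigenvalue, Real.sInf_of_not_bddBelow hb] at hpos
    exact hpos.false
  -- An eigenvector of the abstract form is a weak Dirichlet eigenfunction, so its eigenvalue is at
  -- least the first one.
  have heig : ∀ (μ : ℝ) (q : dirichletSpace hJ), q ≠ 0 →
      (∀ z, formBilin T S A q z = μ * inner ℝ (T q) (T z)) → 0 < μ := by
    intro μ q hq hz
    refine hpos.trans_le (csInf_le hbdd ⟨T q, (hasTrace_iff hJ _ _).2 ⟨S q, hTS q⟩,
      fun h0 ↦ hq (hT q h0), ?_⟩)
    rw [isWeakSolution_iff hJ hA (hTS q).1]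
    exact fun φ F hφ ↦ hz ⟨WithLp.toLp 2 (φ, F), hφ⟩
  have hcomp : ∀ ε > 0, ∃ (m : ℕ) (l : Fin m → (Lp ℝ 2 (area M) →L[ℝ] ℝ)), ∀ q,
      ‖T q‖ ^ 2 ≤ ε * ‖S q‖ ^ 2 + ∑ j, l j (T q) ^ 2 := fun ε hε ↦ by
    obtain ⟨m, l, hl⟩ := exists_functionals_traceTriple hJ hε
    exact ⟨m, l, fun q ↦ hl _ _ _ (hTS q)⟩
  obtain ⟨h1, h2⟩ := form_pos_and_representation (inner_multiplication_comm hA) hnorm hcomp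
    hgraph heig
  refine ⟨fun d E hd hle ↦ ?_, fun v W ↦ ?_⟩
  · by_contra hne
    set q : dirichletSpace hJ := ⟨WithLp.toLp 2 (d, E), hd⟩
    refine (h1 q fun hq ↦ hne ?_).not_ge hle
    exact congrArg T hq |>.trans (map_zero T)
  · obtain ⟨q, hq⟩ := h2 (((innerSL ℝ) W).comp S - ((innerSL ℝ) v).comp T)
    exact ⟨T q, S q, hTS q, fun φ F hφ ↦ hq ⟨WithLp.toLp 2 (φ, F), hφ⟩⟩

theorem dirichlet_principle_of_nonempty (hV : MemLp V ⊤ (area M))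
    (hpos : 0 < firstDirichletEigenvalue V) (hh : h ∈ HHalf) :
    ∃ u : Lp ℝ 2 (area M),
      (u ∈ traceClass h ∧ IsMinOn (energy V) (traceClass h) u) ∧
      (∀ w ∈ traceClass h, IsMinOn (energy V) (traceClass h) w → w = u) ∧
      IsWeakSolution V 0 u ∧ (∀ w ∈ traceClass h, IsWeakSolution V 0 w → w = u) := by
  obtain ⟨J, hJ⟩ := exists_isMeasurableFrame M
  obtain ⟨A, hA⟩ := exists_multiplication_operator hV
  obtain ⟨hdef, hrep⟩ := exists_representation hJ hA hpos
  obtain ⟨u₀, hu₀⟩ := hh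
  obtain ⟨Z₀, H₀⟩ := (hasTrace_iff hJ _ _).1 hu₀
  -- The functional represented is `φ ↦ -B(u₀, φ)`, so the correction `d₀` turns `u₀` into a weak
  -- solution.
  obtain ⟨d₀, E₀, hd₀, hrep⟩ := hrep (-(A u₀)) (-Z₀)
  set u := u₀ + d₀
  set Z := Z₀ + E₀
  have H : IsTraceTriple J u Z h := by
    have := IsTraceTriple.add hJ H₀ hd₀
    rwa [add_zero] at this
  have hweak : ∀ φ F, IsTraceTriple J φ F 0 → inner ℝ Z F - inner ℝ (A u) φ = 0 := by
    intro φ F hφ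
    have := hrep φ F hφ
    simp only [u, Z, map_add, inner_add_left, inner_neg_left] at this ⊢
    linarith
  -- The difference of two functions with trace `h` has trace zero by linearity of the
  -- approximations.
  have hdiff : ∀ w, w ∈ traceClass h → ∃ d E, IsTraceTriple J d E 0 ∧ w = u + d ∧
      IsTraceTriple J w (Z + E) h := by
    intro w hw
    obtain ⟨W, hW⟩ := (hasTrace_iff hJ _ _).1 hw
    have := IsTraceTriple.add hJ hW (IsTraceTriple.smul hJ (-1) H)
    simp only [neg_smul, one_smul, add_neg_cancel] at this
    refine ⟨_, _, this, by abel, ?_⟩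
    rwa [show Z + (W + -Z) = W by abel]
  -- The cross term `2 B(u, d)` vanishes by `hweak` and the symmetry of `A`.
  have henergy : ∀ d E, IsTraceTriple J d E 0 → IsTraceTriple J (u + d) (Z + E) h →
      energy V (u + d) = energy V u + (inner ℝ E E - inner ℝ (A d) d) := by
    intro d E hd hw
    have h1 := hweak d E hd
    rw [energy_eq hJ hA hw.1, energy_eq hJ hA H.1]
    simp only [map_add, inner_add_left, inner_add_right]
    rw [real_inner_comm Z E, inner_multiplication_comm hA d u, real_inner_comm (A u) d]
    linarith
  have hnn : ∀ d E, IsTraceTriple J d E 0 → 0 ≤ inner ℝ E E - inner ℝ (A d) d := by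
    intro d E hd
    by_contra! hlt
    have h0 := hdef d E hd hlt.le
    subst h0
    have : E = 0 := eq_zero_of_mem_weakGraph hJ hd.1
    subst this
    simp at hlt
  refine ⟨u, ⟨(hasTrace_iff hJ _ _).2 ⟨Z, H⟩, fun w hw ↦ ?_⟩, fun w hw hmin ↦ ?_, ?_,
    fun w hw hsol ↦ ?_⟩
  · obtain ⟨d, E, hd, rfl, hw'⟩ := hdiff w hw
    have := henergy d E hd hw'
    have := hnn d E hd
    simp only [mem_ofPred_eq]
    linarith
  · obtain ⟨d, E, hd, rfl, hw'⟩ := hdiff w hw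
    have h1 := henergy d E hd hw'
    have h2 : energy V (u + d) ≤ energy V u := hmin ((hasTrace_iff hJ _ _).2 ⟨Z, H⟩)
    rw [hdef d E hd (by linarith), add_zero]
  · exact (isWeakSolution_iff hJ hA H.1 0).2 fun φ F hφ ↦ by rw [hweak φ F hφ, zero_mul]
  · obtain ⟨d, E, hd, rfl, hw'⟩ := hdiff w hw
    have h1 := (isWeakSolution_iff hJ hA hw'.1 0).1 hsol d E hd
    have h2 := hweak d E hd
    simp only [map_add, inner_add_left] at h1
    rw [hdef d E hd (by linarith), add_zero]

end Main

end DirichletSurface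

theorem mainTheorem11 {M : Type*} [EMetricSpace M] [ChartedSpace (EuclideanHalfSpace 2) M]
    [IsManifold (𝓡∂ 2) ∞ M] [CompactSpace M]
    [RiemannianBundle (fun x : M ↦ TangentSpace (𝓡∂ 2) x)]
    [IsContMDiffRiemannianBundle (𝓡∂ 2) ∞ (EuclideanSpace ℝ (Fin 2))
      (fun x : M ↦ TangentSpace (𝓡∂ 2) x)]
    [IsRiemannianManifold (𝓡∂ 2) M] [MeasurableSpace M] [BorelSpace M]
    (V : M → ℝ) (hV : MemLp V ⊤ (DirichletSurface.area M))
    (hpos : 0 < DirichletSurface.firstDirichletEigenvalue V)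
    (h : Lp ℝ 2 (DirichletSurface.boundaryLength M)) (hh : h ∈ DirichletSurface.HHalf) :
    ∃ u : Lp ℝ 2 (DirichletSurface.area M),
      (u ∈ DirichletSurface.traceClass h ∧
        IsMinOn (DirichletSurface.energy V) (DirichletSurface.traceClass h) u) ∧
      (∀ w ∈ DirichletSurface.traceClass h,
        IsMinOn (DirichletSurface.energy V) (DirichletSurface.traceClass h) w → w = u) ∧
      DirichletSurface.IsWeakSolution V 0 u ∧
      (∀ w ∈ DirichletSurface.traceClass h, DirichletSurface.IsWeakSolution V 0 w → w = u) := by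
  have : IsContinuousRiemannianBundle (EuclideanSpace ℝ (Fin 2))
      (fun x : M ↦ TangentSpace (𝓡∂ 2) x) := by
    obtain ⟨g, g_smooth, hg⟩ := IsContMDiffRiemannianBundle.exists_contMDiff (IB := 𝓡∂ 2) (n := ∞)
      (F := EuclideanSpace ℝ (Fin 2)) (E := fun x : M ↦ TangentSpace (𝓡∂ 2) x)
    exact ⟨g, g_smooth.continuous, hg⟩
  -- On the empty surface there are no eigenvalues, and `sInf ∅ = 0` contradicts `hpos`.
  have : Nonempty M := by
    by_contra hM
    rw [not_nonempty_iff] at hM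
    have hempty : DirichletSurface.dirichletEigenvalues V = ∅ := by
      refine Set.eq_empty_of_forall_notMem fun lam ⟨u, _, hu, _⟩ ↦ hu ?_
      exact Lp.ext (ae_of_all _ fun x ↦ hM.elim x)
    rw [DirichletSurface.firstDirichletEigenvalue, hempty, Real.sInf_empty] at hpos
    exact hpos.false
  exact DirichletSurface.dirichlet_principle_of_nonempty hV hpos hh
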